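/- Let $p$ be a prime, let $n\ge 3$, and let $F(x,z)=\sum_{i=0}^n f_i x^{n-i}z^i\in\mathbb{Z}_p[x,z]$ be a binary form of degree $n$ with $f_0\neq 0$ that is primitive (its coefficients generate the unit ideal) and separable over $\mathbb{Q}_p$. Let $r\in\mathbb{Z}_p^\times$. *Notation.* Let $K_F=\mathbb{Q}_p[x]/(F(x,1))$, let $\theta$ be the image of $x$, and put $\zeta_i=\sum_{j=0}^{i-1}f_j\theta^{i-j}$ for $1\le i\le n-1$. Let $R_F\subset K_F$ be the ring with $\mathbb{Z}_p$-basis $1,\zeta_1,\dots,\zeta_{n-1}$, and for $0\le k\le n-1$ let $I_F^k\subset K_F$ be the fractional ideal of $R_F$ with $\mathbb{Z}_p$-basis $1,\theta,\dots,\theta^k,\zeta_{k+1},\dots,\zeta_{n-1}$. For $\kappa \in K_F$ let $\mathrm{N}(\kappa)$ be the norm from $K_F$ to $\mathbb{Q}_p$. A based fractional ideal of $R_F$ is an $R_F$-submodule $I\subset K_F$ with a chosen $\mathbb{Z}_p$-basis of $n$ elements; its norm $\mathrm{N}(I)$ is the determinant of the $\mathbb{Q}_p$-linear endomorphism of $K_F$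 taking the above basis of $R_F$ to the chosen basis of $I$ (so $\mathrm{N}(I_F^k)=f_0^{-k}$). Let $G_n=\mathrm{SL}_n$ if $n$ is odd and $G_n=\mathrm{SL}_n^{\pm}=\{g\in \mathrm{GL}_n:\det g=\pm1\}$ if $n$ is even. The group $G_n(\mathbb{Z}_p)$ acts on pairs $(A,B)$ of symmetric $n\times n$ matrices over $\mathbb{Z}_p$ by $g\cdot(A,B)=(gAg^T,gBg^T)$. Let $H_{F,r}$ be the set of pairs $(I,\alpha)$ of a based fractional ideal $I$ of $R_F$ and $\alpha\in K_F^\times$ with $I^2\subset\alpha I_F^{n-2}$ and $\mathrm{N}(I)^2=r\,\mathrm{N}(\alpha)\,\mathrm{N}(I_F^{n-2})$, modulo the equivalence $(I_1,\alpha_1)\sim(I_2,\alpha_2)$ if there is $\kappa\in K_F^\times$ such that $\alpha_1=\kappa^2\alpha_2$, $I_1=\kappa I_2$, and the bases of $I_1$ and $\kappa I_2$ differ by an element of $G_n(\mathbb{Z}_p)$. Let $H_{F,r}^*\subset H_{F,r}$ be the subset of classes for which $I$ is invertible. Let $\pi_{n-1},\pi_{n-2}\colon I_F^{n-2}\to\mathbb{Z}_p$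 be the $\mathbb{Z}_p$-linear maps such that $\pi_{n-1}(\zeta_{n-1})=-1$, $\pi_{n-2}(\theta^{n-2})=1$, and both vanish on the other elements of the above basis of $I_F^{n-2}$. The map $\mathsf{orb}_{F,r}$ sends the class of $(I,\alpha)$ to the $G_n(\mathbb{Z}_p)$-orbit of the pair $(A,B)$ of matrices, with respect to the chosen basis of $I$, of the bilinear forms $(\beta,\gamma)\mapsto\pi_{n-1}(\alpha^{-1}\beta\gamma)$ and $(\beta,\gamma)\mapsto\pi_{n-2}(\alpha^{-1}\beta\gamma)$ on $I$. For an abelian group $M$, written multiplicatively, let $M[2]=\{\rho\in M:\rho^2=1\}$. Call $F$ evenly ramified if $n$ is even and $F\equiv\kappa H^2\pmod p$ for some $\kappa\in(\mathbb{Z}/p\mathbb{Z})^\times$ and some $H\in(\mathbb{Z}/p\mathbb{Z})[x,z]$. Call $R_F$ maximal if it is the maximal order of $K_F$, i.e. the integral closure of $\mathbb{Z}_p$ in $K_F$. **Theorem.** The set $\mathsf{orb}_{F,r}(H_{F,r}^*)$ is in bijection with $$(R_F^\times/R_F^{\times2})_{\mathrm{N}\equiv r}=\{\rho\in R_F^\times/R_F^{\times2}:\mathrm{N}(\rho)=r\in\mathbb{Z}_p^\times/\mathbb{Z}_p^{\times2}\}.$$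 The group $R_F^\times[2]$ is finite, and $$\#\mathsf{orb}_{F,r}(H_{F,r}^*)=\#(R_F^\times/R_F^{\times2})_{\mathrm{N}\equiv r}=\begin{cases}\tfrac12\,\#R_F^\times[2]&\text{if }p>2\text{ and }F\text{ is not evenly ramified},\\ \#R_F^\times[2]&\text{if }p>2,\ F\text{ is evenly ramified, and }r\in\mathbb{Z}_p^{\times 2},\\ 0&\text{if }p>2,\ F\text{ is evenly ramified, and }r\notin\mathbb{Z}_p^{\times2},\\ 2^{n-2}\,\#R_F^\times[2]&\text{if }p=2,\ R_F\text{ is maximal, and }F\text{ is not evenly ramified}.\end{cases}$$ Moreover, for every pair $(A,B)$ whose orbit lies in $\mathsf{orb}_{F,r}(H_{F,r}^*)$, the stabilizer of $(A,B)$ in $G_n(\mathbb{Z}_p)$ is isomorphic, as a group, to $\{\rho\in R_F^\times[2]:\mathrm{N}(\rho)=1\}$ if $n$ is odd and to $R_F^\times[2]$ if $n$ is even. -/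

import Mathlib

open scoped Pointwise

/-- A binary form `F(x,z) = ∑ i, f i * x ^ (n - i) * z ^ i` of degree `n ≥ 1` over `R`, with
nonzero leading coefficient `f 0`. -/
structure BinForm (R : Type*) [CommRing R] (n : ℕ) where
  f : Fin (n + 1) → R
  deg_pos : 0 < n
  lead_ne_zero : f 0 ≠ 0

namespace BinForm

section Basic

variable {R : Type*} [CommRing R] {n : ℕ} (F : BinForm R n)

/-- The form itself, as a polynomial in the variables `x = X 0` and `z = X 1`. -/
noncomputable def form : MvPolynomial (Fin 2) R :=
  ∑ i : Fin (n + 1), MvPolynomial.C (F.f i) * MvPolynomial.X 0 ^ (n - (i : ℕ)) *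
    MvPolynomial.X 1 ^ (i : ℕ)

/-- The coefficient `f i`, for a natural number `i` (and `0` for `i > n`). -/
def c (i : ℕ) : R := if h : i < n + 1 then F.f ⟨i, h⟩ else 0

/-- The dehomogenization `F(x,1)`. -/
noncomputable def poly : Polynomial R :=
  ∑ i : Fin (n + 1), Polynomial.C (F.f i) * Polynomial.X ^ (n - (i : ℕ))

/-- The coefficients of `F` generate the unit ideal. -/
def IsPrimitive : Prop := Ideal.span (Set.range F.f) = ⊤

theorem c_zero_ne_zero : F.c 0 ≠ 0 := F.lead_ne_zero

theorem poly_eq : F.poly =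
    ∑ i ∈ Finset.range (n + 1), Polynomial.C (F.c i) * Polynomial.X ^ (n - i) := by
  rw [Finset.sum_range, poly]
  refine Finset.sum_congr rfl fun i _ => ?_
  rw [c, dif_pos i.2]

theorem coeff_poly_n : F.poly.coeff n = F.c 0 := by
  rw [poly_eq, Polynomial.finsetSum_coeff, Finset.sum_eq_single 0]
  · simp
  · intro b hb hb0
    have : b < n + 1 := Finset.mem_range.1 hb
    rw [Polynomial.coeff_C_mul, Polynomial.coeff_X_pow, if_neg (by omega), mul_zero]
  · simp

theorem natDegree_poly : F.poly.natDegree = n := by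
  apply le_antisymm
  · apply Polynomial.natDegree_sum_le_of_forall_le
    intro i _
    exact (Polynomial.natDegree_C_mul_X_pow_le _ _).trans (Nat.sub_le _ _)
  · apply Polynomial.le_natDegree_of_ne_zero
    rw [coeff_poly_n]
    exact F.c_zero_ne_zero

end Basic

/-- A form over `ℤ_[p]` of even degree is evenly ramified if it is congruent modulo `p` to
a unit times the square of a form. -/
def IsEvenlyRamified {p : ℕ} [Fact p.Prime] {n : ℕ} (F : BinForm ℤ_[p] n) : Prop :=
  Even n ∧ ∃ (κ : (ZMod p)ˣ) (H : MvPolynomial (Fin 2) (ZMod p)),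
    MvPolynomial.map PadicInt.toZMod F.form = MvPolynomial.C (κ : ZMod p) * H ^ 2

section Algebra

variable {R : Type*} [CommRing R] {n : ℕ} (F : BinForm R n)
variable (K : Type*) [Field K] [Algebra R K]

/-- `K_F = K[x]/(F(x,1))`. -/
abbrev KF : Type _ := AdjoinRoot (F.poly.map (algebraMap R K))

/-- `θ`, the image of `x` in `K_F`. -/
noncomputable def theta : F.KF K := AdjoinRoot.root _

/-- `ζ_i = ∑_{j < i} f_j θ ^ (i - j)`. -/
noncomputable def zeta (i : ℕ) : F.KF K :=
  ∑ j ∈ Finset.range i, F.c j • F.theta K ^ (i - j)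

/-- The family `1, θ, …, θ ^ k, ζ_{k+1}, …, ζ_{n-1}`. -/
noncomputable def gen (k : ℕ) (i : Fin n) : F.KF K :=
  if (i : ℕ) ≤ k then F.theta K ^ (i : ℕ) else F.zeta K i

theorem zeta_zero : F.zeta K 0 = 0 := by simp [zeta]

theorem zeta_succ (i : ℕ) :
    F.zeta K (i + 1) = F.theta K * (F.zeta K i + algebraMap R _ (F.c i)) := by
  rw [zeta, Finset.sum_range_succ, mul_add, zeta, Finset.mul_sum]
  congr 1
  · refine Finset.sum_congr rfl fun j hj => ?_
    have : j < i := Finset.mem_range.1 hj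
    rw [show i + 1 - j = (i - j) + 1 by omega, pow_succ, mul_comm (F.theta K), smul_mul_assoc]
  · rw [Algebra.smul_def, show i + 1 - i = 1 by omega, pow_one, mul_comm]

theorem zeta_n : F.zeta K n = - algebraMap R _ (F.c n) := by
  have h : Polynomial.aeval (F.theta K) F.poly = 0 := by
    have := AdjoinRoot.eval₂_root (F.poly.map (algebraMap R K))
    rw [Polynomial.eval₂_map] at this
    exact this
  have h' : ∀ P : Polynomial R, P = F.poly → Polynomial.aeval (F.theta K) P = 0 := by
    rintro P rfl
    exact h
  replace h := h' _ F.poly_eq.symm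
  rw [map_sum, Finset.sum_range_succ] at h
  rw [eq_neg_iff_add_eq_zero, ← h, zeta]
  simp [Algebra.smul_def]

/-- The `R`-span of `1, θ, …, θ ^ k, ζ_{k+1}, …, ζ_{n-1}`. -/
noncomputable def lattice (k : ℕ) : Submodule R (F.KF K) := Submodule.span R (Set.range (F.gen K k))

theorem gen_mem (k : ℕ) (i : Fin n) : F.gen K k i ∈ F.lattice K k :=
  Submodule.subset_span ⟨i, rfl⟩

theorem theta_pow_mem {k j : ℕ} (hj : j ≤ k) (hjn : j < n) : F.theta K ^ j ∈ F.lattice K k := by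
  have := F.gen_mem K k ⟨j, hjn⟩
  rwa [gen, if_pos hj] at this

theorem one_mem (k : ℕ) : (1 : F.KF K) ∈ F.lattice K k := by
  have := F.theta_pow_mem K (Nat.zero_le k) F.deg_pos
  rwa [pow_zero] at this

theorem algebraMap_mem (k : ℕ) (a : R) : algebraMap R (F.KF K) a ∈ F.lattice K k := by
  rw [Algebra.algebraMap_eq_smul_one]
  exact Submodule.smul_mem _ _ (F.one_mem K k)

theorem zeta_mem (k : ℕ) {i : ℕ} (hi : i ≤ n) : F.zeta K i ∈ F.lattice K k := by
  rcases hi.eq_or_lt with rfl | hlt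
  · rw [zeta_n]
    exact Submodule.neg_mem _ (F.algebraMap_mem K k _)
  · by_cases hk : i ≤ k
    · rw [zeta]
      exact Submodule.sum_mem _ fun j _ =>
        Submodule.smul_mem _ _ (F.theta_pow_mem K (by omega) (by omega))
    · have := F.gen_mem K k ⟨i, hlt⟩
      rwa [gen, if_neg hk] at this

theorem algebraMap_mul_mem {k : ℕ} (a : R) {x : F.KF K} (hx : x ∈ F.lattice K k) :
    algebraMap R (F.KF K) a * x ∈ F.lattice K k := by
  rw [← Algebra.smul_def]
  exact Submodule.smul_mem _ _ hx

theorem zeta_mul_zeta_mem (k i : ℕ) (hi : i ≤ n) :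
    ∀ j ≤ n, F.zeta K i * F.zeta K j ∈ F.lattice K k := by
  induction i with
  | zero => intro j _; rw [zeta_zero, zero_mul]; exact Submodule.zero_mem _
  | succ i ih =>
    intro j hj
    rcases hj.eq_or_lt with rfl | hlt
    · rw [zeta_n, mul_neg, mul_comm]
      exact Submodule.neg_mem _ (F.algebraMap_mul_mem K _ (F.zeta_mem K k hi))
    · have h : F.zeta K (i + 1) * F.zeta K j = F.zeta K i * F.zeta K (j + 1)
          + algebraMap R _ (F.c i) * F.zeta K (j + 1)
          - algebraMap R _ (F.c j) * F.zeta K (i + 1) := by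
        rw [zeta_succ, zeta_succ]; ring
      rw [h]
      exact Submodule.sub_mem _ (Submodule.add_mem _ (ih (by omega) _ (by omega))
        (F.algebraMap_mul_mem K _ (F.zeta_mem K k (by omega))))
        (F.algebraMap_mul_mem K _ (F.zeta_mem K k hi))

theorem zeta_mul_theta_pow_mem (k j : ℕ) (hj : j ≤ k) (hjn : j < n) :
    ∀ i ≤ n, F.zeta K i * F.theta K ^ j ∈ F.lattice K k := by
  induction j with
  | zero => intro i hi; rw [pow_zero, mul_one]; exact F.zeta_mem K k hi
  | succ j ih =>
    intro i hi
    rcases hi.eq_or_lt with rfl | hlt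
    · rw [zeta_n, neg_mul]
      exact Submodule.neg_mem _ (F.algebraMap_mul_mem K _ (F.theta_pow_mem K hj hjn))
    · have h : F.zeta K i * F.theta K ^ (j + 1) = F.zeta K (i + 1) * F.theta K ^ j
          - algebraMap R _ (F.c i) * F.theta K ^ (j + 1) := by
        rw [zeta_succ]; ring
      rw [h]
      exact Submodule.sub_mem _ (ih (by omega) (by omega) _ hlt)
        (F.algebraMap_mul_mem K _ (F.theta_pow_mem K hj hjn))

theorem lattice_zero_mul_le (k : ℕ) : F.lattice K 0 * F.lattice K k ≤ F.lattice K k := by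
  rw [lattice, lattice, Submodule.span_mul_span, Submodule.span_le]
  rintro _ ⟨_, ⟨i, rfl⟩, _, ⟨j, rfl⟩, rfl⟩
  change F.gen K 0 i * F.gen K k j ∈ F.lattice K k
  by_cases hi : (i : ℕ) ≤ 0
  · rw [gen, if_pos hi, Nat.le_zero.1 hi, pow_zero, one_mul]
    exact F.gen_mem K k j
  · by_cases hj : (j : ℕ) ≤ k
    · rw [gen, if_neg hi, gen, if_pos hj]
      exact F.zeta_mul_theta_pow_mem K k j hj j.2 i i.2.le
    · rw [gen, if_neg hi, gen, if_neg hj]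
      exact F.zeta_mul_zeta_mem K k i i.2.le j j.2.le

/-- The ring `R_F`: the `R`-span of `1, ζ_1, …, ζ_{n-1}`. -/
noncomputable def RF : Subalgebra R (F.KF K) where
  carrier := F.lattice K 0
  mul_mem' hx hy := F.lattice_zero_mul_le K 0 (Submodule.mul_mem_mul hx hy)
  add_mem' hx hy := Submodule.add_mem _ hx hy
  algebraMap_mem' := F.algebraMap_mem K 0

/-- The fractional ideal `I_F ^ k` of `R_F`: the `R`-span of `1, θ, …, θ^k, ζ_{k+1}, …, ζ_{n-1}`. -/
noncomputable def IF (k : ℕ) : Submodule (F.RF K) (F.KF K) where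
  carrier := F.lattice K k
  add_mem' hx hy := Submodule.add_mem _ hx hy
  zero_mem' := Submodule.zero_mem _
  smul_mem' a _ hy := F.lattice_zero_mul_le K k (Submodule.mul_mem_mul a.2 hy)

/-- `R_F` is the maximal order of `K_F`. -/
def IsMaximalOrder : Prop := F.RF K = integralClosure R (F.KF K)

end Algebra

section Bases

variable {R : Type*} [CommRing R] {n : ℕ} (F : BinForm R n)
variable (K : Type*) [Field K] [Algebra R K] [IsFractionRing R K]

theorem natDegree_map : (F.poly.map (algebraMap R K)).natDegree = n := by
  rw [Polynomial.natDegree_map_eq_of_injective (IsFractionRing.injective R K), natDegree_poly]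

theorem map_ne_zero : F.poly.map (algebraMap R K) ≠ 0 := by
  intro h
  have h1 := F.natDegree_map K
  rw [h, Polynomial.natDegree_zero] at h1
  exact F.deg_pos.ne h1

instance : FiniteDimensional K (F.KF K) := (AdjoinRoot.powerBasis (F.map_ne_zero K)).finite

theorem finrank_KF : Module.finrank K (F.KF K) = n := by
  rw [(AdjoinRoot.powerBasis (F.map_ne_zero K)).finrank, AdjoinRoot.powerBasis_dim, natDegree_map]

theorem theta_pow_mem_span (k : ℕ) : ∀ i < n,
    F.theta K ^ i ∈ Submodule.span K (Set.range (F.gen K k)) := by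
  intro i
  induction i using Nat.strong_induction_on with
  | _ i ih =>
    intro hi
    have hg : F.gen K k ⟨i, hi⟩ ∈ Submodule.span K (Set.range (F.gen K k)) :=
      Submodule.subset_span ⟨_, rfl⟩
    by_cases hk : i ≤ k
    · rwa [gen, if_pos hk] at hg
    · rw [gen, if_neg hk] at hg
      obtain ⟨m, rfl⟩ : ∃ m, i = m + 1 := ⟨i - 1, by omega⟩
      have hc : algebraMap R K (F.c 0) ≠ 0 := by
        rw [Ne, IsFractionRing.to_map_eq_zero_iff]
        exact F.c_zero_ne_zero
      rw [zeta, Finset.sum_range_succ'] at hg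
      have hs : ∑ j ∈ Finset.range m, F.c (j + 1) • F.theta K ^ (m + 1 - (j + 1)) ∈
          Submodule.span K (Set.range (F.gen K k)) := by
        refine Submodule.sum_mem _ fun j hj => ?_
        have hj' : j < m := Finset.mem_range.1 hj
        rw [← algebraMap_smul K (F.c (j + 1))]
        exact Submodule.smul_mem _ _ (ih _ (by omega) (by omega))
      have h2 := (Submodule.add_mem_iff_right _ hs).1 hg
      rw [← algebraMap_smul K (F.c 0)] at h2
      exact (Submodule.smul_mem_iff _ hc).1 h2

theorem top_le_span (k : ℕ) : ⊤ ≤ Submodule.span K (Set.range (F.gen K k)) := by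
  rw [← (AdjoinRoot.powerBasis (F.map_ne_zero K)).basis.span_eq, Submodule.span_le]
  rintro _ ⟨i, rfl⟩
  rw [PowerBasis.basis_eq_pow]
  have hi : (i : ℕ) < n := lt_of_lt_of_eq i.2 (F.natDegree_map K)
  exact F.theta_pow_mem_span K k i hi

/-- `1, θ, …, θ ^ k, ζ_{k+1}, …, ζ_{n-1}` as a `K`-basis of `K_F`. -/
noncomputable def genBasis (k : ℕ) : Module.Basis (Fin n) K (F.KF K) :=
  basisOfTopLeSpanOfCardEqFinrank (F.gen K k) (F.top_le_span K k) (by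
    rw [finrank_KF, Fintype.card_fin])

theorem coe_genBasis (k : ℕ) : ⇑(F.genBasis K k) = F.gen K k :=
  coe_basisOfTopLeSpanOfCardEqFinrank _ _ _

/-- `1, θ, …, θ ^ k, ζ_{k+1}, …, ζ_{n-1}` as an `R`-basis of `I_F ^ k`. -/
noncomputable def basisIF (k : ℕ) : Module.Basis (Fin n) R (F.IF K k) :=
  Module.Basis.mk (v := fun i => (⟨F.gen K k i, F.gen_mem K k i⟩ : F.IF K k))
    (by
      have h : LinearIndependent K (F.gen K k) := by
        rw [← coe_genBasis]; exact (F.genBasis K k).linearIndependent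
      have h' : LinearIndependent R (F.gen K k) := h.restrict_scalars (by
        intro a b hab
        apply IsFractionRing.injective R K
        simpa [Algebra.smul_def] using hab)
      exact LinearIndependent.of_comp ((F.IF K k).subtype.restrictScalars R) h')
    (by
      rintro ⟨x, hx⟩ -
      have key : ∀ y ∈ F.lattice K k, ∀ h : y ∈ F.IF K k,
          (⟨y, h⟩ : F.IF K k) ∈ Submodule.span R
            (Set.range fun i => (⟨F.gen K k i, F.gen_mem K k i⟩ : F.IF K k)) := by
        intro y hy
        rw [lattice] at hy
        induction hy using Submodule.span_induction with
        | mem y hy =>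
          obtain ⟨i, rfl⟩ := hy
          intro h
          exact Submodule.subset_span ⟨i, rfl⟩
        | zero => intro h; exact Submodule.zero_mem _
        | add y z hy hz ihy ihz =>
          intro h
          exact Submodule.add_mem _ (ihy hy) (ihz hz)
        | smul a y hy ih =>
          intro h
          exact Submodule.smul_mem _ a (ih hy)
      exact key x hx hx)

theorem coe_basisIF (k : ℕ) (i : Fin n) : (F.basisIF K k i : F.KF K) = F.gen K k i := by
  rw [basisIF, Module.Basis.mk_apply]

/-- `1, ζ_1, …, ζ_{n-1}` as an `R`-basis of `R_F`. -/
noncomputable def basisRF : Module.Basis (Fin n) R (F.RF K) :=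
  (F.basisIF K 0).map
    { toFun := fun x => ⟨x.1, x.2⟩
      invFun := fun x => ⟨x.1, x.2⟩
      map_add' := fun _ _ => rfl
      map_smul' := fun _ _ => rfl
      left_inv := fun _ => rfl
      right_inv := fun _ => rfl }

theorem coe_basisRF (i : Fin n) : (F.basisRF K i : F.KF K) = F.gen K 0 i := F.coe_basisIF K 0 i

/-- The norm of `R_F` over `R` is the restriction of the norm of `K_F` over `K`. -/
theorem norm_RF (x : F.RF K) :
    algebraMap R K (Algebra.norm R x) = Algebra.norm K (x : F.KF K) := by
  rw [Algebra.norm_eq_matrix_det (F.basisRF K), Algebra.norm_eq_matrix_det (F.genBasis K 0),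
    RingHom.map_det]
  congr 1
  ext i j
  rw [RingHom.mapMatrix_apply, Matrix.map_apply, Algebra.leftMulMatrix_eq_repr_mul,
    Algebra.leftMulMatrix_eq_repr_mul]
  have h : (x : F.KF K) * F.genBasis K 0 j =
      ∑ l, algebraMap R K ((F.basisRF K).repr (x * F.basisRF K j) l) • F.genBasis K 0 l := by
    have h1 := congrArg (Subtype.val : F.RF K → F.KF K)
      ((F.basisRF K).sum_repr (x * F.basisRF K j))
    rw [AddSubmonoidClass.coe_finsetSum] at h1
    simp only [coe_genBasis, ← coe_basisRF, algebraMap_smul]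
    exact h1.symm
  rw [h, Module.Basis.repr_sum_self]

/-- `π_{n-1} : I_F ^ (n-2) → R`, which sends `ζ_{n-1}` to `-1` and the other basis
elements `1, θ, …, θ ^ (n-2)` to `0`. -/
noncomputable def piLast : F.IF K (n - 2) →ₗ[R] R :=
  -((F.basisIF K (n - 2)).coord ⟨n - 1, Nat.sub_lt F.deg_pos one_pos⟩)

/-- `π_{n-2} : I_F ^ (n-2) → R`, which sends `θ ^ (n-2)` to `1` and the other basis
elements `1, θ, …, θ ^ (n-3), ζ_{n-1}` to `0`. -/
noncomputable def piPrev : F.IF K (n - 2) →ₗ[R] R :=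
  (F.basisIF K (n - 2)).coord ⟨n - 2, Nat.sub_lt F.deg_pos two_pos⟩

/-- The determinant of the `K`-linear endomorphism of `K_F` which takes the basis
`1, ζ_1, …, ζ_{n-1}` of `R_F` to the family `v`. -/
noncomputable def familyNorm (v : Fin n → F.KF K) : K := (F.genBasis K 0).det v

/-- The norm of `I_F ^ k`, with respect to its basis `1, θ, …, θ ^ k, ζ_{k+1}, …, ζ_{n-1}`. -/
noncomputable def normIF (k : ℕ) : K := F.familyNorm K (F.gen K k)

end Bases
end BinForm

/-- `G_n(R)`: the matrices of determinant `1` if `n` is odd, and of determinant `1` or `-1`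
if `n` is even. -/
def Gn (R : Type*) [CommRing R] (n : ℕ) : Subgroup (Matrix.GeneralLinearGroup (Fin n) R) where
  carrier := {g | Matrix.GeneralLinearGroup.det g = 1 ∨
    (Even n ∧ Matrix.GeneralLinearGroup.det g = -1)}
  mul_mem' := by
    rintro a b (ha | ⟨hn, ha⟩) (hb | ⟨hn', hb⟩) <;> simp_all
  one_mem' := by simp
  inv_mem' := by
    rintro a (ha | ⟨hn, ha⟩) <;> simp_all

/-- Pairs of symmetric `n × n` matrices over `R`. -/
structure SymPair (R : Type*) [CommRing R] (n : ℕ) where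
  A : Matrix (Fin n) (Fin n) R
  B : Matrix (Fin n) (Fin n) R
  symmA : A.IsSymm
  symmB : B.IsSymm

namespace SymPair

variable {R : Type*} [CommRing R] {n : ℕ}

theorem ext' {T T' : SymPair R n} (hA : T.A = T'.A) (hB : T.B = T'.B) : T = T' := by
  cases T; cases T'; cases hA; cases hB; rfl

theorem isSymm_conj (g : Matrix (Fin n) (Fin n) R) {A : Matrix (Fin n) (Fin n) R}
    (hA : A.IsSymm) : (g * A * g.transpose).IsSymm := by
  rw [Matrix.IsSymm, Matrix.transpose_mul, Matrix.transpose_mul, Matrix.transpose_transpose,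
    hA.eq, Matrix.mul_assoc]

/-- `g • (A, B) = (g A gᵀ, g B gᵀ)`. -/
instance : MulAction (Gn R n) (SymPair R n) where
  smul g T :=
    { A := g.1.1 * T.A * g.1.1.transpose
      B := g.1.1 * T.B * g.1.1.transpose
      symmA := isSymm_conj _ T.symmA
      symmB := isSymm_conj _ T.symmB }
  one_smul T := by
    apply ext'
    · change (1 : Matrix _ _ R) * T.A * (1 : Matrix _ _ R).transpose = T.A
      simp
    · change (1 : Matrix _ _ R) * T.B * (1 : Matrix _ _ R).transpose = T.B
      simp
  mul_smul g h T := by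
    apply ext'
    · change (g.1.1 * h.1.1) * T.A * (g.1.1 * h.1.1).transpose =
        g.1.1 * (h.1.1 * T.A * h.1.1.transpose) * g.1.1.transpose
      simp only [Matrix.transpose_mul, Matrix.mul_assoc]
    · change (g.1.1 * h.1.1) * T.B * (g.1.1 * h.1.1).transpose =
        g.1.1 * (h.1.1 * T.B * h.1.1.transpose) * g.1.1.transpose
      simp only [Matrix.transpose_mul, Matrix.mul_assoc]

theorem smul_A (g : Gn R n) (T : SymPair R n) : (g • T).A = g.1.1 * T.A * g.1.1.transpose := rfl

theorem smul_B (g : Gn R n) (T : SymPair R n) : (g • T).B = g.1.1 * T.B * g.1.1.transpose := rfl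

end SymPair

namespace BinForm

section Orbits

variable {R : Type*} [CommRing R] {n : ℕ} (F : BinForm R n)
variable (K : Type*) [Field K] [Algebra R K] [IsFractionRing R K]

/-- A based fractional ideal of `R_F`: an `R_F`-submodule of `K_F` with a chosen `R`-basis
of `n` elements. -/
structure BasedIdeal where
  I : Submodule (F.RF K) (F.KF K)
  basis : Module.Basis (Fin n) R I

/-- The chosen basis of a based fractional ideal, as a family in `K_F`. -/
noncomputable def BasedIdeal.vec {F : BinForm R n} {K : Type*} [Field K] [Algebra R K]
    (J : F.BasedIdeal K) (i : Fin n) : F.KF K := J.basis i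

/-- The norm of a based fractional ideal. -/
noncomputable def BasedIdeal.norm {F : BinForm R n} {K : Type*} [Field K] [Algebra R K]
    [IsFractionRing R K] (J : F.BasedIdeal K) : K := F.familyNorm K J.vec

/-- A pair `(I, α)` of a based fractional ideal `I` and `α ∈ K_F ^ ×` such that
`I ^ 2 ⊆ α I_F ^ (n-2)` and `N(I) ^ 2 = r N(α) N(I_F ^ (n-2))`. -/
structure IdealPair (r : Rˣ) extends F.BasedIdeal K where
  α : (F.KF K)ˣ
  sq_le : I ^ 2 ≤ α • F.IF K (n - 2)
  norm_sq : toBasedIdeal.norm ^ 2 =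
    algebraMap R K r * Algebra.norm K (α : F.KF K) * F.normIF K (n - 2)

namespace IdealPair

variable {F K} {r : Rˣ}

/-- `(I₁, α₁)` and `(I₂, α₂)` are equivalent if, for some `κ ∈ K_F ^ ×`, one has
`α₁ = κ ^ 2 α₂`, `I₁ = κ I₂`, and the bases of `I₁` and `κ I₂` differ by an element of `G_n(R)`. -/
def Equivalent (P Q : F.IdealPair K r) : Prop :=
  ∃ (κ : (F.KF K)ˣ) (g : Gn R n), P.I = κ • Q.I ∧
    (∀ i, P.vec i = ∑ j, g.1.1 i j • ((κ : F.KF K) * Q.vec j)) ∧ P.α = κ ^ 2 * Q.α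

theorem Equivalent.refl (P : F.IdealPair K r) : P.Equivalent P :=
  ⟨1, 1, by simp, fun i => by simp [Matrix.one_apply], by simp⟩

theorem sum_inv (g : Gn R n) {v w : Fin n → F.KF K} (h : ∀ i, v i = ∑ j, g.1.1 i j • w j)
    (i : Fin n) : w i = ∑ j, (g⁻¹).1.1 i j • v j := by
  have hg : (g⁻¹).1.1 * g.1.1 = (1 : Matrix (Fin n) (Fin n) R) := (g.1).inv_mul
  simp only [h, Finset.smul_sum, smul_smul]
  rw [Finset.sum_comm]
  simp only [← Finset.sum_smul, ← Matrix.mul_apply, hg]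
  simp [Matrix.one_apply]

theorem Equivalent.symm {P Q : F.IdealPair K r} (h : P.Equivalent Q) : Q.Equivalent P := by
  obtain ⟨κ, g, hI, hv, hα⟩ := h
  refine ⟨κ⁻¹, g⁻¹, by rw [hI, inv_smul_smul], fun i => ?_, by rw [hα]; simp⟩
  have h1 := sum_inv g hv i
  have h2 : Q.vec i = ((κ⁻¹ : (F.KF K)ˣ) : F.KF K) * ((κ : F.KF K) * Q.vec i) := by
    rw [← mul_assoc, Units.inv_mul, one_mul]
  rw [h2, h1, Finset.mul_sum]
  simp only [mul_smul_comm]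

theorem Equivalent.trans {P Q S : F.IdealPair K r} (h : P.Equivalent Q) (h' : Q.Equivalent S) :
    P.Equivalent S := by
  obtain ⟨κ, g, hI, hv, hα⟩ := h
  obtain ⟨κ', g', hI', hv', hα'⟩ := h'
  refine ⟨κ * κ', g * g', by rw [hI, hI', mul_smul], fun i => ?_, by
    rw [hα, hα', mul_pow, mul_assoc]⟩
  have hm : (g * g').1.1 = g.1.1 * g'.1.1 := rfl
  simp only [hv, hv', hm, Matrix.mul_apply, Finset.mul_sum, Finset.sum_smul, Finset.smul_sum]
  rw [Finset.sum_comm]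
  refine Finset.sum_congr rfl fun j _ => Finset.sum_congr rfl fun k _ => ?_
  rw [mul_smul_comm, smul_smul, Units.val_mul, mul_assoc]

instance setoid (F : BinForm R n) (K : Type*) [Field K] [Algebra R K] [IsFractionRing R K]
    (r : Rˣ) : Setoid (F.IdealPair K r) :=
  ⟨Equivalent, Equivalent.refl, Equivalent.symm, Equivalent.trans⟩

theorem form_mem (P : F.IdealPair K r) {x y : F.KF K} (hx : x ∈ P.I) (hy : y ∈ P.I) :
    ((P.α⁻¹ : (F.KF K)ˣ) : F.KF K) * (x * y) ∈ F.IF K (n - 2) := by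
  have h : x * y ∈ P.I ^ 2 := by
    rw [pow_two]
    exact Submodule.mul_mem_mul hx hy
  obtain ⟨z, hz, hzxy⟩ := P.sq_le h
  have h2 : (P.α : F.KF K) * z = x * y := hzxy
  rw [← h2, ← mul_assoc, Units.inv_mul, one_mul]
  exact hz

/-- The element `⟨b_i, b_j⟩ = α⁻¹ b_i b_j` of `I_F ^ (n-2)`, for the chosen basis `b` of `I`. -/
noncomputable def pairing (P : F.IdealPair K r) (i j : Fin n) : F.IF K (n - 2) :=
  ⟨((P.α⁻¹ : (F.KF K)ˣ) : F.KF K) * (P.vec i * P.vec j),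
    P.form_mem (P.basis i).2 (P.basis j).2⟩

theorem pairing_comm (P : F.IdealPair K r) (i j : Fin n) : P.pairing i j = P.pairing j i :=
  Subtype.ext (by simp only [pairing, mul_comm (P.vec i)])

/-- The pair of matrices, with respect to the chosen basis of `I`, of the bilinear forms
`π_{n-1} ∘ ⟨-,-⟩` and `π_{n-2} ∘ ⟨-,-⟩`, where `⟨β, γ⟩ = α⁻¹ β γ`. -/
noncomputable def matrices (P : F.IdealPair K r) : SymPair R n where
  A := Matrix.of fun i j => F.piLast K (P.pairing i j)
  B := Matrix.of fun i j => F.piPrev K (P.pairing i j)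
  symmA := Matrix.IsSymm.ext fun i j => by simp only [Matrix.of_apply, P.pairing_comm i j]
  symmB := Matrix.IsSymm.ext fun i j => by simp only [Matrix.of_apply, P.pairing_comm i j]

theorem pairing_eq {P Q : F.IdealPair K r} {κ : (F.KF K)ˣ} {g : Gn R n}
    (hv : ∀ i, P.vec i = ∑ j, g.1.1 i j • ((κ : F.KF K) * Q.vec j)) (hα : P.α = κ ^ 2 * Q.α)
    (i j : Fin n) :
    P.pairing i j = ∑ l, ∑ k, (g.1.1 i k * g.1.1 j l) • Q.pairing k l := by
  have hκ : ∀ x y : F.KF K, ((P.α⁻¹ : (F.KF K)ˣ) : F.KF K) * ((κ * x) * (κ * y)) =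
      ((Q.α⁻¹ : (F.KF K)ˣ) : F.KF K) * (x * y) := by
    intro x y
    have h1 : P.α⁻¹ * κ ^ 2 = Q.α⁻¹ := by rw [hα]; simp
    rw [← h1]
    push_cast
    ring
  apply Subtype.ext
  have hc : ((∑ l, ∑ k, (g.1.1 i k * g.1.1 j l) • Q.pairing k l : F.IF K (n - 2)) : F.KF K) =
      ∑ l, ∑ k, (g.1.1 i k * g.1.1 j l) •
        (((Q.α⁻¹ : (F.KF K)ˣ) : F.KF K) * (Q.vec k * Q.vec l)) := by
    rw [AddSubmonoidClass.coe_finsetSum]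
    refine Finset.sum_congr rfl fun l _ => ?_
    rw [AddSubmonoidClass.coe_finsetSum]
    rfl
  rw [hc]
  change ((P.α⁻¹ : (F.KF K)ˣ) : F.KF K) * (P.vec i * P.vec j) = _
  rw [hv, hv, Finset.sum_mul_sum, Finset.sum_comm]
  simp only [Finset.mul_sum]
  refine Finset.sum_congr rfl fun l _ => Finset.sum_congr rfl fun k _ => ?_
  rw [smul_mul_smul_comm, mul_smul_comm, hκ]

theorem conj_apply (g : Gn R n) (M : Matrix (Fin n) (Fin n) R) (i j : Fin n) :
    (g.1.1 * M * g.1.1.transpose) i j = ∑ l, ∑ k, (g.1.1 i k * g.1.1 j l) * M k l := by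
  simp only [Matrix.mul_apply, Matrix.transpose_apply, Finset.sum_mul]
  refine Finset.sum_congr rfl fun l _ => Finset.sum_congr rfl fun k _ => ?_
  ring

theorem Equivalent.matrices_eq {P Q : F.IdealPair K r} (h : P.Equivalent Q) :
    ∃ g : Gn R n, g • Q.matrices = P.matrices := by
  obtain ⟨κ, g, -, hv, hα⟩ := h
  refine ⟨g, SymPair.ext' ?_ ?_⟩
  · ext i j
    rw [SymPair.smul_A, conj_apply]
    simp only [matrices, Matrix.of_apply, pairing_eq hv hα i j, map_sum, map_smul, smul_eq_mul]
  · ext i j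
    rw [SymPair.smul_B, conj_apply]
    simp only [matrices, Matrix.of_apply, pairing_eq hv hα i j, map_sum, map_smul, smul_eq_mul]

end IdealPair

/-- The set `H_{F,r}` of equivalence classes of pairs `(I, α)`. -/
abbrev H (r : Rˣ) : Type _ := Quotient (IdealPair.setoid F K r)

/-- The map `orb_{F,r}` from `H_{F,r}` to the `G_n(R)`-orbits of pairs of symmetric matrices. -/
noncomputable def orb (r : Rˣ) :
    F.H K r → MulAction.orbitRel.Quotient (Gn R n) (SymPair R n) :=
  Quotient.map' IdealPair.matrices fun _ _ h => MulAction.orbitRel_apply.2 h.matrices_eq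

/-- The subset `H*_{F,r}` of classes of pairs `(I, α)` with `I` an invertible fractional ideal. -/
def HStar (r : Rˣ) : Set (F.H K r) :=
  {h | ∃ P : F.IdealPair K r, IsUnit P.I ∧ Quotient.mk _ P = h}

end Orbits

section Units

variable {R : Type*} [CommRing R] {n : ℕ} (F : BinForm R n)
variable (K : Type*) [Field K] [Algebra R K]

/-- The norm `R_F ^ × → R ^ ×`. -/
noncomputable def unitNorm : (F.RF K)ˣ →* Rˣ := Units.map (Algebra.norm R)

/-- The group `R_F ^ × / (R_F ^ ×) ^ 2`. -/
abbrev UnitsModSq : Type _ := (F.RF K)ˣ ⧸ (powMonoidHom 2 : (F.RF K)ˣ →* (F.RF K)ˣ).range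

/-- The map `R_F ^ × / (R_F ^ ×) ^ 2 → R ^ × / (R ^ ×) ^ 2` induced by the norm. -/
noncomputable def normModSq :
    F.UnitsModSq K →* Rˣ ⧸ (powMonoidHom 2 : Rˣ →* Rˣ).range :=
  QuotientGroup.map _ _ (F.unitNorm K) (by
    rintro _ ⟨u, rfl⟩
    exact ⟨F.unitNorm K u, by simp⟩)

/-- The set of classes in `R_F ^ × / (R_F ^ ×) ^ 2` whose norm is `r` in `R ^ × / (R ^ ×) ^ 2`. -/
def unitsModSqOfNorm (r : Rˣ) : Set (F.UnitsModSq K) :=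
  {ρ | F.normModSq K ρ = QuotientGroup.mk r}

/-- `R_F ^ × [2]`, the group of `ρ ∈ R_F ^ ×` with `ρ ^ 2 = 1`. -/
noncomputable def units2 : Subgroup (F.RF K)ˣ := (powMonoidHom 2 : (F.RF K)ˣ →* (F.RF K)ˣ).ker

/-- The group of `ρ ∈ R_F ^ × [2]` with norm `1`. -/
noncomputable def units2NormOne : Subgroup (F.RF K)ˣ := F.units2 K ⊓ (F.unitNorm K).ker

end Units

end BinForm

/-!
The proof rests on three facts.

**Orbits are square classes of units.** `R_F` is finite over `ℤ_[p]`, hence semilocal, so all its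
invertible fractional ideals are principal (`exists_smul_one_of_isUnit`). In particular this holds
for the powers of `I_F = (1, θ)`, which is invertible because `F` is primitive, and `I_F ^ (n-2)`
even has a generator `δ` whose norm is that of the ideal up to the square of a unit
(`nonempty_squareNormGenerator`). After scaling, a pair `(I, α)` with `I` invertible is therefore
`(R_F, δ⁻¹ ρ⁻¹)` for a unit `ρ` of norm `r` modulo squares, and `ρ` matters only modulo squares.
On the other side, the forms `π_{n-1} (α⁻¹ β γ)` and `π_{n-2} (α⁻¹ β γ)` are nondegenerate enough
to recover multiplication by `θ`: a linear bijection which respects both commutes with `θ`, so it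
is multiplication by a unit of `K_F`. Hence `orb` is injective (`IdealPair.orb_eq_iff`), and
stabilizers consist of the units `ρ` with `ρ ^ 2 = 1` and the right norm
(`IdealPair.nonempty_stabilizer_mulEquiv`).

**The number of square classes.** On `U = 1 + 2p R_F`, which has finite index in `R_F ^ ×`,
squaring is injective with image `1 + 4p R_F`. Comparing indices (`index_range_sq_eq`) gives
`#(R_F ^ × / squares) = #R_F ^ × [2] · #(ℤ_[p] / 2) ^ n` (`card_units_quot_sq`), and the same
formula with `n = 1` applies to `ℤ_[p]`. All fibres of the norm onto its image have the same size,
so it remains to determine that image.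

**The image of the norm modulo squares.** For odd `n` a constant `c` has norm `c ^ n`, which is
`c` up to a square, so constants suffice. For even `n`, units of `R_F` are quotients `A(θ) / B(θ)`
of polynomials of degree at most `n - 1` whose resultants with `F` are units, and the norm is the
quotient of these resultants. For odd `p` it is a square or not according to its residue modulo
`p`. An irreducible factor `h` of odd multiplicity of `F` modulo `p` allows one to change `B`
modulo `h` alone, and so to reach a nonsquare, because norms of finite fields are surjective
(`Polynomial.exists_resultant_eq_nonsquare_mul`). If there is no such factor, `F` is `κ s ^ 2`
modulo `p` and every resultant is `κ ^ (n-1)` times a square. For `p = 2` a form which is not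
evenly ramified has a coefficient `f_i` which is a unit, with `i` odd; then `ζ_i`, which has trace
`-i f_i`, makes `1 + 2 ζ_i` and `1 + 4 ζ_i` units with norms `3` modulo `4` and `5` modulo `8`,
which together with the squares generate `ℤ_[2] ^ ×`.
-/

/-! ### Squares in commutative groups -/

/-- If squaring is injective on a subgroup `U` of finite index, the index of the squares and the
number of solutions of `g ^ 2 = 1` differ by the factor `[U : U ^ 2]`. -/
theorem index_range_sq_eq {G : Type*} [CommGroup G] (U : Subgroup G) [U.FiniteIndex]
    (hU : ∀ u ∈ U, u ^ 2 = 1 → u = 1) :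
    Finite (powMonoidHom 2 : G →* G).ker ∧
    (powMonoidHom 2 : G →* G).range.index * (U.index) =
      Nat.card (powMonoidHom 2 : G →* G).ker *
      ((U.map (powMonoidHom 2)).relIndex U * U.index) := by
  set s : G →* G := powMonoidHom 2 with hs
  have hinf : U ⊓ s.ker = ⊥ := by
    rw [eq_bot_iff]
    rintro u ⟨hu, hk⟩
    exact Subgroup.mem_bot.2 (hU u hu hk)
  have hle : U.map s ≤ U := by
    rintro _ ⟨u, hu, rfl⟩
    exact U.pow_mem hu 2
  have hle' : U.map s ≤ s.range := by
    rintro _ ⟨u, -, rfl⟩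
    exact ⟨u, rfl⟩
  have hcard : U.relIndex s.ker = Nat.card s.ker := by
    rw [← Subgroup.inf_relIndex_right, hinf, Subgroup.relIndex_bot_left]
  have h1 : (U.map s).relIndex U * U.index = (U.map s).index := Subgroup.relIndex_mul_index hle
  have h2 : (U.map s).relIndex s.range * s.range.index = (U.map s).index :=
    Subgroup.relIndex_mul_index hle'
  have h3 : (U.map s).relIndex s.range = (U ⊔ s.ker).index := by
    rw [MonoidHom.range_eq_map, Subgroup.relIndex_map_map, top_sup_eq, Subgroup.relIndex_top_right]
  have h4 : U.relIndex (U ⊔ s.ker) * (U ⊔ s.ker).index = U.index :=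
    Subgroup.relIndex_mul_index le_sup_left
  have h5 : U.relIndex (U ⊔ s.ker) = Nat.card s.ker := by
    rw [sup_comm, Subgroup.relIndex_sup_right, hcard]
  have hU0 : U.index ≠ 0 := Subgroup.FiniteIndex.index_ne_zero
  refine ⟨Nat.finite_of_card_ne_zero fun h => hU0 ?_, ?_⟩
  · rw [← h4, h5, h, zero_mul]
  · rw [h1, ← h2, h3, ← h4, h5]
    ring

/-- The fibres of a surjective homomorphism onto a finite group all have the same size. -/
theorem card_fiber_mul_card {G H : Type*} [Group G] [Group H] [Finite H]
    (f : G →* H) (hf : Function.Surjective f) (h : H) :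
    Nat.card {g | f g = h} * Nat.card H = Nat.card G := by
  obtain ⟨g₀, rfl⟩ := hf h
  have e : {g | f g = f g₀} ≃ f.ker :=
    { toFun := fun g => ⟨g * g₀⁻¹, by
        have := g.2
        rw [MonoidHom.mem_ker, map_mul, map_inv, this, mul_inv_cancel]⟩
      invFun := fun k => ⟨k * g₀, by
        have : f k = 1 := k.2
        change f (k * g₀) = f g₀
        rw [map_mul, this, one_mul]⟩
      left_inv := fun g => by simp
      right_inv := fun k => by simp }
  rw [Nat.card_congr e, Subgroup.card_eq_card_quotient_mul_card_subgroup f.ker, mul_comm,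
    Nat.card_congr (QuotientGroup.quotientKerEquivOfSurjective f hf).toEquiv]

/-! ### Unit groups of finite free algebras over `ℤ_[p]` -/

theorem isUnit_of_isUnit_norm {R S : Type*} [CommRing R] [CommRing S] [Algebra R S]
    [Module.Free R S] [Module.Finite R S] {x : S} (h : IsUnit (Algebra.norm R x)) : IsUnit x := by
  have h1 : IsUnit (LinearMap.mul R S x) := (LinearMap.isUnit_iff_isUnit_det _).2 h
  obtain ⟨y, hy⟩ := ((Module.End.isUnit_iff _).1 h1).2 1
  exact IsUnit.of_mul_eq_one y hy

section PadicAlgebra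

variable {p : ℕ} [Fact p.Prime] {S : Type*} [CommRing S] [Algebra ℤ_[p] S]
variable {ι : Type*} [Fintype ι]

/-- Multiplication does not increase the sup norm of coordinates, the structure constants being
integral. -/
theorem norm_equivFun_mul_le (b : Module.Basis ι ℤ_[p] S) (x y : S) :
    ‖b.equivFun (x * y)‖ ≤ ‖b.equivFun x‖ := by
  rw [pi_norm_le_iff_of_nonneg (norm_nonneg _)]
  intro i
  have h : x * y = ∑ j, b.equivFun x j • (b j * y) := by
    conv_lhs => rw [← b.sum_equivFun x, Finset.sum_mul]
    simp only [smul_mul_assoc]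
  rw [h, map_sum, Finset.sum_apply]
  refine IsUltrametricDist.norm_sum_le_of_forall_le_of_nonneg (norm_nonneg _) fun j _ => ?_
  rw [map_smul, Pi.smul_apply, smul_eq_mul, norm_mul]
  exact (mul_le_of_le_one_right (norm_nonneg _) (PadicInt.norm_le_one _)).trans
    (norm_le_pi_norm (b.equivFun x) j)

/-- The map `x ↦ y - p x ^ 2` is a contraction for the sup norm of the coordinates, so it has
a fixed point. -/
theorem exists_add_p_mul_sq (b : Module.Basis ι ℤ_[p] S) (y : S) :
    ∃ x : S, x + (p : S) * x ^ 2 = y := by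
  let e := b.equivFun
  let T : (ι → ℤ_[p]) → (ι → ℤ_[p]) := fun a => e (y - (p : S) * (e.symm a) ^ 2)
  have hp : (1 : ℝ) < p := by exact_mod_cast (Fact.out : p.Prime).one_lt
  let k : NNReal := (p : NNReal)⁻¹
  have hk : ∀ z : S, ‖e ((p : S) * z)‖ ≤ k * ‖e z‖ := by
    intro z
    have : (p : S) * z = (p : ℤ_[p]) • z := by rw [Algebra.smul_def, map_natCast]
    rw [this, map_smul, norm_smul, PadicInt.norm_p]
    simp [k]
  have hT : ContractingWith k T := by
    refine ⟨?_, LipschitzWith.of_dist_le_mul fun a c => ?_⟩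
    · have : (k : ℝ) < 1 := by
        simp only [k, NNReal.coe_inv, NNReal.coe_natCast]
        exact inv_lt_one_of_one_lt₀ hp
      exact_mod_cast this
    · have h1 : T a - T c = e ((p : S) * ((e.symm c - e.symm a) * (e.symm c + e.symm a))) := by
        simp only [T]
        rw [← map_sub]
        congr 1
        ring
      rw [dist_eq_norm, h1, dist_comm, dist_eq_norm]
      refine (hk _).trans (mul_le_mul_of_nonneg_left ?_ k.2)
      refine (norm_equivFun_mul_le b _ _).trans (le_of_eq ?_)
      rw [← map_sub]
      exact congrArg norm (e.apply_symm_apply _)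
  have hfix : T (ContractingWith.fixedPoint T hT) = _ := hT.fixedPoint_isFixedPt
  refine ⟨e.symm (ContractingWith.fixedPoint T hT), ?_⟩
  have h2 := congrArg e.symm hfix
  simp only [T] at h2
  rw [LinearEquiv.symm_apply_apply] at h2
  linear_combination -h2

theorem PadicInt.isUnit_one_add_p_mul (a : ℤ_[p]) : IsUnit (1 + p * a) := by
  have : (p : ℤ_[p]) * a ∈ IsLocalRing.maximalIdeal ℤ_[p] :=
    Ideal.mul_mem_right _ _ (PadicInt.maximalIdeal_eq_span_p (p := p) ▸
      Ideal.mem_span_singleton_self _)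
  by_contra h
  have h1 : (1 : ℤ_[p]) ∈ IsLocalRing.maximalIdeal ℤ_[p] := by
    have := Ideal.sub_mem _ ((IsLocalRing.mem_maximalIdeal _).2 h) this
    rwa [add_sub_cancel_right] at this
  exact (IsLocalRing.mem_maximalIdeal _).1 h1 isUnit_one

theorem isUnit_one_add_p_mul [Module.Free ℤ_[p] S] [Module.Finite ℤ_[p] S] (x : S) :
    IsUnit (1 + (p : S) * x) := by
  apply isUnit_of_isUnit_norm (R := ℤ_[p])
  obtain ⟨r, hr⟩ := Algebra.norm_one_add_smul (p : ℤ_[p]) x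
  have h : 1 + (p : S) * x = 1 + (p : ℤ_[p]) • x := by rw [Algebra.smul_def, map_natCast]
  rw [h, hr]
  have : 1 + Algebra.trace ℤ_[p] S x * p + r * (p : ℤ_[p]) ^ 2 =
      1 + p * (Algebra.trace ℤ_[p] S x + r * p) := by ring
  rw [this]
  exact PadicInt.isUnit_one_add_p_mul _

/-- Coordinatewise reduction modulo `c`. -/
noncomputable def reduceMod (b : Module.Basis ι ℤ_[p] S) (c : ℤ_[p]) :
    S →+ (ι → ℤ_[p] ⧸ Ideal.span {c}) where
  toFun x i := Ideal.Quotient.mk _ (b.equivFun x i)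
  map_zero' := by ext; simp
  map_add' x y := by ext; simp

theorem reduceMod_eq_zero_iff (b : Module.Basis ι ℤ_[p] S) (c : ℤ_[p]) (x : S) :
    reduceMod b c x = 0 ↔ ∃ y, x = c • y := by
  constructor
  · intro h
    have h1 : ∀ i, ∃ d, b.equivFun x i = d * c := fun i => by
      have := congrFun h i
      exact (Ideal.mem_span_singleton'.1 (Ideal.Quotient.eq_zero_iff_mem.1 this)).imp
        fun _ h => h.symm
    choose d hd using h1
    refine ⟨∑ i, d i • b i, ?_⟩
    rw [← b.sum_equivFun x, Finset.smul_sum]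
    refine Finset.sum_congr rfl fun i _ => ?_
    rw [hd, smul_smul, mul_comm]
  · rintro ⟨y, rfl⟩
    ext i
    change Ideal.Quotient.mk _ (b.equivFun (c • y) i) = 0
    rw [map_smul, Pi.smul_apply, smul_eq_mul, Ideal.Quotient.eq_zero_iff_mem]
    exact Ideal.mul_mem_right _ _ (Ideal.mem_span_singleton_self _)

theorem reduceMod_surjective (b : Module.Basis ι ℤ_[p] S) (c : ℤ_[p]) :
    Function.Surjective (reduceMod b c) := by
  intro v
  choose w hw using fun i => Ideal.Quotient.mk_surjective (v i)
  refine ⟨b.equivFun.symm w, ?_⟩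
  ext i
  change Ideal.Quotient.mk _ (b.equivFun (b.equivFun.symm w) i) = v i
  rw [LinearEquiv.apply_symm_apply, hw]

theorem PadicInt.finite_quotient_span {c : ℤ_[p]} (hc : c ≠ 0) :
    Finite (ℤ_[p] ⧸ Ideal.span {c}) := by
  have hspan : Ideal.span {c} = RingHom.ker (PadicInt.toZModPow (p := p) c.valuation) := by
    rw [PadicInt.ker_toZModPow, Ideal.span_singleton_eq_span_singleton]
    refine ⟨(PadicInt.unitCoeff hc)⁻¹, ?_⟩
    have h := PadicInt.unitCoeff_spec hc
    rw [Units.mul_inv_eq_iff_eq_mul, mul_comm]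
    exact h
  rw [hspan]
  have : NeZero (p ^ c.valuation) := ⟨pow_ne_zero _ (Fact.out : p.Prime).ne_zero⟩
  exact Finite.of_injective _ (RingHom.kerLift_injective _)

theorem finite_quotient_span (b : Module.Basis ι ℤ_[p] S) {c : ℤ_[p]} (hc : c ≠ 0) :
    Finite (S ⧸ Ideal.span {algebraMap ℤ_[p] S c}) := by
  have := PadicInt.finite_quotient_span hc
  refine Finite.of_injective (fun x => reduceMod b c (Quotient.out x)) fun x y h => ?_
  have h1 : reduceMod b c (Quotient.out x - Quotient.out y) = 0 := by
    rw [map_sub]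
    exact sub_eq_zero.2 h
  obtain ⟨z, hz⟩ := (reduceMod_eq_zero_iff b c _).1 h1
  rw [← Quotient.out_eq x, ← Quotient.out_eq y]
  change Ideal.Quotient.mk _ _ = Ideal.Quotient.mk _ _
  rw [Ideal.Quotient.eq, hz, Algebra.smul_def]
  exact Ideal.mul_mem_right _ _ (Ideal.mem_span_singleton_self _)

/-- A finite free `ℤ_[p]`-algebra is semilocal: every maximal ideal lies over `p`. -/
theorem finite_maximalSpectrum_of_basis (b : Module.Basis ι ℤ_[p] S) :
    Finite (MaximalSpectrum S) := by
  have hp0 : (p : ℤ_[p]) ≠ 0 := by exact_mod_cast (Fact.out : p.Prime).ne_zero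
  have := finite_quotient_span b hp0
  have : Module.Finite ℤ_[p] S := Module.Finite.of_basis b
  set P := Ideal.span {algebraMap ℤ_[p] S p} with hP
  have hmem : ∀ m : MaximalSpectrum S, P ≤ m.asIdeal := by
    intro m
    have := m.isMaximal
    have hm := Ideal.isMaximal_comap_of_isIntegral_of_isMaximal (R := ℤ_[p]) m.asIdeal
    rw [hP, Ideal.span_singleton_le_iff_mem, ← Ideal.mem_comap, IsLocalRing.eq_maximalIdeal hm,
      PadicInt.maximalIdeal_eq_span_p]
    exact Ideal.mem_span_singleton_self _
  have : Finite (Set (S ⧸ P)) := inferInstance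
  refine Finite.of_injective
    (fun m : MaximalSpectrum S => (Ideal.Quotient.mk P '' (m.asIdeal : Set S))) fun m m' h => ?_
  have key : ∀ m m' : MaximalSpectrum S, (Ideal.Quotient.mk P '' (m.asIdeal : Set S)) =
      (Ideal.Quotient.mk P '' (m'.asIdeal : Set S)) → m.asIdeal ≤ m'.asIdeal := by
    intro m m' h x hx
    obtain ⟨y, hy, hxy⟩ := h ▸ Set.mem_image_of_mem (Ideal.Quotient.mk P) hx
    have h1 := hmem m' (Ideal.Quotient.eq.1 hxy)
    have := m'.asIdeal.sub_mem hy h1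
    rwa [sub_sub_cancel] at this
  exact MaximalSpectrum.ext (le_antisymm (key _ _ h) (key _ _ h.symm))

variable (p S) in
/-- The group `1 + c S ∩ S ^ ×` of units congruent to `1` modulo `c`. -/
noncomputable def unitsOneMod (c : ℤ_[p]) : Subgroup Sˣ :=
  (Units.map (Ideal.Quotient.mk (Ideal.span {algebraMap ℤ_[p] S c})).toMonoidHom).ker

theorem mem_unitsOneMod_iff {c : ℤ_[p]} {u : Sˣ} :
    u ∈ unitsOneMod p S c ↔ ∃ x : S, (u : S) = 1 + c • x := by
  rw [unitsOneMod, MonoidHom.mem_ker, Units.ext_iff]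
  change Ideal.Quotient.mk _ (u : S) = 1 ↔ _
  rw [← map_one (Ideal.Quotient.mk _), Ideal.Quotient.eq, Ideal.mem_span_singleton']
  simp only [Algebra.smul_def]
  refine exists_congr fun x => ⟨fun h => by rw [mul_comm, h]; ring, fun h => by rw [h]; ring⟩

theorem unitsOneMod_finiteIndex (b : Module.Basis ι ℤ_[p] S) {c : ℤ_[p]} (hc : c ≠ 0) :
    (unitsOneMod p S c).FiniteIndex := by
  have := finite_quotient_span b hc
  exact Subgroup.finiteIndex_ker _

theorem smul_right_cancel_of_basis {ι : Type*} (b : Module.Basis ι ℤ_[p] S) {c : ℤ_[p]}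
    (hc : c ≠ 0) {x y : S} (h : c • x = c • y) : x = y := by
  have : Module.Free ℤ_[p] S := Module.Free.of_basis b
  exact smul_right_injective S hc h

/-- Squaring maps `1 + 2p S` bijectively to `1 + 4p S`, since `(1 + 2px)² = 1 + 4p(x + px²)`. -/
theorem map_sq_unitsOneMod (b : Module.Basis ι ℤ_[p] S) :
    (unitsOneMod p S (2 * p)).map (powMonoidHom 2) = unitsOneMod p S (4 * p) := by
  have : Module.Free ℤ_[p] S := Module.Free.of_basis b
  have : Module.Finite ℤ_[p] S := Module.Finite.of_basis b
  have hsq : ∀ x : S, (1 + (2 * (p : ℤ_[p])) • x) ^ 2 =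
      1 + (4 * (p : ℤ_[p])) • (x + p * x ^ 2) := by
    intro x
    simp only [Algebra.smul_def, map_mul, map_natCast, map_ofNat]
    ring
  ext u
  constructor
  · rintro ⟨v, hv, rfl⟩
    obtain ⟨x, hx⟩ := mem_unitsOneMod_iff.1 hv
    refine mem_unitsOneMod_iff.2 ⟨x + p * x ^ 2, ?_⟩
    rw [powMonoidHom_apply, Units.val_pow_eq_pow_val, hx, hsq]
  · intro hu
    obtain ⟨y, hy⟩ := mem_unitsOneMod_iff.1 hu
    obtain ⟨x, hx⟩ := exists_add_p_mul_sq b y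
    have hunit : IsUnit (1 + (2 * (p : ℤ_[p])) • x) := by
      have : 1 + (2 * (p : ℤ_[p])) • x = 1 + (p : S) * (2 * x) := by
        simp only [Algebra.smul_def, map_mul, map_natCast, map_ofNat]
        ring
      rw [this]
      exact isUnit_one_add_p_mul _
    refine ⟨hunit.unit, mem_unitsOneMod_iff.2 ⟨x, rfl⟩, Units.ext ?_⟩
    rw [powMonoidHom_apply, Units.val_pow_eq_pow_val, IsUnit.unit_spec, hsq, hx, hy]

theorem eq_one_of_sq_eq_one_of_mem_unitsOneMod (b : Module.Basis ι ℤ_[p] S) {u : Sˣ}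
    (hu : u ∈ unitsOneMod p S (2 * p)) (h : u ^ 2 = 1) : u = 1 := by
  have : Module.Free ℤ_[p] S := Module.Free.of_basis b
  have : Module.Finite ℤ_[p] S := Module.Finite.of_basis b
  have hp0 : (p : ℤ_[p]) ≠ 0 := by exact_mod_cast (Fact.out : p.Prime).ne_zero
  obtain ⟨x, hx⟩ := mem_unitsOneMod_iff.1 hu
  have h1 : (u : S) ^ 2 = 1 := by rw [← Units.val_pow_eq_pow_val, h, Units.val_one]
  have h2 : (4 * (p : ℤ_[p])) • ((1 + p * x) * x) = (4 * (p : ℤ_[p])) • (0 : S) := by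
    rw [hx] at h1
    simp only [Algebra.smul_def, map_mul, map_natCast, map_ofNat] at h1 ⊢
    linear_combination h1
  have h3 := smul_right_cancel_of_basis b (mul_ne_zero (by norm_num) hp0) h2
  have h4 : x = 0 := (isUnit_one_add_p_mul x).mul_right_eq_zero.1 h3
  rw [h4, smul_zero, add_zero] at hx
  exact Units.ext hx

/-- The map `1 + 2p x ↦ x mod 2` is a surjective homomorphism from `1 + 2p S` to `S / 2`, with
kernel `1 + 4p S`. -/
theorem relIndex_unitsOneMod (b : Module.Basis ι ℤ_[p] S) :
    (unitsOneMod p S (4 * p)).relIndex (unitsOneMod p S (2 * p)) =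
      Nat.card (ℤ_[p] ⧸ Ideal.span {(2 : ℤ_[p])}) ^ Fintype.card ι := by
  have : Module.Free ℤ_[p] S := Module.Free.of_basis b
  have : Module.Finite ℤ_[p] S := Module.Finite.of_basis b
  have hp0 : (p : ℤ_[p]) ≠ 0 := by exact_mod_cast (Fact.out : p.Prime).ne_zero
  have h2p : 2 * (p : ℤ_[p]) ≠ 0 := mul_ne_zero two_ne_zero hp0
  choose x hx using fun u : unitsOneMod p S (2 * p) => mem_unitsOneMod_iff.1 u.2
  have hx' : ∀ (u : unitsOneMod p S (2 * p)) (y : S),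
      ((u : Sˣ) : S) = 1 + (2 * (p : ℤ_[p])) • y → x u = y := fun u y h =>
    smul_right_cancel_of_basis b h2p (add_left_cancel ((hx u).symm.trans h))
  let f : unitsOneMod p S (2 * p) →* Multiplicative (ι → ℤ_[p] ⧸ Ideal.span {(2 : ℤ_[p])}) :=
    MonoidHom.mk' (fun u => Multiplicative.ofAdd (reduceMod b 2 (x u))) (by
      intro u v
      have h1 : x (u * v) = x u + x v + (2 : ℤ_[p]) • (p * x u * x v) := by
        apply hx'
        rw [Subgroup.coe_mul, Units.val_mul, hx u, hx v]
        simp only [Algebra.smul_def, map_mul, map_natCast, map_ofNat]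
        ring
      rw [h1, map_add (reduceMod b 2), map_add (reduceMod b 2),
        (reduceMod_eq_zero_iff b 2 _).2 ⟨_, rfl⟩, add_zero, ofAdd_add])
  have hsurj : Function.Surjective f := by
    intro v
    obtain ⟨y, hy⟩ := reduceMod_surjective b 2 (Multiplicative.toAdd v)
    have hunit : IsUnit (1 + (2 * (p : ℤ_[p])) • y) := by
      have : 1 + (2 * (p : ℤ_[p])) • y = 1 + (p : S) * (2 * y) := by
        simp only [Algebra.smul_def, map_mul, map_natCast, map_ofNat]
        ring
      rw [this]
      exact isUnit_one_add_p_mul _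
    refine ⟨⟨hunit.unit, mem_unitsOneMod_iff.2 ⟨y, rfl⟩⟩, ?_⟩
    change Multiplicative.ofAdd (reduceMod b 2 (x _)) = v
    rw [hx' _ y rfl, hy, ofAdd_toAdd]
  have hker : f.ker = (unitsOneMod p S (4 * p)).subgroupOf (unitsOneMod p S (2 * p)) := by
    ext u
    rw [MonoidHom.mem_ker, Subgroup.mem_subgroupOf, mem_unitsOneMod_iff]
    change reduceMod b 2 (x u) = 0 ↔ _
    rw [reduceMod_eq_zero_iff]
    refine exists_congr fun y => ?_
    have h4 : (4 * (p : ℤ_[p])) • y = (2 * (p : ℤ_[p])) • ((2 : ℤ_[p]) • y) := by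
      rw [smul_smul]
      congr 1
      ring
    rw [h4]
    exact ⟨fun h => by rw [hx u, h], hx' u _⟩
  rw [Subgroup.relIndex, ← hker, Subgroup.index_ker, MonoidHom.range_eq_top.2 hsurj,
    Subgroup.card_top, Nat.card_congr Multiplicative.toAdd, Nat.card_fun, Nat.card_eq_fintype_card
      (α := ι)]

/-- For a free `ℤ_[p]`-algebra `S` of rank `d`, the group `S ^ × [2]` is finite and
`#(S ^ × / S ^ ×²) = #S ^ × [2] * #(ℤ_p / 2) ^ d`. -/
theorem card_units_quot_sq (b : Module.Basis ι ℤ_[p] S) :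
    Finite (powMonoidHom 2 : Sˣ →* Sˣ).ker ∧
    Nat.card (Sˣ ⧸ (powMonoidHom 2 : Sˣ →* Sˣ).range) =
      Nat.card (powMonoidHom 2 : Sˣ →* Sˣ).ker *
        Nat.card (ℤ_[p] ⧸ Ideal.span {(2 : ℤ_[p])}) ^ Fintype.card ι := by
  have hp0 : (p : ℤ_[p]) ≠ 0 := by exact_mod_cast (Fact.out : p.Prime).ne_zero
  have hfin := unitsOneMod_finiteIndex (p := p) b (mul_ne_zero two_ne_zero hp0)
  obtain ⟨h1, h2⟩ := index_range_sq_eq (unitsOneMod p S (2 * p))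
    fun u hu h => eq_one_of_sq_eq_one_of_mem_unitsOneMod b hu h
  refine ⟨h1, ?_⟩
  rw [map_sq_unitsOneMod b, relIndex_unitsOneMod b, ← mul_assoc] at h2
  exact Nat.eq_of_mul_eq_mul_right (Nat.pos_of_ne_zero hfin.index_ne_zero) h2

/-- An element of `1 + 4p S` is a square. -/
theorem exists_sq_eq_of_mem_unitsOneMod (b : Module.Basis ι ℤ_[p] S) {u : Sˣ}
    (hu : u ∈ unitsOneMod p S (4 * p)) : ∃ v : Sˣ, v ^ 2 = u := by
  rw [← map_sq_unitsOneMod b] at hu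
  obtain ⟨v, -, hv⟩ := hu
  exact ⟨v, hv⟩

/-- Invertible modules over a finite free `ℤ_[p]`-algebra are principal. -/
theorem exists_units_smul_eq_of_isUnit (b : Module.Basis ι ℤ_[p] S) {A : Type*} [CommRing A]
    [Algebra S A] [FaithfulSMul S A] {I : Submodule S A} (hI : IsUnit I) :
    ∃ κ : Aˣ, I = κ • (1 : Submodule S A) := by
  have := finite_maximalSpectrum_of_basis b
  obtain ⟨J, rfl⟩ := hI
  -- the Picard group of a semilocal ring is trivial
  have h1 : J ∈ (Submodule.unitsToPic S A).ker := MonoidHom.mem_ker.2 (Subsingleton.elim _ _)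
  rw [Submodule.ker_unitsToPic] at h1
  obtain ⟨κ, rfl⟩ := h1
  refine ⟨κ, ?_⟩
  ext x
  simp [Submodule.mem_span_singleton, Submodule.mem_smul_pointwise_iff_exists, Algebra.smul_def,
    Units.smul_def, mul_comm]

end PadicAlgebra

namespace BinForm

/-! ### The fractional ideals `I_F ^ k` -/

section Ideals

variable {R : Type*} [CommRing R] {n : ℕ} (F : BinForm R n)
variable (K : Type*) [Field K] [Algebra R K]

/-- The `R_F`-module generated by `1` and `θ`; its `k`-th power is `I_F ^ k` for `k < n`. -/
noncomputable def thetaIdeal : Submodule (F.RF K) (F.KF K) :=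
  Submodule.span (F.RF K) {1, F.theta K}

theorem mem_one_iff {x : F.KF K} : x ∈ (1 : Submodule (F.RF K) (F.KF K)) ↔ x ∈ F.lattice K 0 := by
  rw [Submodule.mem_one]
  exact ⟨fun ⟨y, hy⟩ => hy ▸ y.2, fun h => ⟨⟨x, h⟩, rfl⟩⟩

theorem IF_zero : F.IF K 0 = 1 := by
  ext x
  rw [mem_one_iff]
  rfl

theorem lattice_induction {k : ℕ} {P : Submodule R (F.KF K)}
    (hpow : ∀ j ≤ k, j < n → F.theta K ^ j ∈ P) (hzeta : ∀ i, k < i → i < n → F.zeta K i ∈ P) :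
    F.lattice K k ≤ P := by
  rw [lattice, Submodule.span_le]
  rintro _ ⟨i, rfl⟩
  by_cases hi : (i : ℕ) ≤ k
  · rw [gen, if_pos hi]
    exact hpow i hi i.2
  · rw [gen, if_neg hi]
    exact hzeta i (not_le.1 hi) i.2

theorem thetaIdeal_mul_IF {k : ℕ} (hk : k + 1 < n) :
    F.thetaIdeal K * F.IF K k = F.IF K (k + 1) := by
  apply le_antisymm
  · have h1 : F.lattice K k ≤ F.lattice K (k + 1) :=
      F.lattice_induction K (fun j hj hjn => F.theta_pow_mem K (by omega) hjn)
        fun i _ hi => F.zeta_mem K _ hi.le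
    have h2 : F.lattice K k ≤ (F.lattice K (k + 1)).comap (LinearMap.mulLeft R (F.theta K)) := by
      refine F.lattice_induction K (fun j hj hjn => ?_) fun i hki hi => ?_
      · change F.theta K * F.theta K ^ j ∈ F.lattice K (k + 1)
        rw [← pow_succ']
        exact F.theta_pow_mem K (by omega) (by omega)
      · change F.theta K * F.zeta K i ∈ F.lattice K (k + 1)
        have h : F.theta K * F.zeta K i =
            F.zeta K (i + 1) - algebraMap R _ (F.c i) * F.theta K ^ 1 := by
          rw [zeta_succ]; ring
        rw [h]
        exact Submodule.sub_mem _ (F.zeta_mem K _ hi)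
          (F.algebraMap_mul_mem K _ (F.theta_pow_mem K (by omega) (by omega)))
    refine Submodule.mul_le.2 fun x hx y hy => ?_
    obtain ⟨a, b, rfl⟩ := Submodule.mem_span_pair.1 hx
    rw [add_mul, smul_mul_assoc, smul_mul_assoc, one_mul]
    exact Submodule.add_mem _ (Submodule.smul_mem _ _ (h1 hy)) (Submodule.smul_mem _ _ (h2 hy))
  · have h1 : (1 : F.KF K) ∈ F.thetaIdeal K := Submodule.subset_span (by simp)
    have hθ : F.theta K ∈ F.thetaIdeal K := Submodule.subset_span (by simp)
    have h := F.lattice_induction K (k := k + 1)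
      (P := (F.thetaIdeal K * F.IF K k).restrictScalars R) (fun j hj hjn => ?_)
      fun i _ hi => ?_
    · exact fun x hx => h hx
    · rcases j with _ | j
      · have := Submodule.mul_mem_mul h1 (show (1 : F.KF K) ∈ F.IF K k from F.one_mem K k)
        rwa [one_mul, ← pow_zero (F.theta K)] at this
      · have : F.theta K ^ j ∈ F.IF K k := F.theta_pow_mem K (by omega) (by omega)
        have := Submodule.mul_mem_mul hθ this
        rwa [← pow_succ'] at this
    · have : F.zeta K i ∈ F.IF K k := F.zeta_mem K k hi.le
      have := Submodule.mul_mem_mul h1 this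
      rwa [one_mul] at this

theorem IF_eq_pow {k : ℕ} (hk : k < n) : F.IF K k = F.thetaIdeal K ^ k := by
  induction k with
  | zero => rw [pow_zero, IF_zero]
  | succ k ih => rw [← F.thetaIdeal_mul_IF K hk, ih (by omega), pow_succ']

/-- If `F` is primitive, then `(1, θ)` is invertible; its inverse is generated by the elements
`ζ_i + f_i` with `i < n`, since `θ (ζ_i + f_i) = ζ_{i+1}` and hence the product contains every
coefficient of `F`. -/
theorem isUnit_thetaIdeal (hF : F.IsPrimitive) : IsUnit (F.thetaIdeal K) := by
  set J : Submodule (F.RF K) (F.KF K) := Submodule.span (F.RF K)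
    (Set.range fun i : Fin n => F.zeta K i + algebraMap R _ (F.c i)) with hJ
  have hJmem : ∀ i < n, F.zeta K i + algebraMap R _ (F.c i) ∈ J :=
    fun i hi => Submodule.subset_span ⟨⟨i, hi⟩, rfl⟩
  have h1 : (1 : F.KF K) ∈ F.thetaIdeal K := Submodule.subset_span (by simp)
  have hθ : F.theta K ∈ F.thetaIdeal K := Submodule.subset_span (by simp)
  have hz : ∀ i ≤ n, F.zeta K i ∈ F.thetaIdeal K * J := by
    intro i hi
    rcases i with _ | i
    · rw [zeta_zero]; exact Submodule.zero_mem _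
    · rw [zeta_succ]; exact Submodule.mul_mem_mul hθ (hJmem i hi)
  have hc : ∀ i ≤ n, algebraMap R (F.KF K) (F.c i) ∈ F.thetaIdeal K * J := by
    intro i hi
    rcases hi.eq_or_lt with rfl | hlt
    · have := Submodule.neg_mem _ (hz i le_rfl)
      rwa [zeta_n, neg_neg] at this
    · have := Submodule.sub_mem _ (Submodule.mul_mem_mul h1 (hJmem i hlt)) (hz i hi)
      rwa [one_mul, add_sub_cancel_left] at this
  refine IsUnit.of_mul_eq_one J (le_antisymm ?_ ?_)
  · rw [thetaIdeal, hJ, Submodule.span_mul_span, Submodule.span_le]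
    rintro _ ⟨x, hx, _, ⟨i, rfl⟩, rfl⟩
    refine (F.mem_one_iff K).2 ?_
    change x * (F.zeta K i + algebraMap R _ (F.c i)) ∈ _
    rcases hx with rfl | rfl
    · rw [one_mul]
      exact Submodule.add_mem _ (F.zeta_mem K 0 i.2.le) (F.algebraMap_mem K 0 _)
    · rw [← zeta_succ]
      exact F.zeta_mem K 0 i.2
  · rw [Submodule.one_le]
    let Q : Submodule R (F.KF K) := (F.thetaIdeal K * J).restrictScalars R
    have h2 : Ideal.span (Set.range F.f) ≤ Q.comap (Algebra.linearMap R (F.KF K)) := by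
      rw [Ideal.span, Submodule.span_le]
      rintro _ ⟨i, rfl⟩
      have := hc i (Nat.lt_succ_iff.1 i.2)
      rw [c, dif_pos i.2] at this
      exact this
    rw [hF] at h2
    have := h2 (Submodule.mem_top : (1 : R) ∈ _)
    rw [Submodule.mem_comap, Algebra.linearMap_apply, map_one] at this
    exact this

end Ideals

/-! ### Norms of families and of based ideals -/

section Norms

variable {R : Type*} [CommRing R] {n : ℕ} (F : BinForm R n)
variable (K : Type*) [Field K] [Algebra R K] [IsFractionRing R K]

theorem familyNorm_sum_smul (M : Matrix (Fin n) (Fin n) R) (w : Fin n → F.KF K) :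
    F.familyNorm K (fun i => ∑ j, M i j • w j) = algebraMap R K M.det * F.familyNorm K w := by
  rw [familyNorm, familyNorm, Module.Basis.det_apply, Module.Basis.det_apply]
  have h : (F.genBasis K 0).toMatrix (fun i => ∑ j, M i j • w j) =
      (F.genBasis K 0).toMatrix w * ((algebraMap R K).mapMatrix M).transpose := by
    ext a i
    simp only [Module.Basis.toMatrix_apply, Matrix.mul_apply, Matrix.transpose_apply,
      RingHom.mapMatrix_apply, Matrix.map_apply, map_sum, Finset.sum_apply, Finsupp.coe_finsetSum]
    refine Finset.sum_congr rfl fun j _ => ?_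
    rw [← algebraMap_smul K (M i j), map_smul, Finsupp.smul_apply, smul_eq_mul, mul_comm]
  rw [h, Matrix.det_mul, Matrix.det_transpose, ← RingHom.map_det, mul_comm]

theorem familyNorm_mul (x : F.KF K) (v : Fin n → F.KF K) :
    F.familyNorm K (fun i => x * v i) = Algebra.norm K x * F.familyNorm K v := by
  rw [familyNorm, familyNorm, Algebra.norm_apply, ← Module.Basis.det_comp]
  rfl

theorem familyNorm_gen_zero : F.familyNorm K (F.gen K 0) = 1 := by
  rw [familyNorm, ← coe_genBasis, Module.Basis.det_self]

/-- The norms of two bases of the same module differ by a unit. -/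
theorem familyNorm_basis_eq {I : Submodule (F.RF K) (F.KF K)} (b b' : Module.Basis (Fin n) R I) :
    ∃ u : Rˣ, F.familyNorm K (fun i => (b i : F.KF K)) =
      algebraMap R K u * F.familyNorm K (fun i => (b' i : F.KF K)) := by
  obtain ⟨u, hu⟩ := Module.Basis.isUnit_det b' b
  refine ⟨u, ?_⟩
  have h : (fun i => (b i : F.KF K)) =
      fun i => ∑ j, (b'.toMatrix b).transpose i j • (b' j : F.KF K) := by
    ext i
    conv_lhs => rw [← b'.sum_repr (b i)]
    rw [AddSubmonoidClass.coe_finsetSum]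
    rfl
  rw [h, familyNorm_sum_smul, Matrix.det_transpose, ← Module.Basis.det_apply, hu]

/-- The basis `κ, κ ζ_1, …, κ ζ_{n-1}` of `κ R_F`. -/
noncomputable def basisSMulOne (κ : (F.KF K)ˣ) :
    Module.Basis (Fin n) R (κ • (1 : Submodule (F.RF K) (F.KF K)) : Submodule (F.RF K) (F.KF K)) :=
  (F.basisRF K).map
    { toFun := fun x => ⟨κ * (x : F.KF K),
        ⟨x, (F.mem_one_iff K).2 x.2, rfl⟩⟩
      invFun := fun y => ⟨((κ⁻¹ : (F.KF K)ˣ) : F.KF K) * (y : F.KF K), by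
        obtain ⟨z, hz, hzy⟩ := y.2
        have h : (κ : F.KF K) * z = y := hzy
        rw [← h, ← mul_assoc, Units.inv_mul, one_mul]
        exact (F.mem_one_iff K).1 hz⟩
      map_add' := fun x y => Subtype.ext (by simp [mul_add])
      map_smul' := fun a x => Subtype.ext (by simp)
      left_inv := fun x => Subtype.ext (by simp)
      right_inv := fun y => Subtype.ext (by simp) }

theorem coe_basisSMulOne (κ : (F.KF K)ˣ) (i : Fin n) :
    (F.basisSMulOne K κ i : F.KF K) = κ * F.gen K 0 i := by
  rw [← coe_basisRF]; rfl

/-- If `I = κ R_F`, then the norm of a basis of `I` is `N(κ)` up to a unit. -/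
theorem familyNorm_eq_of_eq_smul_one {I : Submodule (F.RF K) (F.KF K)}
    (b : Module.Basis (Fin n) R I) {κ : (F.KF K)ˣ}
    (hI : I = κ • (1 : Submodule (F.RF K) (F.KF K))) :
    ∃ u : Rˣ, F.familyNorm K (fun i => (b i : F.KF K)) =
      algebraMap R K u * Algebra.norm K (κ : F.KF K) := by
  subst hI
  obtain ⟨u, hu⟩ := F.familyNorm_basis_eq K b (F.basisSMulOne K κ)
  refine ⟨u, ?_⟩
  rw [hu]
  simp only [coe_basisSMulOne]
  rw [familyNorm_mul, familyNorm_gen_zero, mul_one]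

/-- Modulo `1, θ, …, θ ^ k` the elements `ζ_{k+1}` and `f_0 θ ^ (k+1)` agree. -/
theorem normIF_succ {k : ℕ} (hk : k + 1 < n) :
    F.normIF K k = algebraMap R K (F.c 0) * F.normIF K (k + 1) := by
  classical
  set i₀ : Fin n := ⟨k + 1, hk⟩ with hi₀
  let L : F.KF K →ₗ[K] K :=
    (F.genBasis K 0).det.toMultilinearMap.toLinearMap (F.gen K (k + 1)) i₀
  have hL : ∀ x, L x = F.familyNorm K (Function.update (F.gen K (k + 1)) i₀ x) := fun _ => rfl
  have h1 : Function.update (F.gen K (k + 1)) i₀ (F.zeta K (k + 1)) = F.gen K k := by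
    ext i
    by_cases hi : i = i₀
    · subst hi
      rw [Function.update_self, gen, if_neg (by simp [hi₀])]
    · have : (i : ℕ) ≠ k + 1 := fun h => hi (Fin.ext h)
      rw [Function.update_of_ne hi, gen, gen]
      by_cases hik : (i : ℕ) ≤ k
      · rw [if_pos hik, if_pos (by omega)]
      · rw [if_neg hik, if_neg (by omega)]
  have h2 : Function.update (F.gen K (k + 1)) i₀ (F.theta K ^ (k + 1)) = F.gen K (k + 1) := by
    have : F.theta K ^ (k + 1) = F.gen K (k + 1) i₀ := by rw [gen, if_pos (by simp [hi₀])]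
    rw [this, Function.update_eq_self]
  have h3 : ∀ l ≤ k, L (F.theta K ^ l) = 0 := by
    intro l hl
    have : F.theta K ^ l = F.gen K (k + 1) ⟨l, by omega⟩ := by
      rw [gen, if_pos (by simp; omega)]
    rw [this]
    exact (F.genBasis K 0).det.map_update_self _ (by simp [hi₀, Fin.ext_iff]; omega)
  rw [normIF, normIF, ← h1, ← hL, zeta, Finset.sum_range_succ', map_add, map_sum,
    Finset.sum_eq_zero, zero_add, ← algebraMap_smul K (F.c 0), map_smul, Nat.sub_zero, hL, h2,
    smul_eq_mul]
  intro j hj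
  rw [← algebraMap_smul K (F.c (j + 1)), map_smul, h3 _ (by omega), smul_zero]

theorem normIF_mul_pow {k : ℕ} (hk : k < n) :
    F.normIF K k * algebraMap R K (F.c 0) ^ k = 1 := by
  induction k with
  | zero => rw [pow_zero, mul_one, normIF, familyNorm_gen_zero]
  | succ k ih => rw [← ih (by omega), F.normIF_succ K hk]; ring

theorem normIF_ne_zero {k : ℕ} (hk : k < n) : F.normIF K k ≠ 0 :=
  left_ne_zero_of_mul_eq_one (F.normIF_mul_pow K hk)

/-- If `J ⊆ I` have bases of the same norm up to a unit, then `J = I`. -/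
theorem eq_of_le_of_familyNorm_eq {I J : Submodule (F.RF K) (F.KF K)}
    (b : Module.Basis (Fin n) R I) (b' : Module.Basis (Fin n) R J) (hle : J ≤ I) (u : Rˣ)
    (h0 : F.familyNorm K (fun i => (b i : F.KF K)) ≠ 0)
    (h : F.familyNorm K (fun i => (b' i : F.KF K)) =
      algebraMap R K u * F.familyNorm K (fun i => (b i : F.KF K))) : J = I := by
  let M : Matrix (Fin n) (Fin n) R := fun i j => b.repr ⟨b' i, hle (b' i).2⟩ j
  have hM : (fun i => (b' i : F.KF K)) = fun i => ∑ j, M i j • (b j : F.KF K) := by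
    ext i
    have := congrArg (Subtype.val : I → F.KF K) (b.sum_repr ⟨b' i, hle (b' i).2⟩)
    rw [AddSubmonoidClass.coe_finsetSum] at this
    exact this.symm
  have hdet : M.det = u := by
    rw [hM, familyNorm_sum_smul] at h
    exact IsFractionRing.injective R K (mul_right_cancel₀ h0 h)
  have hinv : M⁻¹ * M = 1 := Matrix.nonsing_inv_mul _ (hdet ▸ u.isUnit)
  refine le_antisymm hle fun x hx => ?_
  have hb : ∀ i, (b i : F.KF K) ∈ J := by
    intro i
    have : (b i : F.KF K) = ∑ j, M⁻¹ i j • (b' j : F.KF K) := by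
      have h1 : ∀ j, (b' j : F.KF K) = ∑ l, M j l • (b l : F.KF K) := fun j => congrFun hM j
      simp only [h1, Finset.smul_sum, smul_smul]
      rw [Finset.sum_comm]
      simp only [← Finset.sum_smul, ← Matrix.mul_apply, hinv]
      simp [Matrix.one_apply]
    rw [this]
    exact (J.restrictScalars R).sum_mem fun j _ => (J.restrictScalars R).smul_mem _ (b' j).2
  have := congrArg (Subtype.val : I → F.KF K) (b.sum_repr ⟨x, hx⟩)
  rw [AddSubmonoidClass.coe_finsetSum] at this
  rw [← show _ = x from this]
  exact (J.restrictScalars R).sum_mem fun j _ => (J.restrictScalars R).smul_mem _ (hb j)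

end Norms

/-! ### The functionals `π_{n-1}` and `π_{n-2}` on `K_F` -/

section Functionals

variable {R : Type*} [CommRing R] {n : ℕ} (F : BinForm R n)
variable (K : Type*) [Field K] [Algebra R K] [IsFractionRing R K]

/-- The `K`-linear extension of `π_{n-1}` to `K_F`. -/
noncomputable def extLast : F.KF K →ₗ[K] K :=
  -((F.genBasis K (n - 2)).coord ⟨n - 1, Nat.sub_lt F.deg_pos one_pos⟩)

/-- The `K`-linear extension of `π_{n-2}` to `K_F`. -/
noncomputable def extPrev : F.KF K →ₗ[K] K :=
  (F.genBasis K (n - 2)).coord ⟨n - 2, Nat.sub_lt F.deg_pos two_pos⟩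

theorem genBasis_repr_coe (k : ℕ) (x : F.IF K k) (i : Fin n) :
    (F.genBasis K k).repr (x : F.KF K) i = algebraMap R K ((F.basisIF K k).repr x i) := by
  have h : (x : F.KF K) = ∑ l, algebraMap R K ((F.basisIF K k).repr x l) • F.genBasis K k l := by
    have h1 := congrArg (Subtype.val : F.IF K k → F.KF K) ((F.basisIF K k).sum_repr x)
    rw [AddSubmonoidClass.coe_finsetSum] at h1
    simp only [coe_genBasis, ← coe_basisIF, algebraMap_smul]
    exact h1.symm
  rw [h, Module.Basis.repr_sum_self]

theorem algebraMap_piLast (x : F.IF K (n - 2)) :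
    algebraMap R K (F.piLast K x) = F.extLast K x := by
  rw [piLast, extLast, LinearMap.neg_apply, LinearMap.neg_apply, Module.Basis.coord_apply,
    Module.Basis.coord_apply, genBasis_repr_coe, map_neg]

theorem algebraMap_piPrev (x : F.IF K (n - 2)) :
    algebraMap R K (F.piPrev K x) = F.extPrev K x := by
  rw [piPrev, extPrev, Module.Basis.coord_apply, Module.Basis.coord_apply, genBasis_repr_coe]

theorem extLast_theta_pow {j : ℕ} (hj : j + 1 < n) : F.extLast K (F.theta K ^ j) = 0 := by
  have h : F.theta K ^ j = F.genBasis K (n - 2) ⟨j, by omega⟩ := by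
    rw [coe_genBasis, gen, if_pos (by simp; omega)]
  rw [h, extLast, LinearMap.neg_apply, Module.Basis.coord_apply, Module.Basis.repr_self,
    Finsupp.single_apply, if_neg (by simp; omega), neg_zero]

theorem lead_mul_extLast_theta_pow (hn : 2 ≤ n) :
    algebraMap R K (F.c 0) * F.extLast K (F.theta K ^ (n - 1)) = -1 := by
  have h : F.zeta K (n - 1) = F.genBasis K (n - 2) ⟨n - 1, by omega⟩ := by
    rw [coe_genBasis, gen, if_neg (by simp; omega)]
  have h1 : F.extLast K (F.zeta K (n - 1)) = -1 := by
    rw [h, extLast, LinearMap.neg_apply, Module.Basis.coord_apply, Module.Basis.repr_self,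
      Finsupp.single_apply, if_pos rfl]
  obtain ⟨m, rfl⟩ : ∃ m, n = m + 2 := ⟨n - 2, by omega⟩
  rw [← h1, zeta, show m + 2 - 1 = m + 1 by omega, Finset.sum_range_succ', map_add, map_sum,
    Finset.sum_eq_zero, zero_add, ← algebraMap_smul K (F.c 0), map_smul, smul_eq_mul, Nat.sub_zero]
  intro j hj
  rw [← algebraMap_smul K (F.c (j + 1)), map_smul, F.extLast_theta_pow K (by omega), smul_zero]

theorem lead_mul_extLast_aeval (hn : 2 ≤ n) {q : Polynomial K} (hq : q.natDegree < n) :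
    algebraMap R K (F.c 0) * F.extLast K (Polynomial.aeval (F.theta K) q) = -q.coeff (n - 1) := by
  rw [Polynomial.aeval_eq_sum_range' hq, map_sum,
    Finset.sum_eq_single_of_mem (n - 1) (Finset.mem_range.2 (by omega))]
  · rw [map_smul, smul_eq_mul, mul_left_comm, F.lead_mul_extLast_theta_pow K hn, mul_neg_one]
  · intro j hj hjn
    rw [map_smul, F.extLast_theta_pow K (by have := Finset.mem_range.1 hj; omega), smul_zero]

/-- The two functionals differ by multiplication by `θ`, up to a constant. -/
theorem extPrev_eq (hn : 3 ≤ n) (x : F.KF K) :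
    F.extPrev K x = -(algebraMap R K (F.c 0) * F.extLast K (F.theta K * x)) := by
  have h : F.extPrev K =
      -(algebraMap R K (F.c 0) • F.extLast K ∘ₗ LinearMap.mulLeft K (F.theta K)) := by
    refine (F.genBasis K (n - 2)).ext fun i => ?_
    rw [extPrev, Module.Basis.coord_apply, Module.Basis.repr_self, Finsupp.single_apply]
    rw [LinearMap.neg_apply, LinearMap.smul_apply, LinearMap.comp_apply, LinearMap.mulLeft_apply,
      smul_eq_mul, coe_genBasis, gen]
    by_cases hi : (i : ℕ) ≤ n - 2
    · rw [if_pos hi, ← pow_succ']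
      by_cases hi' : (i : ℕ) = n - 2
      · rw [if_pos (Fin.ext hi'), show (i : ℕ) + 1 = n - 1 by omega,
          F.lead_mul_extLast_theta_pow K (by omega), neg_neg]
      · rw [if_neg fun h => hi' (congrArg Fin.val h), F.extLast_theta_pow K (by omega), mul_zero,
          neg_zero]
    · have hi' : (i : ℕ) + 1 = n := by omega
      have h1 : F.theta K * F.zeta K i =
          -(algebraMap R K (F.c n) • F.theta K ^ 0 + algebraMap R K (F.c i) • F.theta K ^ 1) := by
        have := F.zeta_succ K i
        rw [hi', zeta_n, mul_add] at this
        rw [algebraMap_smul, algebraMap_smul, Algebra.smul_def, Algebra.smul_def]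
        linear_combination -this
      rw [if_neg hi, if_neg (fun h => hi (congrArg Fin.val h).le), h1, map_neg, map_add, map_smul,
        map_smul, F.extLast_theta_pow K (by omega), F.extLast_theta_pow K (by omega)]
      simp
  rw [h]
  rfl

theorem exists_aeval_theta_eq (x : F.KF K) :
    ∃ q : Polynomial K, q.natDegree < n ∧ Polynomial.aeval (F.theta K) q = x := by
  have : Nontrivial (F.KF K) :=
    Module.nontrivial_of_finrank_pos (R := K) (by rw [finrank_KF]; exact F.deg_pos)
  obtain ⟨q, hq, hqx⟩ := (AdjoinRoot.powerBasis (F.map_ne_zero K)).exists_eq_aeval x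
  rw [AdjoinRoot.powerBasis_dim, natDegree_map] at hq
  exact ⟨q, hq, hqx.symm⟩

/-- The form `(x, y) ↦ π_{n-1}(x y)` on `K_F` is nondegenerate. -/
theorem eq_zero_of_extLast_mul_eq_zero (hn : 2 ≤ n) {x : F.KF K}
    (h : ∀ y, F.extLast K (x * y) = 0) : x = 0 := by
  by_contra hx
  obtain ⟨q, hq, rfl⟩ := F.exists_aeval_theta_eq K x
  have hq0 : q ≠ 0 := by
    rintro rfl
    exact hx (map_zero _)
  have h1 := h (F.theta K ^ (n - 1 - q.natDegree))
  have h2 : Polynomial.aeval (F.theta K) q *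
      F.theta K ^ (n - 1 - q.natDegree) =
      Polynomial.aeval (F.theta K) (q * Polynomial.X ^ (n - 1 - q.natDegree)) := by
    rw [map_mul, map_pow, Polynomial.aeval_X]
  have h3 := F.lead_mul_extLast_aeval K hn (q := q * Polynomial.X ^ (n - 1 - q.natDegree)) (by
    rw [Polynomial.natDegree_mul_X_pow _ hq0]
    omega)
  rw [← h2, h1, mul_zero] at h3
  have h4 : (q * Polynomial.X ^ (n - 1 - q.natDegree)).coeff (n - 1) = q.leadingCoeff := by
    conv_lhs => rw [show n - 1 = q.natDegree + (n - 1 - q.natDegree) by omega]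
    rw [show n - 1 - q.natDegree = q.natDegree + (n - 1 - q.natDegree) - q.natDegree by omega]
    simp
  rw [h4] at h3
  exact hq0 (Polynomial.leadingCoeff_eq_zero.1 (neg_eq_zero.1 h3.symm))

/-- A `K`-linear map which commutes with `θ` is `K_F`-linear. -/
theorem linearMap_eq_mul_of_comm_theta (φ : F.KF K →ₗ[K] F.KF K)
    (h : ∀ x, φ (F.theta K * x) = F.theta K * φ x) (x : F.KF K) : φ x = φ 1 * x := by
  have key : ∀ q : Polynomial K, ∀ y,
      φ (Polynomial.aeval (F.theta K) q * y) = Polynomial.aeval (F.theta K) q * φ y := by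
    intro q
    induction q using Polynomial.induction_on' with
    | add q q' ih ih' => intro y; rw [map_add, add_mul, map_add, ih, ih', add_mul]
    | monomial m a =>
      intro y
      rw [Polynomial.aeval_monomial, ← Algebra.smul_def, smul_mul_assoc, map_smul, smul_mul_assoc]
      congr 1
      induction m with
      | zero => rw [pow_zero, one_mul, one_mul]
      | succ m ih => rw [pow_succ', mul_assoc, h, ih, mul_assoc]
  obtain ⟨q, -, rfl⟩ := F.exists_aeval_theta_eq K x
  have := key q 1
  rw [mul_one, mul_comm] at this
  exact this

theorem isBasis_of_familyNorm_ne_zero {v : Fin n → F.KF K} (hv : F.familyNorm K v ≠ 0) :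
    ∃ b : Module.Basis (Fin n) K (F.KF K), ⇑b = v := by
  obtain ⟨h1, h2⟩ := ((F.genBasis K 0).is_basis_iff_det (v := v)).2 hv.isUnit
  exact ⟨Module.Basis.mk h1 h2.ge, Module.Basis.coe_mk _ _⟩

/-- Two bases of `K_F` which have the same Gram matrices for `π_{n-1}(α⁻¹ x y)`,
`π_{n-2}(α⁻¹ x y)` and for `π_{n-1}(β⁻¹ x y)`, `π_{n-2}(β⁻¹ x y)` differ by multiplication by some
`κ` with `β = κ² α`: an isometry for both forms commutes with `θ`, hence is `K_F`-linear. -/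
theorem exists_units_of_gram_eq (hn : 3 ≤ n) {v w : Fin n → F.KF K}
    (hv : F.familyNorm K v ≠ 0) (hw : F.familyNorm K w ≠ 0) (α β : (F.KF K)ˣ)
    (h1 : ∀ i j, F.extLast K (((α⁻¹ : (F.KF K)ˣ) : F.KF K) * (v i * v j)) =
      F.extLast K (((β⁻¹ : (F.KF K)ˣ) : F.KF K) * (w i * w j)))
    (h2 : ∀ i j, F.extPrev K (((α⁻¹ : (F.KF K)ˣ) : F.KF K) * (v i * v j)) =
      F.extPrev K (((β⁻¹ : (F.KF K)ˣ) : F.KF K) * (w i * w j))) :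
    ∃ κ : (F.KF K)ˣ, (∀ i, w i = κ * v i) ∧ β = κ ^ 2 * α := by
  obtain ⟨bv, rfl⟩ := F.isBasis_of_familyNorm_ne_zero K hv
  obtain ⟨bw, rfl⟩ := F.isBasis_of_familyNorm_ne_zero K hw
  let φ : F.KF K ≃ₗ[K] F.KF K := bv.equiv bw (Equiv.refl _)
  have hφ : ∀ i, φ (bv i) = bw i := fun i => by simp [φ]
  have ext : ∀ ℓ : F.KF K →ₗ[K] K,
      (∀ i j, ℓ (((α⁻¹ : (F.KF K)ˣ) : F.KF K) * (bv i * bv j)) =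
        ℓ (((β⁻¹ : (F.KF K)ˣ) : F.KF K) * (bw i * bw j))) →
      ∀ x y, ℓ (((α⁻¹ : (F.KF K)ˣ) : F.KF K) * (x * y)) =
        ℓ (((β⁻¹ : (F.KF K)ˣ) : F.KF K) * (φ x * φ y)) := by
    intro ℓ h x y
    let B₁ := (LinearMap.mul K (F.KF K)).compr₂
      (ℓ ∘ₗ LinearMap.mulLeft K ((α⁻¹ : (F.KF K)ˣ) : F.KF K))
    let B₂ := ((LinearMap.mul K (F.KF K)).compl₁₂ φ.toLinearMap φ.toLinearMap).compr₂
      (ℓ ∘ₗ LinearMap.mulLeft K ((β⁻¹ : (F.KF K)ˣ) : F.KF K))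
    have hB : B₁ = B₂ := by
      refine bv.ext fun i => bv.ext fun j => ?_
      change ℓ (((α⁻¹ : (F.KF K)ˣ) : F.KF K) * (bv i * bv j)) =
        ℓ (((β⁻¹ : (F.KF K)ˣ) : F.KF K) * (φ (bv i) * φ (bv j)))
      rw [hφ, hφ, h]
    exact congrArg (fun B => B x y) hB
  have e1 := ext _ h1
  have e2 := ext _ h2
  have hc : algebraMap R K (F.c 0) ≠ 0 := by
    rw [Ne, IsFractionRing.to_map_eq_zero_iff]
    exact F.c_zero_ne_zero
  -- `π_{n-2}` is `π_{n-1} ∘ θ` up to a constant, so `θ` is determined by the two forms together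
  have hcomm : ∀ x, φ (F.theta K * x) = F.theta K * φ x := by
    intro x
    have h0 : ((β⁻¹ : (F.KF K)ˣ) : F.KF K) * (φ (F.theta K * x) - F.theta K * φ x) = 0 := by
      refine F.eq_zero_of_extLast_mul_eq_zero K (by omega) fun y => ?_
      obtain ⟨y, rfl⟩ := φ.surjective y
      have h3 := e1 (F.theta K * x) y
      have h4 := e2 x y
      rw [F.extPrev_eq K hn, F.extPrev_eq K hn, neg_inj, mul_right_inj' hc] at h4
      rw [show ((β⁻¹ : (F.KF K)ˣ) : F.KF K) * (φ (F.theta K * x) - F.theta K * φ x) * φ y =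
        ((β⁻¹ : (F.KF K)ˣ) : F.KF K) * (φ (F.theta K * x) * φ y) -
          F.theta K * (((β⁻¹ : (F.KF K)ˣ) : F.KF K) * (φ x * φ y)) by ring, map_sub, ← h3, ← h4,
        ← map_sub]
      rw [show ((α⁻¹ : (F.KF K)ˣ) : F.KF K) * (F.theta K * x * y) -
        F.theta K * (((α⁻¹ : (F.KF K)ˣ) : F.KF K) * (x * y)) = 0 by ring, map_zero]
    exact sub_eq_zero.1 ((Units.mul_right_eq_zero _).1 h0)
  have hmul : ∀ x, φ x = φ 1 * x :=
    F.linearMap_eq_mul_of_comm_theta K φ.toLinearMap hcomm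
  obtain ⟨x, hx⟩ := φ.surjective 1
  obtain ⟨κ, hκ⟩ := IsUnit.of_mul_eq_one x ((hmul x).symm.trans hx)
  have hκmul : ∀ x, φ x = κ * x := fun x => by rw [hκ, ← hmul]
  refine ⟨κ, fun i => by rw [← hφ, hκmul], ?_⟩
  have h5 : ((α⁻¹ : (F.KF K)ˣ) : F.KF K) - ((β⁻¹ : (F.KF K)ˣ) : F.KF K) * κ ^ 2 = 0 := by
    refine F.eq_zero_of_extLast_mul_eq_zero K (by omega) fun y => ?_
    have := e1 1 y
    rw [hκmul, hκmul] at this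
    rw [sub_mul, map_sub, show ((α⁻¹ : (F.KF K)ˣ) : F.KF K) * y =
      ((α⁻¹ : (F.KF K)ˣ) : F.KF K) * (1 * y) by ring, this, ← map_sub]
    rw [show ((β⁻¹ : (F.KF K)ˣ) : F.KF K) * (κ * 1 * (κ * y)) -
      ((β⁻¹ : (F.KF K)ˣ) : F.KF K) * κ ^ 2 * y = 0 by ring, map_zero]
  have h6 : α⁻¹ = β⁻¹ * κ ^ 2 := Units.ext (by push_cast; exact sub_eq_zero.1 h5)
  have h7 : α = β * (κ ^ 2)⁻¹ := by rw [← inv_inv α, h6, mul_inv, inv_inv]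
  rw [h7, mul_comm, inv_mul_cancel_right]

end Functionals

/-! ### Orbits and stabilizers -/

section Orbits

variable {R : Type*} [CommRing R] {n : ℕ} {F : BinForm R n}
variable {K : Type*} [Field K] [Algebra R K] [IsFractionRing R K]

namespace IdealPair

variable {r : Rˣ}

theorem norm_ne_zero (hn : 3 ≤ n) (P : F.IdealPair K r) : F.familyNorm K P.vec ≠ 0 := by
  have h := P.norm_sq
  intro h0
  rw [BasedIdeal.norm, h0, zero_pow two_ne_zero] at h
  have h1 : IsUnit (algebraMap R K r) := r.isUnit.map _
  have h2 : IsUnit (Algebra.norm K (P.α : F.KF K)) := P.α.isUnit.map _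
  exact (mul_ne_zero (mul_ne_zero h1.ne_zero h2.ne_zero) (F.normIF_ne_zero K (by omega))) h.symm

/-- The basis of `P` transformed by the matrix `g`. -/
noncomputable def transform (g : Matrix (Fin n) (Fin n) R) (P : F.IdealPair K r) (i : Fin n) :
    F.KF K :=
  ∑ j, g i j • P.vec j

theorem familyNorm_transform (g : Matrix (Fin n) (Fin n) R) (P : F.IdealPair K r) :
    F.familyNorm K (P.transform g) = algebraMap R K g.det * F.familyNorm K P.vec :=
  F.familyNorm_sum_smul K g P.vec

theorem apply_transform_mul_transform (ℓ : F.KF K →ₗ[K] K) (a : F.KF K)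
    (g : Matrix (Fin n) (Fin n) R) (P : F.IdealPair K r) (i j : Fin n) :
    ℓ (a * (P.transform g i * P.transform g j)) =
      ∑ l, ∑ k, algebraMap R K (g i k * g j l) * ℓ (a * (P.vec k * P.vec l)) := by
  rw [transform, transform, Finset.sum_mul_sum, Finset.sum_comm]
  simp only [Finset.mul_sum, map_sum]
  refine Finset.sum_congr rfl fun l _ => Finset.sum_congr rfl fun k _ => ?_
  rw [smul_mul_smul_comm, mul_smul_comm, ← algebraMap_smul K, map_smul, smul_eq_mul]

theorem algebraMap_matrices_A (P : F.IdealPair K r) (i j : Fin n) :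
    algebraMap R K (P.matrices.A i j) =
      F.extLast K (((P.α⁻¹ : (F.KF K)ˣ) : F.KF K) * (P.vec i * P.vec j)) :=
  F.algebraMap_piLast K (P.pairing i j)

theorem algebraMap_matrices_B (P : F.IdealPair K r) (i j : Fin n) :
    algebraMap R K (P.matrices.B i j) =
      F.extPrev K (((P.α⁻¹ : (F.KF K)ˣ) : F.KF K) * (P.vec i * P.vec j)) :=
  F.algebraMap_piPrev K (P.pairing i j)

theorem smul_matrices_eq_iff (g : Gn R n) (P Q : F.IdealPair K r) :
    g • Q.matrices = P.matrices ↔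
      (∀ i j, F.extLast K (((Q.α⁻¹ : (F.KF K)ˣ) : F.KF K) *
          (Q.transform g.1.1 i * Q.transform g.1.1 j)) =
        F.extLast K (((P.α⁻¹ : (F.KF K)ˣ) : F.KF K) * (P.vec i * P.vec j))) ∧
      (∀ i j, F.extPrev K (((Q.α⁻¹ : (F.KF K)ˣ) : F.KF K) *
          (Q.transform g.1.1 i * Q.transform g.1.1 j)) =
        F.extPrev K (((P.α⁻¹ : (F.KF K)ˣ) : F.KF K) * (P.vec i * P.vec j))) := by
  have hA : ∀ i j, algebraMap R K ((g • Q.matrices).A i j) =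
      F.extLast K (((Q.α⁻¹ : (F.KF K)ˣ) : F.KF K) *
        (Q.transform g.1.1 i * Q.transform g.1.1 j)) := by
    intro i j
    rw [SymPair.smul_A, conj_apply, apply_transform_mul_transform]
    simp only [map_sum, map_mul, algebraMap_matrices_A]
  have hB : ∀ i j, algebraMap R K ((g • Q.matrices).B i j) =
      F.extPrev K (((Q.α⁻¹ : (F.KF K)ˣ) : F.KF K) *
        (Q.transform g.1.1 i * Q.transform g.1.1 j)) := by
    intro i j
    rw [SymPair.smul_B, conj_apply, apply_transform_mul_transform]
    simp only [map_sum, map_mul, algebraMap_matrices_B]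
  constructor
  · intro h
    exact ⟨fun i j => by rw [← hA, h, algebraMap_matrices_A],
      fun i j => by rw [← hB, h, algebraMap_matrices_B]⟩
  · rintro ⟨h1, h2⟩
    apply SymPair.ext'
    · ext i j
      exact IsFractionRing.injective R K (by rw [hA, h1, algebraMap_matrices_A])
    · ext i j
      exact IsFractionRing.injective R K (by rw [hB, h2, algebraMap_matrices_B])

theorem familyNorm_transform_ne_zero (hn : 3 ≤ n) (g : Gn R n) (P : F.IdealPair K r) :
    F.familyNorm K (P.transform g.1.1) ≠ 0 := by
  rw [familyNorm_transform]
  have h1 : IsUnit (algebraMap R K g.1.1.det) :=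
    ((Matrix.isUnit_iff_isUnit_det _).1 g.1.isUnit).map _
  exact mul_ne_zero h1.ne_zero (P.norm_ne_zero hn)

theorem mem_iff_mem_span (P : F.IdealPair K r) (x : F.KF K) :
    x ∈ P.I ↔ x ∈ Submodule.span R (Set.range P.vec) := by
  constructor
  · intro hx
    have h1 := congrArg (Subtype.val : P.I → F.KF K) (P.basis.sum_repr ⟨x, hx⟩)
    rw [AddSubmonoidClass.coe_finsetSum] at h1
    rw [← show _ = x from h1]
    exact Submodule.sum_mem _ fun i _ => Submodule.smul_mem _ _ (Submodule.subset_span ⟨i, rfl⟩)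
  · intro hx
    have : Submodule.span R (Set.range P.vec) ≤ P.I.restrictScalars R := by
      rw [Submodule.span_le]
      rintro _ ⟨i, rfl⟩
      exact (P.basis i).2
    exact this hx

theorem ideal_eq_smul_of_vec_eq {P Q : F.IdealPair K r} (κ : (F.KF K)ˣ) (g : Gn R n)
    (h : ∀ i, P.vec i = ∑ j, g.1.1 i j • ((κ : F.KF K) * Q.vec j)) : P.I = κ • Q.I := by
  have h' := sum_inv g h
  ext x
  constructor
  · intro hx
    have h1 : Submodule.span R (Set.range P.vec) ≤
        (Q.I.restrictScalars R).map (LinearMap.mulLeft R (κ : F.KF K)) := by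
      rw [Submodule.span_le]
      rintro _ ⟨i, rfl⟩
      rw [h]
      exact Submodule.sum_mem _ fun j _ => Submodule.smul_mem _ _ ⟨_, (Q.basis j).2, rfl⟩
    obtain ⟨y, hy, hyx⟩ := h1 ((P.mem_iff_mem_span x).1 hx)
    exact ⟨y, hy, hyx⟩
  · rintro ⟨y, hy, rfl⟩
    have h1 : Submodule.span R (Set.range Q.vec) ≤
        (P.I.restrictScalars R).comap (LinearMap.mulLeft R (κ : F.KF K)) := by
      rw [Submodule.span_le]
      rintro _ ⟨i, rfl⟩
      change (κ : F.KF K) * Q.vec i ∈ P.I.restrictScalars R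
      rw [h']
      exact Submodule.sum_mem _ fun j _ => Submodule.smul_mem _ _ (P.basis j).2
    exact h1 ((Q.mem_iff_mem_span y).1 hy)

/-- The map `orb` is injective on all of `H_{F,r}`. -/
theorem equivalent_of_smul_matrices_eq (hn : 3 ≤ n) {P Q : F.IdealPair K r} {g : Gn R n}
    (h : g • Q.matrices = P.matrices) : P.Equivalent Q := by
  obtain ⟨h1, h2⟩ := (smul_matrices_eq_iff g P Q).1 h
  obtain ⟨κ, hκ, hα⟩ := F.exists_units_of_gram_eq K hn (Q.familyNorm_transform_ne_zero hn g)
    (P.norm_ne_zero hn) Q.α P.α h1 h2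
  have hv : ∀ i, P.vec i = ∑ j, g.1.1 i j • ((κ : F.KF K) * Q.vec j) := by
    intro i
    rw [hκ, transform, Finset.mul_sum]
    simp only [mul_smul_comm]
  exact ⟨κ, g, ideal_eq_smul_of_vec_eq κ g hv, hv, hα⟩

theorem orb_eq_iff (hn : 3 ≤ n) {P Q : F.IdealPair K r} :
    F.orb K r (Quotient.mk _ P) = F.orb K r (Quotient.mk _ Q) ↔ P.Equivalent Q := by
  constructor
  · intro h
    have h1 : MulAction.orbitRel (Gn R n) (SymPair R n) P.matrices Q.matrices := Quotient.exact h
    obtain ⟨g, hg⟩ := MulAction.orbitRel_apply.1 h1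
    exact equivalent_of_smul_matrices_eq hn hg
  · intro h
    exact congrArg _ (Quotient.sound h)

theorem mul_vec_cancel (hn : 3 ≤ n) (P : F.IdealPair K r) {x y : F.KF K}
    (h : ∀ i, x * P.vec i = y * P.vec i) : x = y := by
  obtain ⟨b, hb⟩ := F.isBasis_of_familyNorm_ne_zero K (P.norm_ne_zero hn)
  have : LinearMap.mulLeft K x = LinearMap.mulLeft K y :=
    b.ext fun i => by rw [hb]; exact h i
  have := LinearMap.congr_fun this 1
  simpa using this

theorem transform_mul (g h : Matrix (Fin n) (Fin n) R) (P : F.IdealPair K r) {x : F.KF K}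
    (hx : ∀ i, P.transform h i = x * P.vec i) (i : Fin n) :
    P.transform (g * h) i = x * P.transform g i := by
  simp only [transform, Matrix.mul_apply, Finset.sum_smul]
  rw [Finset.sum_comm]
  rw [Finset.mul_sum]
  refine Finset.sum_congr rfl fun j _ => ?_
  rw [mul_smul_comm, ← hx, transform, Finset.smul_sum]
  simp only [smul_smul]

theorem transform_injective (P : F.IdealPair K r) {g h : Matrix (Fin n) (Fin n) R}
    (hgh : ∀ i, P.transform g i = P.transform h i) : g = h := by
  ext i j
  have h1 : ∀ g : Matrix (Fin n) (Fin n) R,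
      P.transform g i = ((∑ j, g i j • P.basis j : P.I) : F.KF K) := by
    intro g
    rw [AddSubmonoidClass.coe_finsetSum]
    rfl
  have h2 : ∑ j, g i j • P.basis j = ∑ j, h i j • P.basis j :=
    Subtype.ext (by rw [← h1, ← h1, hgh])
  have h3 := congrArg (fun x => (P.basis.repr x : Fin n → R)) h2
  simp only [Module.Basis.repr_sum_self] at h3
  exact congrFun h3 j

/-- The subgroup of `ρ ∈ R_F ^ × [2]` of norm `1`, or of norm `±1` if `n` is even. -/
noncomputable def stabGroup (F : BinForm R n) (K : Type*) [Field K] [Algebra R K] :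
    Subgroup (F.RF K)ˣ where
  carrier := {ρ | ρ ^ 2 = 1 ∧ (F.unitNorm K ρ = 1 ∨ (Even n ∧ F.unitNorm K ρ = -1))}
  mul_mem' := by
    rintro a b ⟨ha, ha' | ⟨h, ha'⟩⟩ ⟨hb, hb' | ⟨h', hb'⟩⟩ <;>
      refine ⟨by rw [mul_pow, ha, hb, one_mul], ?_⟩ <;> simp_all
  one_mem' := by simp
  inv_mem' := by
    rintro a ⟨ha, ha' | ⟨h, ha'⟩⟩ <;> refine ⟨by rw [inv_pow, ha, inv_one], ?_⟩ <;> simp_all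

/-- A matrix in the stabilizer acts on `I` as multiplication by some `ρ ∈ R_F ^ ×` with
`ρ ^ 2 = 1`, whose norm is the determinant of the matrix. -/
theorem exists_units_of_mem_stabilizer (hn : 3 ≤ n) (P : F.IdealPair K r) {τ : (F.KF K)ˣ}
    (hI : P.I = τ • (1 : Submodule (F.RF K) (F.KF K))) {g : Gn R n}
    (hg : g • P.matrices = P.matrices) :
    ∃ ρ ∈ stabGroup F K, ∀ i, P.transform g.1.1 i = ((ρ : F.RF K) : F.KF K) * P.vec i := by
  obtain ⟨h1, h2⟩ := (smul_matrices_eq_iff g P P).1 hg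
  obtain ⟨κ, hκ, hα⟩ := F.exists_units_of_gram_eq K hn (P.norm_ne_zero hn)
    (P.familyNorm_transform_ne_zero hn g) P.α P.α (fun i j => (h1 i j).symm)
    fun i j => (h2 i j).symm
  have hκ2 : κ ^ 2 = 1 := by
    have : 1 * P.α = κ ^ 2 * P.α := by rw [one_mul, ← hα]
    exact (mul_right_cancel this).symm
  have hmem : ∀ x ∈ P.I, (κ : F.KF K) * x ∈ P.I := by
    have : Submodule.span R (Set.range P.vec) ≤
        (P.I.restrictScalars R).comap (LinearMap.mulLeft R (κ : F.KF K)) := by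
      rw [Submodule.span_le]
      rintro _ ⟨i, rfl⟩
      change (κ : F.KF K) * P.vec i ∈ P.I.restrictScalars R
      rw [← hκ, transform]
      exact Submodule.sum_mem _ fun j _ => Submodule.smul_mem _ _ (P.basis j).2
    exact fun x hx => this ((P.mem_iff_mem_span x).1 hx)
  have hκR : (κ : F.KF K) ∈ F.RF K := by
    have hτ : (τ : F.KF K) ∈ P.I := by
      rw [hI]
      exact ⟨1, Submodule.one_le.1 le_rfl, mul_one _⟩
    have h3 := hmem _ hτ
    rw [hI] at h3
    obtain ⟨y, hy, hyκ⟩ := h3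
    have h4 : (τ : F.KF K) * y = κ * τ := hyκ
    have h5 : y = κ := by
      rw [mul_comm (κ : F.KF K)] at h4
      exact (Units.mul_right_inj τ).1 h4
    exact h5 ▸ (F.mem_one_iff K).1 hy
  have hκκ : (⟨κ, hκR⟩ : F.RF K) * ⟨κ, hκR⟩ = 1 := by
    apply Subtype.ext
    have := congrArg (Units.val) hκ2
    rw [Units.val_pow_eq_pow_val, pow_two] at this
    exact this
  let ρ : (F.RF K)ˣ := ⟨⟨κ, hκR⟩, ⟨κ, hκR⟩, hκκ, hκκ⟩
  have hnorm : F.unitNorm K ρ = Matrix.GeneralLinearGroup.det g.1 := by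
    apply Units.ext
    apply IsFractionRing.injective R K
    have h3 : algebraMap R K (F.unitNorm K ρ : R) = Algebra.norm K (κ : F.KF K) :=
      F.norm_RF K ⟨κ, hκR⟩
    have h4 : F.familyNorm K (P.transform g.1.1) = Algebra.norm K (κ : F.KF K) *
        F.familyNorm K P.vec := by
      rw [← familyNorm_mul]
      exact congrArg _ (funext hκ)
    rw [familyNorm_transform] at h4
    rw [h3, ← mul_right_cancel₀ (P.norm_ne_zero hn) h4]
    rfl
  refine ⟨ρ, ⟨Units.ext (by rw [Units.val_pow_eq_pow_val, pow_two]; exact hκκ), ?_⟩, hκ⟩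
  rw [hnorm]
  exact g.2

/-- Conversely, multiplication by `ρ` with `ρ ^ 2 = 1` preserves `I` and its forms. -/
theorem exists_mem_stabilizer_of_mem_stabGroup (hn : 3 ≤ n) (P : F.IdealPair K r)
    {ρ : (F.RF K)ˣ} (hρ : ρ ∈ stabGroup F K) :
    ∃ g : Gn R n, g • P.matrices = P.matrices ∧
      ∀ i, P.transform g.1.1 i = ((ρ : F.RF K) : F.KF K) * P.vec i := by
  let ρv : Fin n → P.I := fun i =>
    ⟨((ρ : F.RF K) : F.KF K) * P.vec i, P.I.smul_mem (ρ : F.RF K) (P.basis i).2⟩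
  let M : Matrix (Fin n) (Fin n) R := fun i j => P.basis.repr (ρv i) j
  have hM : ∀ i, P.transform M i = ((ρ : F.RF K) : F.KF K) * P.vec i := by
    intro i
    have h1 := congrArg (Subtype.val : P.I → F.KF K) (P.basis.sum_repr (ρv i))
    rw [AddSubmonoidClass.coe_finsetSum] at h1
    exact h1
  have hdet : M.det = F.unitNorm K ρ := by
    apply IsFractionRing.injective R K
    have h3 : algebraMap R K (F.unitNorm K ρ : R) = Algebra.norm K ((ρ : F.RF K) : F.KF K) :=
      F.norm_RF K ρ
    have h4 : F.familyNorm K (P.transform M) = Algebra.norm K ((ρ : F.RF K) : F.KF K) *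
        F.familyNorm K P.vec := by
      rw [← familyNorm_mul]
      exact congrArg _ (funext hM)
    rw [familyNorm_transform] at h4
    rw [h3, mul_right_cancel₀ (P.norm_ne_zero hn) h4]
  have hMu : IsUnit M.det := hdet ▸ (F.unitNorm K ρ).isUnit
  let g₀ : Matrix.GeneralLinearGroup (Fin n) R := Matrix.GeneralLinearGroup.mk'' M hMu
  have hg₀ : Matrix.GeneralLinearGroup.det g₀ = F.unitNorm K ρ := Units.ext hdet
  let g : Gn R n := ⟨g₀, by
    change _ ∨ _
    rw [hg₀]
    exact hρ.2⟩
  have hgM : g.1.1 = M := rfl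
  have hρ2 : ((ρ : F.RF K) : F.KF K) * ((ρ : F.RF K) : F.KF K) = 1 := by
    have := congrArg (fun u : (F.RF K)ˣ => ((u : F.RF K) : F.KF K)) hρ.1
    simpa [pow_two] using this
  have hprod : ∀ i j, P.transform M i * P.transform M j = P.vec i * P.vec j := by
    intro i j
    rw [hM, hM, mul_mul_mul_comm, hρ2, one_mul]
  refine ⟨g, (smul_matrices_eq_iff g P P).2 ?_, hM⟩
  simp only [hgM, hprod, implies_true, and_self]

/-- The stabilizer of the pair of matrices of `(I, α)`, for `I` invertible. -/
theorem nonempty_stabilizer_mulEquiv (hn : 3 ≤ n) (P : F.IdealPair K r) {τ : (F.KF K)ˣ}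
    (hI : P.I = τ • (1 : Submodule (F.RF K) (F.KF K))) :
    Nonempty (MulAction.stabilizer (Gn R n) P.matrices ≃* stabGroup F K) := by
  choose f hf hfg using fun g : MulAction.stabilizer (Gn R n) P.matrices =>
    P.exists_units_of_mem_stabilizer hn hI (MulAction.mem_stabilizer_iff.1 g.2)
  have hinj : ∀ {u u' : (F.RF K)ˣ}, (∀ i, ((u : F.RF K) : F.KF K) * P.vec i =
      ((u' : F.RF K) : F.KF K) * P.vec i) → u = u' := fun h =>
    Units.ext (Subtype.ext (P.mul_vec_cancel hn h))
  let φ : MulAction.stabilizer (Gn R n) P.matrices →* stabGroup F K :=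
    MonoidHom.mk' (fun g => ⟨f g, hf g⟩) (by
      intro g h
      apply Subtype.ext
      apply hinj
      intro i
      rw [← hfg (g * h)]
      change P.transform (g.1.1.1 * h.1.1.1) i = _
      rw [P.transform_mul _ _ (hfg h), hfg g]
      change _ = ((f g : F.RF K) : F.KF K) * ((f h : F.RF K) : F.KF K) * P.vec i
      ring)
  refine ⟨MulEquiv.ofBijective φ ⟨fun g h hgh => ?_, fun ρ => ?_⟩⟩
  · have h1 : f g = f h := congrArg Subtype.val hgh
    apply Subtype.ext
    apply Subtype.ext
    apply Units.ext
    exact P.transform_injective fun i => by rw [hfg g, hfg h, h1]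
  · obtain ⟨g, hg, hgρ⟩ := P.exists_mem_stabilizer_of_mem_stabGroup hn ρ.2
    refine ⟨⟨g, hg⟩, Subtype.ext (hinj fun i => ?_)⟩
    rw [← hgρ]
    exact (hfg ⟨g, hg⟩ i).symm

end IdealPair

theorem stabGroup_of_even (hn : Even n) : IdealPair.stabGroup F K = F.units2 K := by
  have : IsDomain R := (IsFractionRing.injective R K).isDomain _
  ext ρ
  change (ρ ^ 2 = 1 ∧ (F.unitNorm K ρ = 1 ∨ (Even n ∧ F.unitNorm K ρ = -1))) ↔ ρ ^ 2 = 1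
  refine ⟨fun h => h.1, fun h => ⟨h, ?_⟩⟩
  have h1 : F.unitNorm K ρ ^ 2 = 1 := by rw [← map_pow, h, map_one]
  have h2 : (F.unitNorm K ρ : R) ^ 2 = 1 := by
    rw [← Units.val_pow_eq_pow_val, h1, Units.val_one]
  rcases sq_eq_one_iff.1 h2 with h3 | h3
  · exact Or.inl (Units.ext h3)
  · exact Or.inr ⟨hn, Units.ext h3⟩

end Orbits

section StabGroup

variable {R : Type*} [CommRing R] {n : ℕ} {F : BinForm R n} {K : Type*} [Field K] [Algebra R K]

theorem stabGroup_of_odd (hn : Odd n) : IdealPair.stabGroup F K = F.units2NormOne K := by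
  ext ρ
  have h : ¬ Even n := Nat.not_even_iff_odd.2 hn
  change (ρ ^ 2 = 1 ∧ (F.unitNorm K ρ = 1 ∨ (Even n ∧ F.unitNorm K ρ = -1))) ↔
    ρ ^ 2 = 1 ∧ F.unitNorm K ρ = 1
  simp [h]

end StabGroup

/-! ### Classification of the orbits of invertible ideals -/

section Classification

variable {R : Type*} [CommRing R] {n : ℕ} {F : BinForm R n}
variable {K : Type*} [Field K] [Algebra R K]

theorem units_smul_one (u : (F.RF K)ˣ) :
    (Units.map (algebraMap (F.RF K) (F.KF K)).toMonoidHom u) • (1 : Submodule (F.RF K) (F.KF K)) =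
      1 := by
  ext x
  constructor
  · rintro ⟨y, hy, rfl⟩
    exact (1 : Submodule (F.RF K) (F.KF K)).smul_mem (u : F.RF K) hy
  · intro hx
    refine ⟨((u⁻¹ : (F.RF K)ˣ) : F.RF K) • x, Submodule.smul_mem _ _ hx, ?_⟩
    change ((u : F.RF K) : F.KF K) * ((((u⁻¹ : (F.RF K)ˣ) : F.RF K) : F.KF K) * x) = x
    rw [← mul_assoc, ← MulMemClass.coe_mul, Units.mul_inv, OneMemClass.coe_one, one_mul]

theorem exists_units_of_smul_one_eq_one {κ : (F.KF K)ˣ}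
    (h : κ • (1 : Submodule (F.RF K) (F.KF K)) = 1) :
    ∃ u : (F.RF K)ˣ, Units.map (algebraMap (F.RF K) (F.KF K)).toMonoidHom u = κ := by
  have h1 : ∀ κ : (F.KF K)ˣ, κ • (1 : Submodule (F.RF K) (F.KF K)) = 1 →
      (κ : F.KF K) ∈ F.RF K := by
    intro κ h
    have : (κ : F.KF K) ∈ κ • (1 : Submodule (F.RF K) (F.KF K)) :=
      ⟨1, Submodule.one_le.1 le_rfl, mul_one _⟩
    rw [h] at this
    exact (F.mem_one_iff K).1 this
  have h2 : κ⁻¹ • (1 : Submodule (F.RF K) (F.KF K)) = 1 := by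
    conv_lhs => rw [← h]
    rw [inv_smul_smul]
  exact ⟨⟨⟨κ, h1 κ h⟩, ⟨_, h1 κ⁻¹ h2⟩, Subtype.ext κ.mul_inv, Subtype.ext κ.inv_mul⟩,
    Units.ext rfl⟩

theorem mk_mem_unitsModSqOfNorm_iff {r : Rˣ} {u : (F.RF K)ˣ} :
    (QuotientGroup.mk u : F.UnitsModSq K) ∈ F.unitsModSqOfNorm K r ↔
      ∃ s : Rˣ, F.unitNorm K u = r * s ^ 2 := by
  have h : F.normModSq K (QuotientGroup.mk u) = QuotientGroup.mk (F.unitNorm K u) := rfl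
  change F.normModSq K (QuotientGroup.mk u) = QuotientGroup.mk r ↔ _
  rw [h, eq_comm, QuotientGroup.eq]
  refine exists_congr fun s => ?_
  change s ^ 2 = r⁻¹ * F.unitNorm K u ↔ _
  rw [eq_inv_mul_iff_mul_eq, eq_comm]

variable [IsFractionRing R K]

namespace IdealPair

variable {r : Rˣ}

theorem vec_eq_of_ideal_eq_smul {P Q : F.IdealPair K r} {κ : (F.KF K)ˣ} (hI : P.I = κ • Q.I) :
    ∃ M : Matrix (Fin n) (Fin n) R, ∀ i, P.vec i = ∑ j, M i j • ((κ : F.KF K) * Q.vec j) := by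
  have h : ∀ i, ∃ y : Q.I, (κ : F.KF K) * y = P.vec i := by
    intro i
    have h1 : P.vec i ∈ κ • Q.I := hI ▸ (P.basis i).2
    obtain ⟨y, hy, hyP⟩ := h1
    exact ⟨⟨y, hy⟩, hyP⟩
  choose y hy using h
  refine ⟨fun i j => Q.basis.repr (y i) j, fun i => ?_⟩
  have h1 := congrArg (Subtype.val : Q.I → F.KF K) (Q.basis.sum_repr (y i))
  rw [AddSubmonoidClass.coe_finsetSum] at h1
  rw [← hy, ← h1, Finset.mul_sum]
  refine Finset.sum_congr rfl fun j _ => ?_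
  exact mul_smul_comm _ _ _

/-- In the definition of equivalence the condition on the bases is automatic: by the norm
condition the change of basis has determinant `±1`, and for odd `n` the sign can be absorbed
in `κ`. -/
theorem equivalent_of_ideal_eq_smul (hn : 3 ≤ n) {P Q : F.IdealPair K r} {κ : (F.KF K)ˣ}
    (hI : P.I = κ • Q.I) (hα : P.α = κ ^ 2 * Q.α) : P.Equivalent Q := by
  have : IsDomain R := (IsFractionRing.injective R K).isDomain _
  obtain ⟨M, hM⟩ := vec_eq_of_ideal_eq_smul hI
  have hnorm : P.norm = algebraMap R K M.det * (Algebra.norm K (κ : F.KF K) * Q.norm) := by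
    rw [BasedIdeal.norm, BasedIdeal.norm, ← familyNorm_mul, ← familyNorm_sum_smul]
    exact congrArg _ (funext hM)
  have hκ0 : Algebra.norm K (κ : F.KF K) ≠ 0 := (κ.isUnit.map _).ne_zero
  have hQ0 : Q.norm ≠ 0 := Q.norm_ne_zero hn
  have hdet : M.det ^ 2 = 1 := by
    apply IsFractionRing.injective R K
    have h1 := P.norm_sq
    rw [hα, Units.val_mul, Units.val_pow_eq_pow_val, map_mul, map_pow, hnorm] at h1
    have h2 := Q.norm_sq
    have h3 : (Algebra.norm K (κ : F.KF K) * Q.norm) ^ 2 ≠ 0 := pow_ne_zero _ (mul_ne_zero hκ0 hQ0)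
    refine mul_right_cancel₀ h3 ?_
    rw [map_pow, map_one, one_mul]
    calc _ = (algebraMap R K M.det * (Algebra.norm K (κ : F.KF K) * Q.norm)) ^ 2 := by ring
      _ = Algebra.norm K (κ : F.KF K) ^ 2 * (algebraMap R K r * Algebra.norm K (Q.α : F.KF K) *
          F.normIF K (n - 2)) := by rw [h1]; ring
      _ = _ := by rw [← h2]; ring
  have key : ∀ (κ' : (F.KF K)ˣ) (N : Matrix (Fin n) (Fin n) R),
      (N.det = 1 ∨ (Even n ∧ N.det = -1)) →
      (∀ i, P.vec i = ∑ j, N i j • ((κ' : F.KF K) * Q.vec j)) → P.α = κ' ^ 2 * Q.α →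
      P.Equivalent Q := by
    intro κ' N hN hv hα'
    have hu : IsUnit N.det := by
      rcases hN with h | ⟨-, h⟩ <;> rw [h]
      · exact isUnit_one
      · exact isUnit_one.neg
    let g : Gn R n := ⟨Matrix.GeneralLinearGroup.mk'' N hu, by
      rcases hN with h | ⟨he, h⟩
      · exact Or.inl (Units.ext h)
      · exact Or.inr ⟨he, Units.ext h⟩⟩
    exact ⟨κ', g, ideal_eq_smul_of_vec_eq κ' g hv, hv, hα'⟩
  rcases sq_eq_one_iff.1 hdet with h | h
  · exact key κ M (Or.inl h) hM hα
  · rcases Nat.even_or_odd n with he | ho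
    · exact key κ M (Or.inr ⟨he, h⟩) hM hα
    · refine key (-κ) (-M) (Or.inl ?_) (fun i => ?_) (by rw [neg_sq, hα])
      · rw [Matrix.det_neg, h, Fintype.card_fin, ho.neg_one_pow, neg_one_mul, neg_neg]
      · rw [hM]
        refine Finset.sum_congr rfl fun j _ => ?_
        rw [Matrix.neg_apply, Units.val_neg, neg_mul, smul_neg, neg_smul, neg_neg]

end IdealPair

theorem algebraMap_unitNorm (u : (F.RF K)ˣ) : algebraMap R K (F.unitNorm K u) =
    Algebra.norm K ((u : F.RF K) : F.KF K) := F.norm_RF K u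

/-- A generator `δ` of `I_F ^ (n-2)` which has the norm of that ideal up to the square of a
unit. -/
structure SquareNormGenerator (F : BinForm R n) (K : Type*) [Field K] [Algebra R K]
    [IsFractionRing R K] where
  δ : (F.KF K)ˣ
  w : Rˣ
  IF_eq : F.IF K (n - 2) = δ • (1 : Submodule (F.RF K) (F.KF K))
  normIF_eq : F.normIF K (n - 2) = Algebra.norm K (δ : F.KF K) * algebraMap R K w ^ 2

namespace SquareNormGenerator

variable {r : Rˣ}

/-- The second component `δ⁻¹ ρ⁻¹` of the pair `(R_F, δ⁻¹ ρ⁻¹)` attached to a unit `ρ`. -/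
noncomputable def alpha (D : SquareNormGenerator F K) (ρ : (F.RF K)ˣ) : (F.KF K)ˣ :=
  D.δ⁻¹ * (Units.map (algebraMap (F.RF K) (F.KF K)).toMonoidHom ρ)⁻¹

/-- If `I = κ R_F`, then `ρ = κ ^ 2 / (α δ)` lies in `R_F` because `κ ^ 2 ∈ I ^ 2 ⊆ α δ R_F`, and by
the norm condition it is a unit of norm `r` modulo squares. -/
theorem exists_alpha_eq (D : SquareNormGenerator F K) (P : F.IdealPair K r) {κ : (F.KF K)ˣ}
    (hI : P.I = κ • (1 : Submodule (F.RF K) (F.KF K))) :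
    ∃ ρ : (F.RF K)ˣ, P.α = κ ^ 2 * D.alpha ρ ∧ ∃ s : Rˣ, F.unitNorm K ρ = r * s ^ 2 := by
  have hκ : (κ : F.KF K) ∈ P.I := by
    rw [hI]
    exact ⟨1, Submodule.one_le.1 le_rfl, mul_one _⟩
  have hκ2 : (κ : F.KF K) * κ ∈ P.α • F.IF K (n - 2) := by
    refine P.sq_le ?_
    rw [pow_two]
    exact Submodule.mul_mem_mul hκ hκ
  rw [D.IF_eq, smul_smul] at hκ2
  obtain ⟨x, hx, hxκ⟩ := hκ2
  replace hxκ : ((P.α * D.δ : (F.KF K)ˣ) : F.KF K) * x = κ * κ := hxκ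
  have hx' : x ∈ F.RF K := (F.mem_one_iff K).1 hx
  obtain ⟨u, hu⟩ := F.familyNorm_eq_of_eq_smul_one K P.basis hI
  have hκ0 : Algebra.norm K (κ : F.KF K) ≠ 0 := (κ.isUnit.map _).ne_zero
  have hN := congrArg (Algebra.norm K) hxκ
  rw [Units.val_mul, map_mul, map_mul, map_mul] at hN
  have hsq := P.norm_sq
  have hPu : P.norm = algebraMap R K u * Algebra.norm K (κ : F.KF K) := hu
  have hxn : algebraMap R K (Algebra.norm R (⟨x, hx'⟩ : F.RF K)) = Algebra.norm K x :=
    F.norm_RF K ⟨x, hx'⟩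
  have h1 : Algebra.norm R (⟨x, hx'⟩ : F.RF K) * (u : R) ^ 2 = r * (D.w : R) ^ 2 := by
    apply IsFractionRing.injective R K
    rw [map_mul, map_mul, map_pow, map_pow, hxn]
    have hα0 : Algebra.norm K (P.α : F.KF K) ≠ 0 := (P.α.isUnit.map _).ne_zero
    have hδ0 : Algebra.norm K (D.δ : F.KF K) ≠ 0 := (D.δ.isUnit.map _).ne_zero
    rw [hPu, D.normIF_eq] at hsq
    refine mul_right_cancel₀ (mul_ne_zero hα0 hδ0) ?_
    calc _ = (Algebra.norm K (P.α : F.KF K) * Algebra.norm K (D.δ : F.KF K) * Algebra.norm K x) *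
          algebraMap R K u ^ 2 := by ring
      _ = (algebraMap R K u * Algebra.norm K (κ : F.KF K)) ^ 2 := by rw [hN]; ring
      _ = _ := by rw [hsq]; ring
  have h2 : Algebra.norm R (⟨x, hx'⟩ : F.RF K) = (r * (D.w * u⁻¹) ^ 2 : Rˣ) := by
    rw [mul_pow, inv_pow, ← mul_assoc, Units.val_mul, Units.eq_mul_inv_iff_mul_eq]
    exact h1
  have : Module.Free R (F.RF K) := Module.Free.of_basis (F.basisRF K)
  have : Module.Finite R (F.RF K) := Module.Finite.of_basis (F.basisRF K)
  obtain ⟨ρ, hρ⟩ := isUnit_of_isUnit_norm (R := R) (x := (⟨x, hx'⟩ : F.RF K))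
    (h2 ▸ Units.isUnit _)
  refine ⟨ρ, ?_, D.w * u⁻¹, Units.ext ?_⟩
  · rw [alpha]
    have h3 : P.α * D.δ * Units.map (algebraMap (F.RF K) (F.KF K)).toMonoidHom ρ = κ ^ 2 := by
      apply Units.ext
      rw [Units.val_mul, pow_two, Units.val_mul κ, ← hxκ]
      congr 1
      exact congrArg Subtype.val hρ
    rw [← h3, mul_assoc, mul_assoc, mul_left_comm D.δ]
    simp
  · rw [← h2, ← hρ]
    rfl

theorem exists_idealPair (D : SquareNormGenerator F K) {ρ : (F.RF K)ˣ}
    (h : ∃ s : Rˣ, F.unitNorm K ρ = r * s ^ 2) :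
    ∃ P : F.IdealPair K r, P.I = 1 ∧ P.α = D.alpha ρ := by
  classical
  obtain ⟨s, hs⟩ := h
  -- one basis vector of `R_F` is rescaled by `d` to make the norm condition hold on the nose
  let d : Rˣ := D.w * s⁻¹
  let z : Fin n := ⟨0, F.deg_pos⟩
  let c : Fin n → Rˣ := fun i => if i = z then d else 1
  let b := (F.basisSMulOne K 1).unitsSMul c
  let J : F.BasedIdeal K := ⟨(1 : (F.KF K)ˣ) • (1 : Submodule (F.RF K) (F.KF K)), b⟩
  have hJnorm : J.norm = algebraMap R K d := by
    have h1 : J.vec = fun i => ∑ j, (Matrix.diagonal fun i => (c i : R)) i j • F.gen K 0 j := by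
      ext i
      have h2 : J.vec i = (c i : R) • F.gen K 0 i := by
        change ((b i : J.I) : F.KF K) = _
        rw [Module.Basis.unitsSMul_apply]
        change (c i : R) • (F.basisSMulOne K 1 i : F.KF K) = _
        rw [coe_basisSMulOne, Units.val_one, one_mul]
      rw [h2, Finset.sum_eq_single i]
      · rw [Matrix.diagonal_apply_eq]
      · intro j _ hj
        rw [Matrix.diagonal_apply_ne _ hj.symm, zero_smul]
      · simp
    have h3 : ∏ i, (c i : R) = d := by
      rw [Finset.prod_eq_single z]
      · simp [c]
      · intro j _ hj
        simp [c, hj]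
      · simp
    rw [BasedIdeal.norm, h1, familyNorm_sum_smul, Matrix.det_diagonal, h3, familyNorm_gen_zero,
      mul_one]
  have hJ : J.I = 1 := one_smul _ _
  refine ⟨{ J with α := D.alpha ρ, sq_le := ?_, norm_sq := ?_ }, hJ, rfl⟩
  · rw [hJ, one_pow, D.IF_eq, smul_smul, alpha]
    have : D.δ⁻¹ * (Units.map (algebraMap (F.RF K) (F.KF K)).toMonoidHom ρ)⁻¹ * D.δ =
        Units.map (algebraMap (F.RF K) (F.KF K)).toMonoidHom ρ⁻¹ := by
      rw [mul_right_comm, inv_mul_cancel, one_mul, map_inv]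
    rw [this, units_smul_one]
  · have hρ := algebraMap_unitNorm ρ
    rw [hs] at hρ
    have h1 : Algebra.norm K (D.alpha ρ : F.KF K) *
        (Algebra.norm K (D.δ : F.KF K) * algebraMap R K (r * s ^ 2 : Rˣ)) = 1 := by
      rw [hρ, ← map_mul, ← map_mul]
      have : (D.alpha ρ : F.KF K) * (D.δ * ((ρ : F.RF K) : F.KF K)) =
          ((D.alpha ρ * (D.δ * Units.map (algebraMap (F.RF K) (F.KF K)).toMonoidHom ρ) :
            (F.KF K)ˣ) : F.KF K) := rfl
      have h2 : D.alpha ρ * (D.δ * Units.map (algebraMap (F.RF K) (F.KF K)).toMonoidHom ρ) = 1 := by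
        rw [alpha, mul_mul_mul_comm]
        simp
      rw [this, h2, Units.val_one, map_one]
    have h3 : algebraMap R K d * algebraMap R K s = algebraMap R K D.w := by
      rw [← map_mul, ← Units.val_mul]
      simp [d]
    have hs0 : algebraMap R K s ^ 2 ≠ 0 := pow_ne_zero _ (s.isUnit.map _).ne_zero
    rw [hJnorm, D.normIF_eq]
    refine mul_right_cancel₀ hs0 ?_
    rw [← mul_pow, h3]
    rw [Units.val_mul, Units.val_pow_eq_pow_val, map_mul, map_pow] at h1
    linear_combination (-(algebraMap R K D.w ^ 2)) * h1

/-- The classes of units `ρ` of norm `r` modulo squares classify the orbits which come from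
invertible ideals: `ρ` corresponds to the pair `(R_F, δ⁻¹ ρ⁻¹)`. -/
theorem nonempty_orb_image_equiv (D : SquareNormGenerator F K) (hn : 3 ≤ n)
    (hprinc : ∀ I : Submodule (F.RF K) (F.KF K), IsUnit I → ∃ κ : (F.KF K)ˣ,
      I = κ • (1 : Submodule (F.RF K) (F.KF K))) :
    Nonempty (F.orb K r '' F.HStar K r ≃ F.unitsModSqOfNorm K r) := by
  have hrep : ∀ c : F.unitsModSqOfNorm K r, ∃ ρ : (F.RF K)ˣ,
      (QuotientGroup.mk ρ : F.UnitsModSq K) = c := fun c => QuotientGroup.mk_surjective _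
  choose rep hrep using hrep
  have hP : ∀ c : F.unitsModSqOfNorm K r, ∃ P : F.IdealPair K r, P.I = 1 ∧
      P.α = D.alpha (rep c) := by
    intro c
    refine D.exists_idealPair (mk_mem_unitsModSqOfNorm_iff.1 ?_)
    rw [hrep]
    exact c.2
  choose P hPI hPα using hP
  have hrange : ∀ c, F.orb K r (Quotient.mk _ (P c)) ∈ F.orb K r '' F.HStar K r := fun c =>
    ⟨_, ⟨P c, by rw [hPI]; exact isUnit_one, rfl⟩, rfl⟩
  refine ⟨(Equiv.ofBijective (fun c => (⟨_, hrange c⟩ : F.orb K r '' F.HStar K r))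
    ⟨fun c c' h => ?_, ?_⟩).symm⟩
  · have h1 : (P c).Equivalent (P c') :=
      (IdealPair.orb_eq_iff hn).1 (congrArg Subtype.val h)
    obtain ⟨κ, g, hI, -, hα⟩ := h1
    rw [hPI, hPI] at hI
    obtain ⟨u, rfl⟩ := exists_units_of_smul_one_eq_one hI.symm
    have hinj : Function.Injective (Units.map (algebraMap (F.RF K) (F.KF K)).toMonoidHom) :=
      Units.map_injective Subtype.val_injective
    have h2 : rep c' = u ^ 2 * rep c := by
      rw [hPα, hPα, alpha, alpha, mul_left_comm, mul_right_inj] at hα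
      apply hinj
      rw [map_mul, map_pow]
      rw [eq_mul_inv_iff_mul_eq, inv_mul_eq_iff_eq_mul] at hα
      rw [hα, mul_comm]
    apply Subtype.ext
    rw [← hrep c, ← hrep c', QuotientGroup.eq]
    exact ⟨u, by rw [h2]; simp⟩
  · rintro ⟨_, _, ⟨Q, hQ, rfl⟩, rfl⟩
    obtain ⟨κ, hκ⟩ := hprinc Q.I hQ
    obtain ⟨ρ, hρα, hρ⟩ := D.exists_alpha_eq Q hκ
    let c : F.unitsModSqOfNorm K r := ⟨QuotientGroup.mk ρ, mk_mem_unitsModSqOfNorm_iff.2 hρ⟩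
    refine ⟨c, Subtype.ext ?_⟩
    refine (IdealPair.orb_eq_iff hn).2 (IdealPair.Equivalent.symm ?_)
    obtain ⟨σ, hσ⟩ := QuotientGroup.eq.1 (show (QuotientGroup.mk ρ : F.UnitsModSq K) =
      QuotientGroup.mk (rep c) from (hrep c).symm)
    have hσ' : rep c = ρ * σ ^ 2 := by
      rw [eq_comm, ← eq_inv_mul_iff_mul_eq]
      exact hσ
    refine IdealPair.equivalent_of_ideal_eq_smul hn
      (κ := κ * Units.map (algebraMap (F.RF K) (F.KF K)).toMonoidHom σ) ?_ ?_
    · rw [hPI, mul_smul, units_smul_one, hκ]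
    · rw [hPα, hρα, alpha, alpha, hσ', map_mul, map_pow, mul_inv, mul_pow, mul_assoc]
      congr 1
      rw [mul_left_comm, mul_left_comm (_ ^ 2), mul_inv_cancel, mul_one]

end SquareNormGenerator
end Classification

section Padic

variable {p : ℕ} [Fact p.Prime] {n : ℕ} (F : BinForm ℤ_[p] n)

theorem exists_smul_one_of_isUnit (I : Submodule (F.RF ℚ_[p]) (F.KF ℚ_[p])) (hI : IsUnit I) :
    ∃ κ : (F.KF ℚ_[p])ˣ, I = κ • (1 : Submodule (F.RF ℚ_[p]) (F.KF ℚ_[p])) :=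
  exists_units_smul_eq_of_isUnit (F.basisRF ℚ_[p]) hI

theorem exists_IF_eq_smul_one (hF : F.IsPrimitive) {k : ℕ} (hk : k < n) :
    ∃ (δ : (F.KF ℚ_[p])ˣ) (u : ℤ_[p]ˣ),
      F.IF ℚ_[p] k = δ • (1 : Submodule (F.RF ℚ_[p]) (F.KF ℚ_[p])) ∧
      F.normIF ℚ_[p] k = algebraMap ℤ_[p] ℚ_[p] u * Algebra.norm ℚ_[p] (δ : F.KF ℚ_[p]) := by
  obtain ⟨δ, hδ⟩ := F.exists_smul_one_of_isUnit (F.IF ℚ_[p] k) (by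
    rw [F.IF_eq_pow ℚ_[p] hk]
    exact (F.isUnit_thetaIdeal ℚ_[p] hF).pow k)
  obtain ⟨u, hu⟩ := F.familyNorm_eq_of_eq_smul_one ℚ_[p] (F.basisIF ℚ_[p] k) hδ
  refine ⟨δ, u, hδ, ?_⟩
  rw [← hu, normIF]
  simp only [coe_basisIF]

/-- For even `n` one takes the square of a generator of `I_F ^ ((n-2)/2)`; for odd `n` the unit
by which the norm of a generator differs from that of `I_F ^ (n-2)` is, modulo squares, the norm
of a constant. -/
theorem nonempty_squareNormGenerator (hn : 3 ≤ n) (hF : F.IsPrimitive) :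
    Nonempty (SquareNormGenerator F ℚ_[p]) := by
  rcases Nat.even_or_odd n with ⟨m, hm⟩ | ⟨m, hm⟩
  · obtain ⟨δ, u, h1, h2⟩ := F.exists_IF_eq_smul_one hF (k := m - 1) (by omega)
    have hk : n - 2 = (m - 1) + (m - 1) := by omega
    refine ⟨⟨δ ^ 2, u, ?_, ?_⟩⟩
    · have h3 : F.IF ℚ_[p] (n - 2) = F.IF ℚ_[p] (m - 1) * F.IF ℚ_[p] (m - 1) := by
        rw [F.IF_eq_pow ℚ_[p] (by omega), F.IF_eq_pow ℚ_[p] (by omega), hk, pow_add]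
      rw [h3, h1]
      conv_rhs => rw [← mul_one (1 : Submodule (F.RF ℚ_[p]) (F.KF ℚ_[p])), pow_two]
      rw [smul_mul_smul_comm]
    · have h3 := F.normIF_mul_pow ℚ_[p] (k := n - 2) (by omega)
      have h4 := F.normIF_mul_pow ℚ_[p] (k := m - 1) (by omega)
      have h5 : F.normIF ℚ_[p] (n - 2) = F.normIF ℚ_[p] (m - 1) ^ 2 := by
        have hc : algebraMap ℤ_[p] ℚ_[p] (F.c 0) ^ (n - 2) ≠ 0 := right_ne_zero_of_mul_eq_one h3
        refine mul_right_cancel₀ hc ?_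
        rw [h3, hk, pow_add, pow_two, mul_mul_mul_comm, h4, one_mul]
      rw [h5, h2, Units.val_pow_eq_pow_val, map_pow]
      ring
  · obtain ⟨δ, u, h1, h2⟩ := F.exists_IF_eq_smul_one hF (k := n - 2) (by omega)
    let c : (F.RF ℚ_[p])ˣ := Units.map (algebraMap ℤ_[p] (F.RF ℚ_[p])).toMonoidHom u
    refine ⟨⟨δ * Units.map (algebraMap (F.RF ℚ_[p]) (F.KF ℚ_[p])).toMonoidHom c, u⁻¹ ^ m, ?_, ?_⟩⟩
    · rw [mul_smul, units_smul_one, h1]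
    · have h3 : Algebra.norm ℚ_[p] ((c : F.RF ℚ_[p]) : F.KF ℚ_[p]) =
          algebraMap ℤ_[p] ℚ_[p] u ^ n := by
        rw [← F.norm_RF]
        change algebraMap ℤ_[p] ℚ_[p] (Algebra.norm ℤ_[p] (algebraMap ℤ_[p] (F.RF ℚ_[p]) u)) = _
        rw [Algebra.norm_algebraMap_of_basis (F.basisRF ℚ_[p]), map_pow, Fintype.card_fin]
      have h4 : algebraMap ℤ_[p] ℚ_[p] u ^ n * algebraMap ℤ_[p] ℚ_[p] ((u⁻¹ ^ m : ℤ_[p]ˣ)) ^ 2 =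
          algebraMap ℤ_[p] ℚ_[p] u := by
        rw [← map_pow, ← map_pow, ← map_mul, ← Units.val_pow_eq_pow_val, ← Units.val_pow_eq_pow_val,
          ← Units.val_mul, ← pow_mul, hm, pow_succ, mul_comm m 2, mul_right_comm, ← mul_pow]
        simp
      change _ = Algebra.norm ℚ_[p] ((δ : F.KF ℚ_[p]) * ((c : F.RF ℚ_[p]) : F.KF ℚ_[p])) * _
      rw [h2, map_mul, h3, mul_assoc, h4, mul_comm]

end Padic
end BinForm

/-! ### Norms as resultants -/

section Resultants

open Polynomial

/-- Over an algebraically closed field this is multiplicativity in `g`, the case `g = X - a` being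
the definition of the characteristic polynomial. -/
theorem Matrix.det_aeval_eq_resultant {K : Type*} [Field K] {ι : Type*} [Fintype ι] [DecidableEq ι]
    (M : Matrix ι ι K) (g : K[X]) : (aeval M g).det = M.charpoly.resultant g := by
  have split : ∀ {E : Type _} [Field E] (M : Matrix ι ι E) (g : E[X]), g.Splits →
      (aeval M g).det = M.charpoly.resultant g := by
    intro E _ M g hg
    let φ : E[X] →* E := Matrix.detMonoidHom.comp (aeval M : E[X] →ₐ[E] Matrix ι ι E).toMonoidHom
    have hφ : ∀ q, (aeval M q).det = φ q := fun _ => rfl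
    have hC : ∀ a, φ (C a) = a ^ Fintype.card ι := by
      intro a
      rw [← hφ, aeval_C, Matrix.algebraMap_eq_diagonal, Matrix.det_diagonal]
      simp
    have hX : ∀ a, φ (X - C a) = (-1) ^ Fintype.card ι * M.charpoly.eval a := by
      intro a
      rw [← hφ, Matrix.eval_charpoly, ← Matrix.det_neg, neg_sub, map_sub, aeval_X, aeval_C]
      rfl
    rw [resultant_comm, resultant_eq_prod_eval _ _ _ le_rfl hg, hφ]
    conv_lhs => rw [hg.eq_prod_roots]
    rw [map_mul, map_multiset_prod, Multiset.map_map, hC]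
    simp only [Function.comp_def, hX, Multiset.prod_map_mul, Multiset.map_const',
      Multiset.prod_replicate, Matrix.charpoly_natDegree_eq_dim, ← hg.natDegree_eq_card_roots]
    ring
  let φ := algebraMap K (AlgebraicClosure K)
  apply φ.injective
  have h1 := split (φ.mapMatrix M) (g.map φ) (IsAlgClosed.splits _)
  have h2 : aeval (φ.mapMatrix M) (g.map φ) = φ.mapMatrix (aeval M g) := by
    refine (map_aeval_eq_aeval_map (φ := φ) (ψ := (φ.mapMatrix : Matrix ι ι K →+* _)) ?_ g M).symm
    ext a i j
    simp only [RingHom.comp_apply, RingHom.mapMatrix_apply, Matrix.map_apply,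
      Matrix.algebraMap_eq_diagonal, Matrix.diagonal_apply, Pi.algebraMap_apply,
      Algebra.algebraMap_self_apply]
    split_ifs <;> simp [φ]
  rw [h2, ← RingHom.map_det] at h1
  rw [h1, RingHom.mapMatrix_apply, Matrix.charpoly_map, natDegree_map, natDegree_map,
    resultant_map_map]

/-- The norm of `g(θ)`, where `θ` is a root of `f` of degree `n`, in terms of a resultant. -/
theorem AdjoinRoot.norm_aeval_root {K : Type*} [Field K] {f : K[X]} (hf : f ≠ 0) (g : K[X]) {m : ℕ}
    (hg : g.natDegree ≤ m) :
    Algebra.norm K (aeval (AdjoinRoot.root f) g) * f.leadingCoeff ^ m =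
      f.resultant g f.natDegree m := by
  let pb := AdjoinRoot.powerBasis hf
  have h1 : Algebra.norm K (aeval (AdjoinRoot.root f) g) =
      (minpoly K pb.gen).resultant g := by
    rw [Algebra.norm_eq_matrix_det pb.basis, ← charpoly_leftMulMatrix,
      ← Matrix.det_aeval_eq_resultant]
    congr 1
    exact (aeval_algHom_apply (Algebra.leftMulMatrix pb.basis) pb.gen g).symm
  have hlc : f.leadingCoeff ≠ 0 := leadingCoeff_ne_zero.2 hf
  have hχ : minpoly K pb.gen = f * C f.leadingCoeff⁻¹ := AdjoinRoot.minpoly_powerBasis_gen hf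
  have hf' : f = C f.leadingCoeff * minpoly K pb.gen := by
    rw [hχ, mul_left_comm, ← C_mul, mul_inv_cancel₀ hlc, C_1, mul_one]
  have hdeg : f.natDegree = (minpoly K pb.gen).natDegree := by
    conv_lhs => rw [hf']
    rw [natDegree_C_mul hlc]
  have hmon : (minpoly K pb.gen).coeff (minpoly K pb.gen).natDegree = 1 :=
    minpoly.monic (pb.isIntegral_gen)
  have hr : f.resultant g f.natDegree m =
      f.leadingCoeff ^ m * (minpoly K pb.gen).resultant g f.natDegree m := by
    conv_lhs => rw [hf', resultant_C_mul_left, ← hf']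
  rw [h1, hr, mul_comm, hdeg]
  obtain ⟨k, rfl⟩ := Nat.exists_eq_add_of_le hg
  rw [resultant_add_right_deg _ _ _ _ _ le_rfl, hmon, one_pow, one_mul]

/-- Multiplicativity of the resultant for formal degrees. -/
theorem Polynomial.resultant_mul_left_of_le {R : Type*} [CommRing R] (f₁ f₂ g : R[X])
    {m₁ m₂ n : ℕ} (h₁ : f₁.natDegree ≤ m₁) (h₂ : f₂.natDegree ≤ m₂) (hg : g.natDegree ≤ n) :
    (f₁ * f₂).resultant g (m₁ + m₂) n = f₁.resultant g m₁ n * f₂.resultant g m₂ n := by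
  obtain ⟨k₁, rfl⟩ := Nat.exists_eq_add_of_le h₁
  obtain ⟨k₂, rfl⟩ := Nat.exists_eq_add_of_le h₂
  rw [add_add_add_comm, resultant_add_left_deg _ _ _ _ _ natDegree_mul_le,
    resultant_add_left_deg _ _ _ _ _ le_rfl, resultant_add_left_deg _ _ _ _ _ le_rfl,
    resultant_mul_left _ _ _ _ hg]
  ring

theorem Polynomial.resultant_pow_left_of_le {R : Type*} [CommRing R] (f g : R[X])
    {m n : ℕ} (hf : f.natDegree ≤ m) (hg : g.natDegree ≤ n) (e : ℕ) :
    (f ^ e).resultant g (e * m) n = f.resultant g m n ^ e := by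
  induction e with
  | zero => simp
  | succ e ih =>
    rw [pow_succ, Nat.succ_mul, resultant_mul_left_of_le _ _ _ _ hf hg, ih, pow_succ]
    exact natDegree_pow_le_of_le e hf

/-- A nonzero polynomial over a field has a monic irreducible factor of odd multiplicity, unless
it is a constant multiple of a square. -/
theorem Polynomial.exists_odd_factor_or_eq_C_mul_sq {K : Type*} [Field K] (f : K[X]) (hf : f ≠ 0) :
    (∃ (h g : K[X]) (e : ℕ), h.Monic ∧ Irreducible h ∧ Odd e ∧ ¬ h ∣ g ∧ f = h ^ e * g) ∨
    ∃ (κ : K) (s : K[X]), κ ≠ 0 ∧ f = C κ * s ^ 2 := by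
  induction hd : f.natDegree using Nat.strong_induction_on generalizing f with
  | _ d ih =>
    by_cases hu : IsUnit f
    · obtain ⟨κ, hκ, rfl⟩ := Polynomial.isUnit_iff.1 hu
      exact Or.inr ⟨κ, 1, hκ.ne_zero, by simp⟩
    · obtain ⟨h, hmon, hirr, hdvd⟩ := exists_monic_irreducible_factor f hu
      have hfin : FiniteMultiplicity h f :=
        finiteMultiplicity_of_degree_pos_of_monic hirr.degree_pos hmon hf
      obtain ⟨g, hfg, hg⟩ := hfin.exists_eq_pow_mul_and_not_dvd
      set e := multiplicity h f with he
      rcases Nat.even_or_odd e with hev | hodd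
      · have hg0 : g ≠ 0 := by
          rintro rfl
          exact hg (dvd_zero h)
        have he0 : e ≠ 0 := by
          intro h0
          rw [h0, pow_zero, one_mul] at hfg
          exact hg (hfg ▸ hdvd)
        have hlt : g.natDegree < d := by
          rw [← hd, hfg, natDegree_mul (pow_ne_zero _ hirr.ne_zero) hg0, natDegree_pow]
          have := hirr.natDegree_pos
          have := Nat.mul_pos (Nat.pos_of_ne_zero he0) this
          omega
        obtain ⟨m, hm⟩ := hev
        rcases ih _ hlt g hg0 rfl with ⟨h', g', e', hmon', hirr', hodd', hnd, hgg⟩ | ⟨κ, s, hκ, hs⟩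
        · refine Or.inl ⟨h', h ^ e * g', e', hmon', hirr', hodd', fun hd' => ?_, ?_⟩
          · rcases hirr'.prime.dvd_or_dvd hd' with h1 | h1
            · have h2 : h' ∣ h := hirr'.prime.dvd_of_dvd_pow h1
              have h3 : h ∣ h' := (hirr'.dvd_symm hirr) h2
              apply hg
              rw [hgg]
              exact (h3.trans (dvd_pow_self h' hodd'.pos.ne')).mul_right _
            · exact hnd h1
          · rw [hfg, hgg]; ring
        · refine Or.inr ⟨κ, h ^ m * s, hκ, ?_⟩
          rw [hfg, hs, hm]; ring
      · exact Or.inl ⟨h, g, e, hmon, hirr, hodd, hg, hfg⟩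

/-- If a factor of `f` has odd multiplicity `e`, a polynomial `B` can be changed so that its
resultant with `f` is multiplied by `ν ^ e`, for a nonsquare `ν`: one prescribes `B` modulo the
factor, whose residue field has surjective norm, and leaves it unchanged modulo the cofactor. -/
theorem Polynomial.exists_resultant_eq_nonsquare_mul {k : Type*} [Field k] [Finite k]
    (hk : ringChar k ≠ 2) {n : ℕ} {f h g B : k[X]} {e : ℕ} (hfn : f.natDegree ≤ n)
    (hmon : h.Monic) (hirr : Irreducible h) (he : Odd e) (hg : ¬ h ∣ g) (hfg : f = h ^ e * g)
    (hB : B.natDegree ≤ n - 1) :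
    ∃ A : k[X], A.natDegree ≤ n - 1 ∧
      ∃ ν : k, ¬ IsSquare ν ∧ f.resultant A n (n - 1) = ν * f.resultant B n (n - 1) := by
  have : Fact (Irreducible h) := ⟨hirr⟩
  let L := AdjoinRoot h
  let ξ : L := AdjoinRoot.root h
  have : Module.Finite k L := (AdjoinRoot.powerBasis hirr.ne_zero).finite
  have : Finite L := Module.finite_of_finite k
  have hg0 : g ≠ 0 := by
    rintro rfl
    exact hg (dvd_zero h)
  have hd := hirr.natDegree_pos
  have hed : e * h.natDegree + g.natDegree ≤ n := by
    rwa [hfg, natDegree_mul (pow_ne_zero _ hirr.ne_zero) hg0, natDegree_pow] at hfn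
  have hde : h.natDegree ≤ e * h.natDegree := Nat.le_mul_of_pos_left _ he.pos
  have hsplit : ∀ A : k[X], A.natDegree ≤ n - 1 → f.resultant A n (n - 1) =
      Algebra.norm k (aeval ξ A) ^ e * g.resultant A (n - e * h.natDegree) (n - 1) := by
    intro A hA
    have h1 := AdjoinRoot.norm_aeval_root hirr.ne_zero A hA
    rw [hmon.leadingCoeff, one_pow, mul_one] at h1
    rw [h1, ← resultant_pow_left_of_le _ _ le_rfl hA, ← resultant_mul_left_of_le _ _ _
      (natDegree_pow_le) (by omega) hA, ← hfg]
    congr 1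
    omega
  have haeval : ∀ q : k[X], aeval ξ q = 0 ↔ h ∣ q := by
    intro q
    rw [AdjoinRoot.aeval_eq]
    exact AdjoinRoot.mk_eq_zero
  have hgξ : aeval ξ g ≠ 0 := fun h0 => hg ((haeval g).1 h0)
  obtain ⟨ν, hν⟩ := FiniteField.exists_nonsquare hk
  obtain ⟨γ, hγ⟩ := FiniteField.norm_surjective k L ν
  -- `B + g C` is `γ B` modulo `h` and `B` modulo `g`
  obtain ⟨C, hC, hCξ⟩ : ∃ C : k[X], C.natDegree < h.natDegree ∧
      aeval ξ C = (γ - 1) * aeval ξ B / aeval ξ g := by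
    obtain ⟨C, hC, hCξ⟩ := (AdjoinRoot.powerBasis hirr.ne_zero).exists_eq_aeval
      ((γ - 1) * aeval ξ B / aeval ξ g)
    exact ⟨C, hC, hCξ.symm⟩
  have hA : (B + g * C).natDegree ≤ n - 1 := by
    refine natDegree_add_le_of_degree_le hB (natDegree_mul_le.trans ?_)
    omega
  have hAξ : aeval ξ (B + g * C) = γ * aeval ξ B := by
    rw [map_add, map_mul, hCξ, mul_div_cancel₀ _ hgξ]
    ring
  refine ⟨B + g * C, hA, ν ^ e, ?_, ?_⟩
  · obtain ⟨m, rfl⟩ := he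
    rintro ⟨s, hs⟩
    have hν0 : ν ≠ 0 := by
      rintro rfl
      exact hν ⟨0, by simp⟩
    apply hν
    refine ⟨s / ν ^ m, ?_⟩
    rw [div_mul_div_comm, ← hs]
    field_simp
    ring
  · rw [hsplit _ hA, hsplit _ hB, hAξ, map_mul, hγ, mul_pow, resultant_add_mul_right _ _ _ _ _
      (by omega) (by omega)]
    ring

end Resultants

/-! ### Squares of `p`-adic units -/

section PadicSquares

variable {p : ℕ} [Fact p.Prime]

theorem PadicInt.isUnit_iff_toZMod_ne_zero {x : ℤ_[p]} : IsUnit x ↔ PadicInt.toZMod x ≠ 0 := by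
  rw [← not_iff_not, not_not, ← RingHom.mem_ker, PadicInt.ker_toZMod, IsLocalRing.mem_maximalIdeal]
  rfl

theorem PadicInt.exists_eq_p_mul_of_toZMod_eq_zero {x : ℤ_[p]} (h : PadicInt.toZMod x = 0) :
    ∃ y, x = p * y := by
  rw [← RingHom.mem_ker, PadicInt.ker_toZMod, PadicInt.maximalIdeal_eq_span_p,
    Ideal.mem_span_singleton] at h
  exact h

theorem PadicInt.exists_sq_eq_of_eq_one_add {r : ℤ_[p]ˣ} {y : ℤ_[p]}
    (h : (r : ℤ_[p]) = 1 + 4 * p * y) :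
    ∃ s : ℤ_[p]ˣ, s ^ 2 = r :=
  exists_sq_eq_of_mem_unitsOneMod (Module.Basis.singleton Unit ℤ_[p])
    (mem_unitsOneMod_iff.2 ⟨y, h⟩)

theorem PadicInt.exists_sq_eq_of_isSquare_toZMod (hp : p ≠ 2) {r : ℤ_[p]ˣ}
    (h : IsSquare (PadicInt.toZMod (r : ℤ_[p]))) : ∃ s : ℤ_[p]ˣ, s ^ 2 = r := by
  obtain ⟨a, ha⟩ := h
  obtain ⟨b, rfl⟩ := ZMod.ringHom_surjective (PadicInt.toZMod (p := p)) a
  have hr : PadicInt.toZMod (r : ℤ_[p]) ≠ 0 := PadicInt.isUnit_iff_toZMod_ne_zero.1 r.isUnit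
  have hb : IsUnit b := by
    rw [PadicInt.isUnit_iff_toZMod_ne_zero]
    intro h0
    rw [h0, mul_zero] at ha
    exact hr ha
  obtain ⟨b, rfl⟩ := hb
  have h4 : IsUnit (4 : ℤ_[p]) := by
    rw [PadicInt.isUnit_iff_toZMod_ne_zero]
    have h2 : (2 : ZMod p) ≠ 0 := by
      intro h0
      have h1 : ((2 : ℕ) : ZMod p) = 0 := by exact_mod_cast h0
      rw [ZMod.natCast_eq_zero_iff] at h1
      exact hp ((Nat.prime_dvd_prime_iff_eq Fact.out Nat.prime_two).1 h1)
    have : (PadicInt.toZMod (4 : ℤ_[p])) = 2 * 2 := by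
      rw [map_ofNat]; norm_num
    rw [this]
    exact mul_ne_zero h2 h2
  obtain ⟨q, hq⟩ := h4
  obtain ⟨y, hy⟩ := PadicInt.exists_eq_p_mul_of_toZMod_eq_zero
    (x := (r : ℤ_[p]) - (b : ℤ_[p]) * (b : ℤ_[p])) (by rw [map_sub, ha, map_mul, sub_self])
  obtain ⟨s, hs⟩ := PadicInt.exists_sq_eq_of_eq_one_add (r := r * (b⁻¹) ^ 2)
    (y := ((q⁻¹ : ℤ_[p]ˣ) : ℤ_[p]) * ((b⁻¹ : ℤ_[p]ˣ) : ℤ_[p]) ^ 2 * y) (by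
      have hb1 : (b : ℤ_[p]) * ((b⁻¹ : ℤ_[p]ˣ) : ℤ_[p]) = 1 := b.mul_inv
      have hq1 : (4 : ℤ_[p]) * ((q⁻¹ : ℤ_[p]ˣ) : ℤ_[p]) = 1 := by rw [← hq]; exact q.mul_inv
      rw [Units.val_mul, Units.val_pow_eq_pow_val]
      linear_combination ((b⁻¹ : ℤ_[p]ˣ) : ℤ_[p]) ^ 2 * hy +
        (b * ((b⁻¹ : ℤ_[p]ˣ) : ℤ_[p]) + 1) * hb1 -
        p * ((b⁻¹ : ℤ_[p]ˣ) : ℤ_[p]) ^ 2 * y * hq1)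
  refine ⟨s * b, ?_⟩
  rw [mul_pow, hs, mul_assoc, ← mul_pow, inv_mul_cancel, one_pow, mul_one]

theorem PadicInt.even_or_odd (x : ℤ_[2]) : ∃ y, x = 2 * y ∨ x = 1 + 2 * y := by
  have h : ∀ a : ZMod 2, a = 0 ∨ a - 1 = 0 := by decide
  rcases h (PadicInt.toZMod x) with h | h
  · obtain ⟨y, hy⟩ := PadicInt.exists_eq_p_mul_of_toZMod_eq_zero h
    exact ⟨y, Or.inl (by exact_mod_cast hy)⟩
  · obtain ⟨y, hy⟩ := PadicInt.exists_eq_p_mul_of_toZMod_eq_zero (x := x - 1)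
      (by rw [map_sub, map_one, h])
    refine ⟨y, Or.inr ?_⟩
    have : x - 1 = 2 * y := by exact_mod_cast hy
    linear_combination this

theorem PadicInt.exists_eq_one_add_of_isUnit {x : ℤ_[2]} (hx : IsUnit x) :
    ∃ y, x = 1 + 2 * y := by
  obtain ⟨y, hy | hy⟩ := PadicInt.even_or_odd x
  · rw [PadicInt.isUnit_iff_toZMod_ne_zero, hy, map_mul] at hx
    exact absurd (by rw [map_ofNat, show (OfNat.ofNat 2 : ZMod 2) = 0 from rfl, zero_mul]) hx
  · exact ⟨y, hy⟩

/-- A subgroup of `ℤ_[2] ^ ×` which contains the squares, an element `≡ 3` modulo `4` and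
an element `≡ 5` modulo `8` is everything. -/
theorem PadicInt.mem_of_mem_of_mem (N : Subgroup ℤ_[2]ˣ) (hsq : ∀ s : ℤ_[2]ˣ, s ^ 2 ∈ N)
    {u v : ℤ_[2]ˣ} (hu : u ∈ N) (hv : v ∈ N) {a b : ℤ_[2]} (ha : (u : ℤ_[2]) = 3 + 4 * a)
    (hb : (v : ℤ_[2]) = 5 + 8 * b) (r : ℤ_[2]ˣ) : r ∈ N := by
  have h8 : ∀ (r : ℤ_[2]ˣ) (y : ℤ_[2]), (r : ℤ_[2]) = 1 + 8 * y → r ∈ N := by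
    intro r y hy
    obtain ⟨s, rfl⟩ := PadicInt.exists_sq_eq_of_eq_one_add (r := r) (y := y) (by
      rw [hy]; push_cast; ring)
    exact hsq s
  have h4 : ∀ (r : ℤ_[2]ˣ) (y : ℤ_[2]), (r : ℤ_[2]) = 1 + 4 * y → r ∈ N := by
    intro r y hy
    obtain ⟨z, rfl | rfl⟩ := PadicInt.even_or_odd y
    · exact h8 r z (by rw [hy]; ring)
    · refine (Subgroup.mul_mem_cancel_right N hv).1
        (h8 (r * v) (3 + 5 * z + b * (5 + 8 * z)) ?_)
      rw [Units.val_mul, hy, hb]; ring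
  obtain ⟨y, hy⟩ := PadicInt.exists_eq_one_add_of_isUnit r.isUnit
  obtain ⟨z, rfl | rfl⟩ := PadicInt.even_or_odd y
  · exact h4 r z (by rw [hy]; ring)
  · refine (Subgroup.mul_mem_cancel_right N hu).1
      (h4 (r * u) (2 + 3 * z + a * (3 + 4 * z)) ?_)
    rw [Units.val_mul, hy, ha]; ring

end PadicSquares

namespace BinForm

/-! ### Norms of units of `R_F` -/

section UnitNorms

open Polynomial

variable {R : Type*} [CommRing R] {n : ℕ} (F : BinForm R n)
variable (K : Type*) [Field K] [Algebra R K]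

theorem coeff_poly {i : ℕ} (hi : i ≤ n) : F.poly.coeff (n - i) = F.c i := by
  rw [poly_eq, finsetSum_coeff, Finset.sum_eq_single i]
  · rw [coeff_C_mul, coeff_X_pow, if_pos rfl, mul_one]
  · intro j hj hji
    have := Finset.mem_range.1 hj
    rw [coeff_C_mul, coeff_X_pow, if_neg (by omega), mul_zero]
  · intro h
    exact absurd (Finset.mem_range.2 (by omega)) h

theorem poly_ne_zero_of_isPrimitive {k : Type*} [Field k] (φ : R →+* k) (hF : F.IsPrimitive) :
    F.poly.map φ ≠ 0 := by
  intro h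
  have h1 : ∀ i : Fin (n + 1), F.f i ∈ RingHom.ker φ := by
    intro i
    have h2 : F.poly.coeff (n - i) = F.f i := by
      rw [F.coeff_poly (by omega), c, dif_pos i.2]
    rw [RingHom.mem_ker, ← h2, ← coeff_map, h, coeff_zero]
  have h2 : Ideal.span (Set.range F.f) ≤ RingHom.ker φ := by
    rw [Ideal.span_le]
    rintro _ ⟨i, rfl⟩
    exact h1 i
  rw [hF] at h2
  have := h2 (Submodule.mem_top : (1 : R) ∈ _)
  rw [RingHom.mem_ker, map_one] at this
  exact one_ne_zero this

theorem exists_aeval_eq_of_mem_IF {x : F.KF K} (hx : x ∈ F.IF K (n - 1)) :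
    ∃ A : R[X], A.natDegree ≤ n - 1 ∧ aeval (F.theta K) A = x := by
  have hn := F.deg_pos
  have h := F.lattice_induction K (k := n - 1)
    (P := (degreeLT R n).map (aeval (F.theta K)).toLinearMap) (fun j _ hjn => ?_)
    (fun i h1 h2 => absurd h2 (by omega)) hx
  · obtain ⟨A, hA, rfl⟩ := h
    refine ⟨A, ?_, rfl⟩
    have h1 : A.degree < n := mem_degreeLT.1 hA
    by_cases hA0 : A = 0
    · rw [hA0, natDegree_zero]; omega
    · have := (natDegree_lt_iff_degree_lt hA0).2 h1
      omega
  · refine ⟨X ^ j, mem_degreeLT.2 ?_, by simp⟩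
    exact (degree_X_pow_le j).trans_lt (by exact_mod_cast hjn)

theorem aeval_mem_IF {A : R[X]} (hA : A.natDegree ≤ n - 1) :
    aeval (F.theta K) A ∈ F.IF K (n - 1) := by
  have hn := F.deg_pos
  have h : aeval (F.theta K) A ∈ (F.IF K (n - 1)).restrictScalars R := by
    rw [aeval_eq_sum_range' (n := n) (by omega)]
    refine Submodule.sum_mem _ fun j hj => Submodule.smul_mem _ _ ?_
    have := Finset.mem_range.1 hj
    exact F.theta_pow_mem K (k := n - 1) (by omega) this
  exact h

variable [IsFractionRing R K]

theorem norm_aeval_theta {A : R[X]} (hA : A.natDegree ≤ n - 1) :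
    Algebra.norm K (aeval (F.theta K) A) =
      algebraMap R K (F.poly.resultant A n (n - 1)) * F.normIF K (n - 1) := by
  have hn := F.deg_pos
  have h1 := AdjoinRoot.norm_aeval_root (F.map_ne_zero K) (A.map (algebraMap R K))
    (natDegree_map_le.trans hA)
  have h2 : aeval (AdjoinRoot.root (F.poly.map (algebraMap R K))) (A.map (algebraMap R K)) =
      aeval (F.theta K) A := aeval_map_algebraMap K _ A
  have h3 : (F.poly.map (algebraMap R K)).leadingCoeff = algebraMap R K (F.c 0) := by
    rw [leadingCoeff, natDegree_map, coeff_map, coeff_poly_n]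
  rw [h2, h3, natDegree_map, resultant_map_map] at h1
  have h4 := F.normIF_mul_pow K (k := n - 1) (by omega)
  rw [← h1, mul_assoc, mul_comm (_ ^ _), h4, mul_one]

/-- A polynomial of degree at most `n - 1` whose resultant with `F` is a unit gives a generator of
`I_F ^ (n-1)`. -/
theorem IF_eq_smul_one_of_isUnit_resultant {A : R[X]} (hA : A.natDegree ≤ n - 1)
    (hres : IsUnit (F.poly.resultant A n (n - 1))) :
    ∃ κ : (F.KF K)ˣ, (κ : F.KF K) = aeval (F.theta K) A ∧
      F.IF K (n - 1) = κ • (1 : Submodule (F.RF K) (F.KF K)) := by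
  have hn := F.deg_pos
  have hN := F.norm_aeval_theta K hA
  have h0 : F.normIF K (n - 1) ≠ 0 := F.normIF_ne_zero K (by omega)
  obtain ⟨κ, hκ⟩ : IsUnit (aeval (F.theta K) A) := by
    refine isUnit_of_isUnit_norm (R := K) (IsUnit.mk0 _ ?_)
    rw [hN]
    exact mul_ne_zero (hres.map _).ne_zero h0
  obtain ⟨v, hv⟩ := hres
  refine ⟨κ, hκ, (F.eq_of_le_of_familyNorm_eq K (F.basisIF K (n - 1)) (F.basisSMulOne K κ) ?_ v
    ?_ ?_).symm⟩
  · rintro _ ⟨x, hx, rfl⟩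
    change (κ : F.KF K) * x ∈ _
    rw [hκ, mul_comm]
    exact (F.IF K (n - 1)).smul_mem (⟨x, (F.mem_one_iff K).1 hx⟩ : F.RF K) (F.aeval_mem_IF K hA)
  · simp only [coe_basisIF]
    exact h0
  · simp only [coe_basisIF, coe_basisSMulOne]
    rw [familyNorm_mul, familyNorm_gen_zero, mul_one, hκ, hN, hv]
    rfl

theorem unitNorm_mul_resultant_eq {A B : R[X]} (hA : A.natDegree ≤ n - 1)
    (hB : B.natDegree ≤ n - 1) {u : (F.RF K)ˣ}
    (h : ((u : F.RF K) : F.KF K) * aeval (F.theta K) B = aeval (F.theta K) A) :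
    (F.unitNorm K u : R) * F.poly.resultant B n (n - 1) = F.poly.resultant A n (n - 1) := by
  have hn := F.deg_pos
  apply IsFractionRing.injective R K
  have h1 := congrArg (Algebra.norm K) h
  have h0 : F.normIF K (n - 1) ≠ 0 := F.normIF_ne_zero K (by omega)
  rw [map_mul, F.norm_aeval_theta K hA, F.norm_aeval_theta K hB, ← algebraMap_unitNorm,
    ← mul_assoc] at h1
  rw [map_mul]
  exact mul_right_cancel₀ h0 h1

/-- Quotients `A(θ) / B(θ)` of polynomials of degree at most `n - 1` which are prime to `F` are
units of `R_F`. -/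
theorem exists_units_of_isUnit_resultant {A B : R[X]} (hA : A.natDegree ≤ n - 1)
    (hB : B.natDegree ≤ n - 1) (hAres : IsUnit (F.poly.resultant A n (n - 1)))
    (hBres : IsUnit (F.poly.resultant B n (n - 1))) :
    ∃ u : (F.RF K)ˣ,
      (F.unitNorm K u : R) * F.poly.resultant B n (n - 1) = F.poly.resultant A n (n - 1) := by
  obtain ⟨κ, hκ, hκI⟩ := F.IF_eq_smul_one_of_isUnit_resultant K hA hAres
  obtain ⟨μ, hμ, hμI⟩ := F.IF_eq_smul_one_of_isUnit_resultant K hB hBres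
  obtain ⟨u, hu⟩ := exists_units_of_smul_one_eq_one (F := F) (K := K) (κ := μ⁻¹ * κ) (by
    rw [mul_smul, ← hκI, hμI, inv_smul_smul])
  refine ⟨u, F.unitNorm_mul_resultant_eq K hA hB ?_⟩
  have h1 : ((u : F.RF K) : F.KF K) = ((μ⁻¹ * κ : (F.KF K)ˣ) : F.KF K) := congrArg Units.val hu
  rw [h1, ← hκ, ← hμ, ← Units.val_mul, mul_right_comm, inv_mul_cancel, one_mul]

/-- Every unit of `R_F` is such a quotient, with a prescribed denominator. -/
theorem exists_resultant_eq_unitNorm_mul {B : R[X]} (hB : B.natDegree ≤ n - 1) (u : (F.RF K)ˣ) :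
    ∃ A : R[X], A.natDegree ≤ n - 1 ∧
      (F.unitNorm K u : R) * F.poly.resultant B n (n - 1) = F.poly.resultant A n (n - 1) := by
  have h := (F.IF K (n - 1)).smul_mem (u : F.RF K) (F.aeval_mem_IF K hB)
  obtain ⟨A, hA, hAu⟩ := F.exists_aeval_eq_of_mem_IF K h
  exact ⟨A, hA, F.unitNorm_mul_resultant_eq K hA hB hAu.symm⟩

/-- For odd `n`, a constant `r` has norm `r ^ n = r (r ^ m) ^ 2`, where `n = 2 m + 1`. -/
theorem exists_unitNorm_eq_mul_sq_of_odd (hn : Odd n) (r : Rˣ) :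
    ∃ (u : (F.RF K)ˣ) (s : Rˣ), F.unitNorm K u = r * s ^ 2 := by
  obtain ⟨m, hm⟩ := hn
  refine ⟨Units.map (algebraMap R (F.RF K)).toMonoidHom r, r ^ m, Units.ext ?_⟩
  change Algebra.norm R (algebraMap R (F.RF K) r) = _
  rw [Algebra.norm_algebraMap_of_basis (F.basisRF K), Fintype.card_fin, ← pow_mul, ← pow_succ',
    Units.val_pow_eq_pow_val, mul_comm m 2, hm]

end UnitNorms

/-! ### The trace of `ζ_i` -/

section Trace

open Polynomial

variable {R : Type*} [CommRing R] {n : ℕ} (F : BinForm R n)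
variable (K : Type*) [Field K] [Algebra R K]

theorem sum_c_smul_theta_pow :
    ∑ a ∈ Finset.range (n + 1), F.c a • F.theta K ^ (n - a) = 0 := by
  rw [Finset.sum_range_succ, ← zeta, zeta_n, Nat.sub_self, pow_zero,
    ← Algebra.algebraMap_eq_smul_one,
    neg_add_cancel]

variable [IsFractionRing R K]

theorem algebraMap_leftMulMatrix_basisRF (x : F.RF K) (i j : Fin n) :
    algebraMap R K (Algebra.leftMulMatrix (F.basisRF K) x i j) =
      Algebra.leftMulMatrix (F.genBasis K 0) (x : F.KF K) i j := by
  rw [Algebra.leftMulMatrix_eq_repr_mul, Algebra.leftMulMatrix_eq_repr_mul]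
  have h : (x : F.KF K) * F.genBasis K 0 j =
      ∑ l, algebraMap R K ((F.basisRF K).repr (x * F.basisRF K j) l) • F.genBasis K 0 l := by
    have h1 := congrArg (Subtype.val : F.RF K → F.KF K)
      ((F.basisRF K).sum_repr (x * F.basisRF K j))
    rw [AddSubmonoidClass.coe_finsetSum] at h1
    simp only [coe_genBasis, ← coe_basisRF, algebraMap_smul]
    exact h1.symm
  rw [h, Module.Basis.repr_sum_self]

theorem trace_RF (x : F.RF K) :
    algebraMap R K (Algebra.trace R (F.RF K) x) = Algebra.trace K (F.KF K) (x : F.KF K) := by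
  rw [Algebra.trace_eq_matrix_trace (F.basisRF K), Algebra.trace_eq_matrix_trace (F.genBasis K 0),
    Matrix.trace, Matrix.trace, map_sum]
  exact Finset.sum_congr rfl fun i _ => F.algebraMap_leftMulMatrix_basisRF K x i i

/-- In the basis `1, θ, …, θ ^ (n-1)`, the diagonal entries of multiplication by `ζ_i` are
`0` (`n - i` times) and `-f_i` (`i` times). -/
theorem trace_zeta {i : ℕ} (hi : i < n) :
    Algebra.trace K (F.KF K) (F.zeta K i) = -(i * algebraMap R K (F.c i)) := by
  have hgen : ∀ j : Fin n, F.genBasis K (n - 1) j = F.theta K ^ (j : ℕ) := by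
    intro j
    rw [coe_genBasis, gen, if_pos (by omega)]
  have hcoord : ∀ (j : Fin n) (m : ℕ), m < n →
      (F.genBasis K (n - 1)).repr (F.theta K ^ m) j = if m = j then 1 else 0 := by
    intro j m hm
    rw [← hgen ⟨m, hm⟩, Module.Basis.repr_self, Finsupp.single_apply]
    simp only [Fin.ext_iff]
  have hsmul : ∀ (a : R) (x : F.KF K) (j : Fin n), (F.genBasis K (n - 1)).repr (a • x) j =
      algebraMap R K a * (F.genBasis K (n - 1)).repr x j := by
    intro a x j
    rw [← algebraMap_smul K a, map_smul, Finsupp.smul_apply, smul_eq_mul]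
  have hdiag : ∀ j : Fin n, (F.genBasis K (n - 1)).repr (F.zeta K i * F.theta K ^ (j : ℕ)) j =
      if n ≤ i + j then -algebraMap R K (F.c i) else 0 := by
    intro j
    have hlow : F.zeta K i * F.theta K ^ (j : ℕ) =
        ∑ a ∈ Finset.range i, F.c a • F.theta K ^ (i - a + j) := by
      rw [zeta, Finset.sum_mul]
      simp only [smul_mul_assoc, ← pow_add]
    by_cases hij : n ≤ i + j
    -- high powers are avoided by replacing `ζ_i` by the negative of the rest of `F(θ)`
    · have hrel : F.zeta K i * F.theta K ^ (j : ℕ) =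
          -∑ b ∈ Finset.range (n + 1 - i), F.c (i + b) • F.theta K ^ (j - b : ℕ) := by
        have h0 := F.sum_c_smul_theta_pow K
        rw [show n + 1 = i + (n + 1 - i) by omega, Finset.sum_range_add] at h0
        have h1 := congrArg (· * F.theta K ^ (i + j - n)) h0
        simp only [add_mul, Finset.sum_mul, smul_mul_assoc, ← pow_add, zero_mul] at h1
        rw [hlow, eq_neg_iff_add_eq_zero, ← h1]
        congr 1
        · refine Finset.sum_congr rfl fun a ha => ?_
          have := Finset.mem_range.1 ha
          congr 2
          omega
        · refine Finset.sum_congr rfl fun b hb => ?_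
          have := Finset.mem_range.1 hb
          congr 2
          omega
      rw [if_pos hij, hrel, map_neg, map_sum, Finsupp.neg_apply, Finsupp.finsetSum_apply,
        Finset.sum_eq_single 0]
      · rw [hsmul, hcoord _ _ (by omega), if_pos (by omega), mul_one, Nat.add_zero]
      · intro b hb hb0
        have := Finset.mem_range.1 hb
        rw [hsmul, hcoord _ _ (by omega), if_neg (by omega), mul_zero]
      · intro h
        exact absurd (Finset.mem_range.2 (by omega)) h
    · rw [if_neg hij, hlow, map_sum, Finsupp.finsetSum_apply]
      refine Finset.sum_eq_zero fun a ha => ?_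
      have := Finset.mem_range.1 ha
      rw [hsmul, hcoord _ _ (by omega), if_neg (by omega), mul_zero]
  rw [Algebra.trace_eq_matrix_trace (F.genBasis K (n - 1)), Matrix.trace]
  simp only [Matrix.diag_apply, Algebra.leftMulMatrix_eq_repr_mul, hgen, hdiag]
  rw [Fin.sum_univ_eq_sum_range (fun j => if n ≤ i + j then -algebraMap R K (F.c i) else 0) n,
    ← Finset.sum_filter, Finset.sum_const]
  have hcard : (Finset.filter (fun j => n ≤ i + j) (Finset.range n)).card = i := by
    have : Finset.filter (fun j => n ≤ i + j) (Finset.range n) = Finset.Ico (n - i) n := by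
      ext j
      simp only [Finset.mem_filter, Finset.mem_range, Finset.mem_Ico]
      omega
    rw [this, Nat.card_Ico]
    omega
  rw [hcard, nsmul_eq_mul, mul_neg]

end Trace

/-! ### Forms modulo `p` and even ramification -/

section EvenRamification

open Polynomial

variable {p : ℕ} [Fact p.Prime] {n : ℕ} (F : BinForm ℤ_[p] n)

theorem homogenize_poly {R : Type*} [CommRing R] {n : ℕ} (F : BinForm R n) :
    F.poly.homogenize n = F.form := by
  rw [poly, form, homogenize_finsetSum]
  refine Finset.sum_congr rfl fun i _ => ?_
  rw [homogenize_C_mul, homogenize_X_pow (Nat.sub_le _ _), ← mul_assoc,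
    show n - (n - (i : ℕ)) = i by omega]

/-- Even ramification in terms of the dehomogenized form. -/
theorem isEvenlyRamified_iff (hF : F.IsPrimitive) : F.IsEvenlyRamified ↔
    Even n ∧ ∃ (κ : ZMod p) (s : (ZMod p)[X]), κ ≠ 0 ∧
      F.poly.map PadicInt.toZMod = C κ * s ^ 2 := by
  have hdeg : (F.poly.map PadicInt.toZMod).natDegree ≤ n :=
    natDegree_map_le.trans F.natDegree_poly.le
  constructor
  · rintro ⟨hn, κ, H, h⟩
    refine ⟨hn, κ, MvPolynomial.aeval ![X, 1] H, κ.ne_zero, ?_⟩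
    have h1 := congrArg (MvPolynomial.aeval ![X, (1 : (ZMod p)[X])]) h
    rw [← homogenize_poly, ← homogenize_map, aeval_homogenize_X_one _ hdeg, map_mul, map_pow,
      ← MvPolynomial.algebraMap_eq, AlgHom.commutes] at h1
    exact h1
  · rintro ⟨hn, κ, s, hκ, h⟩
    obtain ⟨m, rfl⟩ := hn
    refine ⟨⟨m, rfl⟩, Units.mk0 κ hκ, s.homogenize m, ?_⟩
    have hs : s.natDegree ≤ m := by
      rw [h, natDegree_C_mul hκ, natDegree_pow] at hdeg
      omega
    rw [← homogenize_poly, ← homogenize_map, h, homogenize_C_mul, pow_two, homogenize_mul _ _ hs hs,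
      pow_two]
    rfl

end EvenRamification

/-! ### Which classes of units are norms -/

section NormClasses

open Polynomial

variable {p : ℕ} [Fact p.Prime] {n : ℕ} (F : BinForm ℤ_[p] n)

/-- Since `I_F ^ (n-1)` is principal, some polynomial of degree at most `n - 1` is prime to `F`,
even modulo `p`. -/
theorem exists_isUnit_resultant (hF : F.IsPrimitive) :
    ∃ B : ℤ_[p][X], B.natDegree ≤ n - 1 ∧ IsUnit (F.poly.resultant B n (n - 1)) := by
  have hn := F.deg_pos
  obtain ⟨δ, u, hδ, hu⟩ := F.exists_IF_eq_smul_one hF (k := n - 1) (by omega)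
  have hmem : (δ : F.KF ℚ_[p]) ∈ F.IF ℚ_[p] (n - 1) := by
    rw [hδ]
    exact ⟨1, Submodule.one_le.1 le_rfl, mul_one _⟩
  obtain ⟨B, hB, hBδ⟩ := F.exists_aeval_eq_of_mem_IF ℚ_[p] hmem
  refine ⟨B, hB, IsUnit.of_mul_eq_one (u : ℤ_[p]) ?_⟩
  have h1 := F.norm_aeval_theta ℚ_[p] hB
  rw [hBδ, hu, mul_left_comm, ← mul_assoc, mul_comm (algebraMap _ _ (u : ℤ_[p])), ← map_mul] at h1
  have h0 : Algebra.norm ℚ_[p] (δ : F.KF ℚ_[p]) ≠ 0 := (δ.isUnit.map (Algebra.norm ℚ_[p])).ne_zero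
  apply IsFractionRing.injective ℤ_[p] ℚ_[p]
  rw [map_one]
  exact (mul_right_cancel₀ h0 (by rw [one_mul]; exact h1)).symm

theorem resultant_map_toZMod (A : ℤ_[p][X]) :
    PadicInt.toZMod (F.poly.resultant A n (n - 1)) =
      (F.poly.map PadicInt.toZMod).resultant (A.map PadicInt.toZMod) n (n - 1) :=
  (resultant_map_map _ _ _ _ _).symm

/-- For odd `p`, an irreducible factor of odd multiplicity of `F` modulo `p` makes the norm of some
unit a nonsquare modulo `p`. -/
theorem exists_not_isSquare_toZMod_unitNorm (hp : p ≠ 2) (hF : F.IsPrimitive) (hn : Even n)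
    (hram : ¬ F.IsEvenlyRamified) :
    ∃ u : (F.RF ℚ_[p])ˣ, ¬ IsSquare (PadicInt.toZMod (F.unitNorm ℚ_[p] u : ℤ_[p])) := by
  obtain ⟨B, hB, hBres⟩ := F.exists_isUnit_resultant hF
  have hdeg : (F.poly.map PadicInt.toZMod).natDegree ≤ n :=
    natDegree_map_le.trans F.natDegree_poly.le
  rcases exists_odd_factor_or_eq_C_mul_sq (F.poly.map PadicInt.toZMod)
    (F.poly_ne_zero_of_isPrimitive _ hF) with ⟨h, g, e, hmon, hirr, he, hg, hfg⟩ | ⟨κ, s, hκ, hs⟩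
  · obtain ⟨A', hA', ν, hν, hres⟩ := exists_resultant_eq_nonsquare_mul
      (by rwa [ZMod.ringChar_zmod_n]) hdeg hmon hirr he hg hfg
      (natDegree_map_le.trans hB : (B.map (PadicInt.toZMod (p := p))).natDegree ≤ n - 1)
    obtain ⟨A, hA, hAdeg⟩ := exists_degree_eq_of_mem_lifts
      ((mem_lifts A').2 (map_surjective _ (ZMod.ringHom_surjective (PadicInt.toZMod (p := p))) A'))
    have hAn : A.natDegree ≤ n - 1 := by
      rwa [natDegree_eq_of_degree_eq hAdeg]
    rw [← hA, ← resultant_map_toZMod, ← resultant_map_toZMod] at hres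
    have hB0 := PadicInt.isUnit_iff_toZMod_ne_zero.1 hBres
    have hν0 : ν ≠ 0 := fun h0 => hν (h0 ▸ IsSquare.zero)
    have hAres : IsUnit (F.poly.resultant A n (n - 1)) := by
      rw [PadicInt.isUnit_iff_toZMod_ne_zero, hres]
      exact mul_ne_zero hν0 hB0
    obtain ⟨u, hu⟩ := F.exists_units_of_isUnit_resultant ℚ_[p] hAn hB hAres hBres
    refine ⟨u, ?_⟩
    rw [← hu, map_mul] at hres
    rwa [mul_right_cancel₀ hB0 hres]
  · exact absurd ((F.isEvenlyRamified_iff hF).2 ⟨hn, κ, s, hκ, hs⟩) hram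

/-- For odd `p`, unless `F` is evenly ramified, every unit of `ℤ_[p]` is a norm up to a square. -/
theorem exists_unitNorm_eq_mul_sq_of_ne_two (hp : p ≠ 2) (hF : F.IsPrimitive)
    (hram : ¬ F.IsEvenlyRamified) (r : ℤ_[p]ˣ) :
    ∃ (u : (F.RF ℚ_[p])ˣ) (s : ℤ_[p]ˣ), F.unitNorm ℚ_[p] u = r * s ^ 2 := by
  rcases Nat.even_or_odd n with hn | hn
  · by_cases hr : IsSquare (PadicInt.toZMod (r : ℤ_[p]))
    · obtain ⟨s, rfl⟩ := PadicInt.exists_sq_eq_of_isSquare_toZMod hp hr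
      exact ⟨1, s⁻¹, by rw [map_one, ← mul_pow, mul_inv_cancel, one_pow]⟩
    · obtain ⟨u, hu⟩ := F.exists_not_isSquare_toZMod_unitNorm hp hF hn hram
      -- the product of two nonsquares of `ZMod p` is a square
      have hsq : IsSquare (PadicInt.toZMod ((F.unitNorm ℚ_[p] u * r⁻¹ : ℤ_[p]ˣ) : ℤ_[p])) := by
        have hmul : F.unitNorm ℚ_[p] u * r⁻¹ = F.unitNorm ℚ_[p] u * r * r⁻¹ ^ 2 := by
          rw [pow_two, ← mul_assoc, mul_inv_cancel_right]
        have h1 := quadraticChar_neg_one_iff_not_isSquare.2 hu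
        have h2 := quadraticChar_neg_one_iff_not_isSquare.2 hr
        have h0 : PadicInt.toZMod ((F.unitNorm ℚ_[p] u * r : ℤ_[p]ˣ) : ℤ_[p]) ≠ 0 :=
          PadicInt.isUnit_iff_toZMod_ne_zero.1 (Units.isUnit _)
        rw [hmul, Units.val_mul, map_mul, Units.val_pow_eq_pow_val, map_pow]
        refine ((quadraticChar_one_iff_isSquare h0).1 ?_).mul (IsSquare.sq _)
        rw [Units.val_mul, map_mul, map_mul, h1, h2]
        rfl
      obtain ⟨s, hs⟩ := PadicInt.exists_sq_eq_of_isSquare_toZMod hp hsq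
      exact ⟨u, s, by rw [hs, mul_left_comm, mul_inv_cancel, mul_one]⟩
  · exact F.exists_unitNorm_eq_mul_sq_of_odd ℚ_[p] hn r

/-- If `F` is evenly ramified, all resultants with `F` lie in one square class modulo `p`. -/
theorem exists_unitNorm_eq_sq (hp : p ≠ 2) (hF : F.IsPrimitive) (hram : F.IsEvenlyRamified)
    (u : (F.RF ℚ_[p])ˣ) : ∃ s : ℤ_[p]ˣ, s ^ 2 = F.unitNorm ℚ_[p] u := by
  obtain ⟨⟨m, hm⟩, κ, s, hκ, hs⟩ := (F.isEvenlyRamified_iff hF).1 hram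
  obtain ⟨B, hB, hBres⟩ := F.exists_isUnit_resultant hF
  obtain ⟨A, hA, hAB⟩ := F.exists_resultant_eq_unitNorm_mul ℚ_[p] hB u
  have hsdeg : s.natDegree ≤ m := by
    have hdeg : (F.poly.map PadicInt.toZMod).natDegree ≤ n :=
      natDegree_map_le.trans F.natDegree_poly.le
    rw [hs, natDegree_C_mul hκ, natDegree_pow] at hdeg
    omega
  have hres : ∀ A : ℤ_[p][X], A.natDegree ≤ n - 1 → ∃ a,
      PadicInt.toZMod (F.poly.resultant A n (n - 1)) = κ ^ (n - 1) * a ^ 2 := by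
    intro A hA
    refine ⟨s.resultant (A.map PadicInt.toZMod) m (n - 1), ?_⟩
    have h1 := resultant_pow_left_of_le s (A.map (PadicInt.toZMod (p := p))) hsdeg
      (natDegree_map_le.trans hA) 2
    rw [resultant_map_toZMod, hs, ← h1, resultant_C_mul_left, two_mul, hm]
  obtain ⟨a, ha⟩ := hres A hA
  obtain ⟨b, hb⟩ := hres B hB
  have hB0 := PadicInt.isUnit_iff_toZMod_ne_zero.1 hBres
  apply PadicInt.exists_sq_eq_of_isSquare_toZMod hp
  rw [hb] at hB0
  have hb0 : b ≠ 0 := by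
    rintro rfl
    exact hB0 (by ring)
  refine ⟨a / b, ?_⟩
  have h2 := congrArg PadicInt.toZMod hAB
  rw [map_mul, ha, hb] at h2
  have h3 := mul_left_cancel₀ (pow_ne_zero (n - 1) hκ)
    (by linear_combination h2 : κ ^ (n - 1) *
      (PadicInt.toZMod (F.unitNorm ℚ_[p] u : ℤ_[p]) * b ^ 2) = κ ^ (n - 1) * a ^ 2)
  field_simp
  exact h3

end NormClasses

section NormClassesTwo

open Polynomial

variable {n : ℕ} (F : BinForm ℤ_[2] n)

/-- A form of even degree over `ℤ_[2]` all of whose odd coefficients are even is evenly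
ramified, being the square of a form modulo `2`. -/
theorem exists_odd_coeff_isUnit (hF : F.IsPrimitive) (hn : Even n) (hram : ¬ F.IsEvenlyRamified) :
    ∃ i < n, Odd i ∧ IsUnit (F.c i) := by
  by_contra! hcon
  refine hram ((F.isEvenlyRamified_iff hF).2 ⟨hn, 1,
    contract 2 (F.poly.map PadicInt.toZMod), one_ne_zero, ?_⟩)
  have hcoeff : ∀ j, ¬ 2 ∣ j → (F.poly.map (PadicInt.toZMod (p := 2))).coeff j = 0 := by
    intro j hj
    by_cases hjn : j ≤ n
    · obtain ⟨i, rfl⟩ := Nat.exists_eq_add_of_le hjn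
      have hjo : Odd j := Nat.odd_iff.2 (by omega)
      have hi : Odd i := by
        obtain ⟨m, hm⟩ := hn
        exact Nat.odd_iff.2 (by omega)
      have h1 := hcon i (by have := hjo.pos; omega) hi
      rw [PadicInt.isUnit_iff_toZMod_ne_zero, not_not] at h1
      have h2 := F.coeff_poly (i := i) (by omega)
      rw [Nat.add_sub_cancel] at h2
      rw [coeff_map, h2, h1]
    · exact coeff_eq_zero_of_natDegree_lt
        (natDegree_map_le.trans_lt (by rw [F.natDegree_poly]; omega))
  -- `s(x)² = s(x²)` over `ZMod 2`
  rw [C_1, one_mul, ← ZMod.expand_card]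
  ext j
  rw [coeff_expand two_pos]
  split_ifs with hj
  · rw [coeff_contract two_ne_zero, Nat.div_mul_cancel hj]
  · exact hcoeff j hj

/-- For `p = 2`, if `ζ_i` has unit trace, the norms of `1 + 2 ζ_i` and `1 + 4 ζ_i`
are `3` modulo `4` and `5` modulo `8`; together with the squares these generate `ℤ_[2] ^ ×`. -/
theorem exists_unitNorm_eq_mul_sq_of_eq_two (hF : F.IsPrimitive) (hram : ¬ F.IsEvenlyRamified)
    (r : ℤ_[2]ˣ) : ∃ (u : (F.RF ℚ_[2])ˣ) (s : ℤ_[2]ˣ), F.unitNorm ℚ_[2] u = r * s ^ 2 := by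
  rcases Nat.even_or_odd n with hn | hn
  · obtain ⟨i, hi, hodd, hci⟩ := F.exists_odd_coeff_isUnit hF hn hram
    let b : F.RF ℚ_[2] := ⟨F.zeta ℚ_[2] i, F.zeta_mem ℚ_[2] 0 hi.le⟩
    have hb : Algebra.trace ℤ_[2] (F.RF ℚ_[2]) b = -(i * F.c i) := by
      apply IsFractionRing.injective ℤ_[2] ℚ_[2]
      rw [trace_RF, F.trace_zeta ℚ_[2] hi, map_neg, map_mul, map_natCast]
    have hi1 : IsUnit (i : ℤ_[2]) := by
      rw [PadicInt.isUnit_iff_toZMod_ne_zero, map_natCast, Ne, ZMod.natCast_eq_zero_iff]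
      exact hodd.not_two_dvd_nat
    have htr : IsUnit (Algebra.trace ℤ_[2] (F.RF ℚ_[2]) b) := by
      rw [hb]
      exact (hi1.mul hci).neg
    obtain ⟨t, ht⟩ := PadicInt.exists_eq_one_add_of_isUnit htr
    let S : Subgroup ℤ_[2]ˣ := (F.unitNorm ℚ_[2]).range ⊔ (powMonoidHom 2).range
    have := Module.Free.of_basis (F.basisRF ℚ_[2])
    have := Module.Finite.of_basis (F.basisRF ℚ_[2])
    have hunit : ∀ x : F.RF ℚ_[2], ∃ u : (F.RF ℚ_[2])ˣ, (u : F.RF ℚ_[2]) = 1 + (2 : ℤ_[2]) • x := by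
      intro x
      obtain ⟨u, hu⟩ := isUnit_one_add_p_mul (p := 2) x
      refine ⟨u, ?_⟩
      rw [hu, Algebra.smul_def, map_ofNat, Nat.cast_ofNat]
    obtain ⟨u, hu⟩ := hunit b
    obtain ⟨v, hv⟩ := hunit ((2 : ℤ_[2]) • b)
    obtain ⟨a, ha⟩ := Algebra.norm_one_add_smul (2 : ℤ_[2]) b
    obtain ⟨a', ha'⟩ := Algebra.norm_one_add_smul (4 : ℤ_[2]) b
    have key : r⁻¹ ∈ S := by
      refine PadicInt.mem_of_mem_of_mem S (fun s => Subgroup.mem_sup_right ⟨s, rfl⟩)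
        (u := F.unitNorm ℚ_[2] u) (v := F.unitNorm ℚ_[2] v)
        (Subgroup.mem_sup_left ⟨u, rfl⟩) (Subgroup.mem_sup_left ⟨v, rfl⟩)
        (a := t + a) (b := t + 2 * a') ?_ ?_ _
      · change Algebra.norm ℤ_[2] (u : F.RF ℚ_[2]) = _
        rw [hu, ha, ht]
        ring
      · change Algebra.norm ℤ_[2] (v : F.RF ℚ_[2]) = _
        rw [hv, smul_smul, show (2 : ℤ_[2]) * 2 = 4 by norm_num, ha', ht]
        ring
    obtain ⟨_, ⟨w, rfl⟩, _, ⟨s, rfl⟩, hws⟩ := Subgroup.mem_sup.1 key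
    refine ⟨w⁻¹, s, ?_⟩
    rw [map_inv, ← inv_inv r, ← hws, powMonoidHom_apply, mul_inv, inv_mul_cancel_right]
  · exact F.exists_unitNorm_eq_mul_sq_of_odd ℚ_[2] hn r

end NormClassesTwo

end BinForm

/-! ### Counting classes of units modulo squares -/

section PadicCounts

variable {p : ℕ} [Fact p.Prime]

theorem PadicInt.card_quotient_span_two_of_ne_two (hp : p ≠ 2) :
    Nat.card (ℤ_[p] ⧸ Ideal.span {(2 : ℤ_[p])}) = 1 := by
  have h2 : IsUnit (2 : ℤ_[p]) := by
    rw [PadicInt.isUnit_iff_toZMod_ne_zero, ← Nat.cast_ofNat, map_natCast, Ne,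
      ZMod.natCast_eq_zero_iff]
    exact fun h => hp ((Nat.prime_dvd_prime_iff_eq Fact.out Nat.prime_two).1 h)
  have := Ideal.Quotient.subsingleton_iff.2 (Ideal.span_singleton_eq_top.2 h2)
  exact Nat.card_of_subsingleton 0

theorem PadicInt.card_quotient_span_two :
    Nat.card (ℤ_[2] ⧸ Ideal.span {(2 : ℤ_[2])}) = 2 := by
  have h : Ideal.span {(2 : ℤ_[2])} = RingHom.ker (PadicInt.toZMod (p := 2)) := by
    rw [PadicInt.ker_toZMod, PadicInt.maximalIdeal_eq_span_p, Nat.cast_ofNat]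
  rw [h, Nat.card_congr (RingHom.quotientKerEquivOfSurjective
    (ZMod.ringHom_surjective (PadicInt.toZMod (p := 2)))).toEquiv, Nat.card_zmod]

theorem PadicInt.card_units_sq_eq_one : Nat.card (powMonoidHom 2 : ℤ_[p]ˣ →* ℤ_[p]ˣ).ker = 2 := by
  have h : ((powMonoidHom 2 : ℤ_[p]ˣ →* ℤ_[p]ˣ).ker : Set ℤ_[p]ˣ) = {1, -1} := by
    ext x
    simp only [SetLike.mem_coe, MonoidHom.mem_ker, powMonoidHom_apply, Set.mem_insert_iff,
      Set.mem_singleton_iff, Units.ext_iff, Units.val_pow_eq_pow_val, Units.val_one, Units.val_neg]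
    exact sq_eq_one_iff
  have hne : (1 : ℤ_[p]ˣ) ≠ -1 := by
    intro h
    have h1 : (1 : ℤ_[p]) = -1 := congrArg Units.val h
    exact two_ne_zero (by linear_combination h1 : (2 : ℤ_[p]) = 0)
  change Nat.card ((powMonoidHom 2 : ℤ_[p]ˣ →* ℤ_[p]ˣ).ker : Set ℤ_[p]ˣ) = 2
  rw [h, Nat.card_coe_set_eq, Set.ncard_pair hne]

end PadicCounts

namespace BinForm

section Counts

variable {p : ℕ} [Fact p.Prime] {n : ℕ} (F : BinForm ℤ_[p] n)

theorem finite_units2 : Finite (F.units2 ℚ_[p]) := (card_units_quot_sq (F.basisRF ℚ_[p])).1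

theorem finite_unitsModSq : Finite (F.UnitsModSq ℚ_[p]) := by
  have h := card_units_quot_sq (F.basisRF ℚ_[p])
  have := h.1
  have := PadicInt.finite_quotient_span (two_ne_zero : (2 : ℤ_[p]) ≠ 0)
  apply Nat.finite_of_card_ne_zero
  rw [h.2]
  exact mul_ne_zero Nat.card_pos.ne' (pow_ne_zero _ Nat.card_pos.ne')

/-- If every unit of `ℤ_[p]` is a norm modulo squares, the map `normModSq` is onto a group of order
`2 · #(ℤ_[p] / 2)`, from a group of order `#R_F ^ × [2] · #(ℤ_[p] / 2) ^ n`. -/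
theorem two_mul_card_unitsModSqOfNorm
    (h : ∀ r : ℤ_[p]ˣ, ∃ (u : (F.RF ℚ_[p])ˣ) (s : ℤ_[p]ˣ), F.unitNorm ℚ_[p] u = r * s ^ 2)
    (r : ℤ_[p]ˣ) :
    2 * Nat.card (F.unitsModSqOfNorm ℚ_[p] r) = Nat.card (F.units2 ℚ_[p]) *
      Nat.card (ℤ_[p] ⧸ Ideal.span {(2 : ℤ_[p])}) ^ (n - 1) := by
  have hn := F.deg_pos
  have hG := (card_units_quot_sq (F.basisRF ℚ_[p])).2
  have hH := (card_units_quot_sq (Module.Basis.singleton Unit ℤ_[p])).2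
  have := PadicInt.finite_quotient_span (two_ne_zero : (2 : ℤ_[p]) ≠ 0)
  have hq : 0 < Nat.card (ℤ_[p] ⧸ Ideal.span {(2 : ℤ_[p])}) := Nat.card_pos
  rw [PadicInt.card_units_sq_eq_one, Fintype.card_unit, pow_one] at hH
  have : Finite (ℤ_[p]ˣ ⧸ (powMonoidHom 2 : ℤ_[p]ˣ →* ℤ_[p]ˣ).range) :=
    Nat.finite_of_card_ne_zero (by rw [hH]; positivity)
  have hsurj : Function.Surjective (F.normModSq ℚ_[p]) := by
    intro ρ
    obtain ⟨s, rfl⟩ := QuotientGroup.mk_surjective ρ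
    obtain ⟨u, hu⟩ := h s
    exact ⟨QuotientGroup.mk u, mk_mem_unitsModSqOfNorm_iff.2 hu⟩
  have hfib := card_fiber_mul_card (F.normModSq ℚ_[p]) hsurj (QuotientGroup.mk r)
  rw [hH, hG, Fintype.card_fin] at hfib
  have hpow : Nat.card (ℤ_[p] ⧸ Ideal.span {(2 : ℤ_[p])}) ^ n =
      Nat.card (ℤ_[p] ⧸ Ideal.span {(2 : ℤ_[p])}) ^ (n - 1) *
        Nat.card (ℤ_[p] ⧸ Ideal.span {(2 : ℤ_[p])}) := by
    rw [← pow_succ, Nat.sub_add_cancel hn]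
  refine Nat.eq_of_mul_eq_mul_right hq ?_
  rw [hpow, ← mul_assoc, ← mul_assoc, mul_comm _ 2] at hfib
  exact hfib

theorem unitsModSqOfNorm_eq_univ (h : ∀ u, ∃ s : ℤ_[p]ˣ, s ^ 2 = F.unitNorm ℚ_[p] u)
    {r : ℤ_[p]ˣ} (hr : IsSquare r) : F.unitsModSqOfNorm ℚ_[p] r = Set.univ := by
  rw [Set.eq_univ_iff_forall]
  intro ρ
  obtain ⟨u, rfl⟩ := QuotientGroup.mk_surjective ρ
  obtain ⟨s, hs⟩ := h u
  obtain ⟨t, rfl⟩ := hr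
  refine mk_mem_unitsModSqOfNorm_iff.2 ⟨t⁻¹ * s, ?_⟩
  rw [mul_pow, ← mul_assoc, ← pow_two, inv_pow, mul_inv_cancel, one_mul, hs]

theorem unitsModSqOfNorm_eq_empty (h : ∀ u, ∃ s : ℤ_[p]ˣ, s ^ 2 = F.unitNorm ℚ_[p] u)
    {r : ℤ_[p]ˣ} (hr : ¬ IsSquare r) : F.unitsModSqOfNorm ℚ_[p] r = ∅ := by
  rw [Set.eq_empty_iff_forall_notMem]
  intro ρ hρ
  obtain ⟨u, rfl⟩ := QuotientGroup.mk_surjective ρ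
  obtain ⟨s, hs⟩ := h u
  obtain ⟨t, ht⟩ := mk_mem_unitsModSqOfNorm_iff.1 hρ
  refine hr ⟨s * t⁻¹, ?_⟩
  rw [← pow_two, mul_pow, hs, ht, inv_pow, mul_inv_cancel_right]

end Counts

/-! ### Orbits and stabilizers over `ℤ_[p]` -/

section Main

variable {p : ℕ} [Fact p.Prime] {n : ℕ} (F : BinForm ℤ_[p] n)

theorem nonempty_stabilizer_mulEquiv (hn : 3 ≤ n) {r : ℤ_[p]ˣ} {T : SymPair ℤ_[p] n}
    (hT : (Quotient.mk _ T : MulAction.orbitRel.Quotient (Gn ℤ_[p] n) (SymPair ℤ_[p] n)) ∈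
      F.orb ℚ_[p] r '' F.HStar ℚ_[p] r) :
    Nonempty (MulAction.stabilizer (Gn ℤ_[p] n) T ≃* IdealPair.stabGroup F ℚ_[p]) := by
  obtain ⟨_, ⟨P, hP, rfl⟩, h⟩ := hT
  obtain ⟨κ, hκ⟩ := F.exists_smul_one_of_isUnit P.I hP
  obtain ⟨e⟩ := IdealPair.nonempty_stabilizer_mulEquiv hn P hκ
  have hrel : MulAction.orbitRel (Gn ℤ_[p] n) (SymPair ℤ_[p] n) P.matrices T := Quotient.exact h
  exact ⟨(MulAction.stabilizerEquivStabilizerOfOrbitRel hrel).symm.trans e⟩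

end Main

end BinForm

theorem mainTheorem8 (p : ℕ) [Fact p.Prime] (n : ℕ) (hn : 3 ≤ n) (F : BinForm ℤ_[p] n)
    (hprim : F.IsPrimitive) (hsep : (F.poly.map (algebraMap ℤ_[p] ℚ_[p])).Separable)
    (r : ℤ_[p]ˣ) :
    Nonempty (F.orb ℚ_[p] r '' F.HStar ℚ_[p] r ≃ F.unitsModSqOfNorm ℚ_[p] r) ∧
    Finite (F.units2 ℚ_[p]) ∧
    (p ≠ 2 → ¬ F.IsEvenlyRamified →
      2 * (F.orb ℚ_[p] r '' F.HStar ℚ_[p] r).encard = ENat.card (F.units2 ℚ_[p])) ∧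
    (p ≠ 2 → F.IsEvenlyRamified → IsSquare r →
      (F.orb ℚ_[p] r '' F.HStar ℚ_[p] r).encard = ENat.card (F.units2 ℚ_[p])) ∧
    (p ≠ 2 → F.IsEvenlyRamified → ¬ IsSquare r →
      (F.orb ℚ_[p] r '' F.HStar ℚ_[p] r).encard = 0) ∧
    (p = 2 → F.IsMaximalOrder ℚ_[p] → ¬ F.IsEvenlyRamified →
      (F.orb ℚ_[p] r '' F.HStar ℚ_[p] r).encard = 2 ^ (n - 2) * ENat.card (F.units2 ℚ_[p])) ∧
    ∀ T : SymPair ℤ_[p] n,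
      (Quotient.mk _ T : MulAction.orbitRel.Quotient (Gn ℤ_[p] n) (SymPair ℤ_[p] n)) ∈
        F.orb ℚ_[p] r '' F.HStar ℚ_[p] r →
      (Odd n → Nonempty (MulAction.stabilizer (Gn ℤ_[p] n) T ≃* F.units2NormOne ℚ_[p])) ∧
      (Even n → Nonempty (MulAction.stabilizer (Gn ℤ_[p] n) T ≃* F.units2 ℚ_[p])) := by
  obtain ⟨D⟩ := F.nonempty_squareNormGenerator hn hprim
  obtain ⟨e⟩ := D.nonempty_orb_image_equiv (r := r) hn F.exists_smul_one_of_isUnit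
  have hfin := F.finite_units2
  have hfinG := F.finite_unitsModSq
  have hcard : (F.orb ℚ_[p] r '' F.HStar ℚ_[p] r).encard =
      (Nat.card (F.unitsModSqOfNorm ℚ_[p] r) : ℕ∞) := by
    rw [Set.encard, ENat.card_congr e, ENat.card_eq_coe_natCard]
  rw [ENat.card_eq_coe_natCard (F.units2 ℚ_[p]), hcard]
  refine ⟨⟨e⟩, hfin, fun hp hram => ?_, fun hp hram hr => ?_, fun hp hram hr => ?_,
    fun hp _ hram => ?_, fun T hT => ?_⟩
  · have h := F.two_mul_card_unitsModSqOfNorm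
      (F.exists_unitNorm_eq_mul_sq_of_ne_two hp hprim hram) r
    rw [PadicInt.card_quotient_span_two_of_ne_two hp, one_pow, mul_one] at h
    exact_mod_cast h
  · have h := (card_units_quot_sq (F.basisRF ℚ_[p])).2
    rw [PadicInt.card_quotient_span_two_of_ne_two hp, one_pow, mul_one] at h
    rw [F.unitsModSqOfNorm_eq_univ (F.exists_unitNorm_eq_sq hp hprim hram) hr,
      Nat.card_congr (Equiv.Set.univ _)]
    exact congrArg _ h
  · rw [F.unitsModSqOfNorm_eq_empty (F.exists_unitNorm_eq_sq hp hprim hram) hr]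
    simp
  · subst hp
    have h := F.two_mul_card_unitsModSqOfNorm
      (F.exists_unitNorm_eq_mul_sq_of_eq_two hprim hram) r
    rw [PadicInt.card_quotient_span_two, show n - 1 = (n - 2) + 1 by omega, pow_succ, ← mul_assoc,
      mul_comm _ 2] at h
    have h1 := Nat.eq_of_mul_eq_mul_left two_pos h
    rw [h1, mul_comm]
    push_cast
    rfl
  · obtain ⟨f⟩ := F.nonempty_stabilizer_mulEquiv hn hT
    exact ⟨fun ho => ⟨f.trans (MulEquiv.subgroupCongr (BinForm.stabGroup_of_odd ho))⟩,
      fun he => ⟨f.trans (MulEquiv.subgroupCongr (BinForm.stabGroup_of_even he))⟩⟩
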